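/- Notation. Let $H$ be a complex Hilbert space and $\mathcal A\subset B(H)$ a norm closed $*$-subalgebra containing $I$ (by the Gelfand–Naimark theorem, every unital $C^*$-algebra is of this form). $\mathcal A$ has real rank zero if each of its self-adjoint elements is a norm limit of self-adjoint elements of $\mathcal A$ with finite spectra. $M_2(\mathcal A)\subset B(H\oplus H)$ is the algebra of $2\times2$ matrices with entries in $\mathcal A$, $P=\begin{pmatrix}I&0\\0&0\end{pmatrix}$, and $\operatorname{diag}_PT=PTP+(I-P)T(I-P)$. $GL_0(\mathcal A)$ is the connected component of $I$ in the group of invertible elements of $\mathcal A$, and $GL_0(\mathcal A\oplus\mathcal A)$ is the set of operators $\begin{pmatrix}A_1&0\\0&A_2\end{pmatrix}$ with $A_1,A_2\in GL_0(\mathcal A)$. Finally, $\mathcal O_r=\{z\in\mathbb C:|z|<r\}$. Theorem. There exist constants $\delta>0$ and $C>0$, independent of $H$, $\mathcal A$, $T$ and $\theta$ below, such that the following is true. Let $\mathcal A$ have real rank zero, and let $T\in M_2(\mathcal A)$ be a normal operator such that $\sigma(T)\cap\mathcal O_3$ is a subset of the straight line $e^{i\theta}\mathbb R$, where $\theta\in[0,\pi)$.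 Let $\Pi_r$ be the spectral projection of $T$ onto $\mathcal O_r$. If $\|[P,T]\|<\delta$ and both $\operatorname{diag}_P(T+ie^{i\theta}I)$ and $\operatorname{diag}_P(T-ie^{i\theta}I)$ belong to $GL_0(\mathcal A\oplus\mathcal A)$, then there is a unitary operator $U\in M_2(\mathcal A)$ such that - $\operatorname{diag}_PU\in GL_0(\mathcal A\oplus\mathcal A)$; - $[U,\Pi_r]=0$ for all $1\le r\le2$; - $U(\Pi_2-\Pi_1)=V(\Pi_2-\Pi_1)$ for every unitary polar part $V$ of $T$, that is, for every unitary $V\in B(H\oplus H)$ with $T=V|T|$, $|T|=(T^*T)^{1/2}$; - $\|[P,U]\|\le C\,\|[P,T]\|$; - the range $\operatorname{Ran}\Pi_2$ is invariant under $U$, and the spectrum of $U|_{\operatorname{Ran}\Pi_2}$ is contained in the intersection of $e^{i\theta}\mathbb R$ with the unit circle, that is, in $\{e^{i\theta},-e^{i\theta}\}$. -/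

import Mathlib

noncomputable section

namespace NormalDist

universe u

/-- A C*-algebra (here: a unital star subalgebra of the bounded operators on `H`, in applications
norm closed) has real rank zero if each of its self-adjoint elements can be approximated in norm
by its self-adjoint elements with finite spectrum. -/
def RealRankZero {H : Type u} [NormedAddCommGroup H] [InnerProductSpace ℂ H] [CompleteSpace H]
    (A : StarSubalgebra ℂ (H →L[ℂ] H)) : Prop :=
  ∀ a : A, IsSelfAdjoint a → ∀ ε : ℝ, 0 < ε →
    ∃ b : A, IsSelfAdjoint b ∧ (spectrum ℂ b).Finite ∧ ‖a - b‖ < ε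

/-- `GL₀(A)`: the connected component of the identity in the group of invertible elements of `A`,
as a set of operators on `H`. -/
def GL0 {H : Type u} [NormedAddCommGroup H] [InnerProductSpace ℂ H] [CompleteSpace H]
    (A : StarSubalgebra ℂ (H →L[ℂ] H)) : Set (H →L[ℂ] H) :=
  {a | ∃ g : (↥A)ˣ, g ∈ connectedComponent (1 : (↥A)ˣ) ∧ ((g : A) : H →L[ℂ] H) = a}

/-- The Hilbert space direct sum `H ⊕ H`. -/
abbrev Dbl (H : Type u) : Type u := PiLp 2 (fun _ : Fin 2 => H)

/-- The operator on `H ⊕ H` given by a `2 × 2` matrix of operators on `H`. -/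
def opMatrix {H : Type u} [NormedAddCommGroup H] [InnerProductSpace ℂ H]
    (M : Matrix (Fin 2) (Fin 2) (H →L[ℂ] H)) : Dbl H →L[ℂ] Dbl H :=
  ((PiLp.continuousLinearEquiv 2 ℂ (fun _ : Fin 2 => H)).symm :
      (Fin 2 → H) →L[ℂ] Dbl H) ∘L
    ContinuousLinearMap.pi fun i => ∑ j, M i j ∘L PiLp.proj 2 (fun _ : Fin 2 => H) j

theorem opMatrix_apply {H : Type u} [NormedAddCommGroup H] [InnerProductSpace ℂ H]
    (M : Matrix (Fin 2) (Fin 2) (H →L[ℂ] H)) (x : Dbl H) (i : Fin 2) :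
    opMatrix M x i = ∑ j, M i j (x j) := by
  simp [opMatrix]

/-- `M₂(A)`: the operators on `H ⊕ H` given by `2 × 2` matrices with entries in `A`. -/
def M2 {H : Type u} [NormedAddCommGroup H] [InnerProductSpace ℂ H] [CompleteSpace H]
    (A : StarSubalgebra ℂ (H →L[ℂ] H)) : Set (Dbl H →L[ℂ] Dbl H) :=
  {T | ∃ M : Matrix (Fin 2) (Fin 2) (H →L[ℂ] H), (∀ i j, M i j ∈ A) ∧ T = opMatrix M}

/-- `P`: the projection of `H ⊕ H` onto its first component. -/
def projFst (H : Type u) [NormedAddCommGroup H] [InnerProductSpace ℂ H] :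
    Dbl H →L[ℂ] Dbl H :=
  opMatrix !![1, 0; 0, 0]

/-- `diag_P T = P T P + (1 - P) T (1 - P)`. -/
def diagP {H : Type u} [NormedAddCommGroup H] [InnerProductSpace ℂ H]
    (T : Dbl H →L[ℂ] Dbl H) : Dbl H →L[ℂ] Dbl H :=
  projFst H * T * projFst H + (1 - projFst H) * T * (1 - projFst H)

/-- `GL₀(A ⊕ A)`: the block diagonal operators on `H ⊕ H` with both blocks in `GL₀(A)`. -/
def GL0Sum {H : Type u} [NormedAddCommGroup H] [InnerProductSpace ℂ H] [CompleteSpace H]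
    (A : StarSubalgebra ℂ (H →L[ℂ] H)) : Set (Dbl H →L[ℂ] Dbl H) :=
  {D | ∃ A₁ ∈ GL0 A, ∃ A₂ ∈ GL0 A, D = opMatrix !![A₁, 0; 0, A₂]}

/-- The spectral subspace of a normal operator `T` for an open set `Ω ⊆ ℂ`: the closed linear span
of the ranges of `f(T)`, where `f` is continuous and vanishes off `Ω`. The indicator function of
`Ω` is the limit of an increasing sequence of such functions, so this is the range of the value at
`Ω` of the spectral measure of `T`. -/
def spectralSubspace {K : Type u} [NormedAddCommGroup K] [InnerProductSpace ℂ K] [CompleteSpace K]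
    (T : K →L[ℂ] K) (Ω : Set ℂ) : Submodule ℂ K :=
  (Submodule.span ℂ {y : K | ∃ f : ℂ → ℂ, Continuous f ∧ (∀ z, z ∉ Ω → f z = 0) ∧
    ∃ x : K, y = cfc f T x}).topologicalClosure

instance {K : Type u} [NormedAddCommGroup K] [InnerProductSpace ℂ K] [CompleteSpace K]
    (T : K →L[ℂ] K) (Ω : Set ℂ) : CompleteSpace (spectralSubspace T Ω) :=
  Submodule.topologicalClosure.completeSpace _

/-- The spectral projection of a normal operator `T` onto the open disc of radius `r` about `0`. -/
def discProj {K : Type u} [NormedAddCommGroup K] [InnerProductSpace ℂ K] [CompleteSpace K]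
    (T : K →L[ℂ] K) (r : ℝ) : K →L[ℂ] K :=
  (spectralSubspace T (Metric.ball 0 r)).starProjection

/-- `V` is a unitary polar part of `T`: it is a unitary operator on the whole Hilbert space, not
necessarily in the algebra of `T`, and `T = V|T|` with `|T| = (T⋆T)^{1/2}`. -/
def IsUnitaryPolarPart {K : Type u} [NormedAddCommGroup K] [InnerProductSpace ℂ K]
    [CompleteSpace K] (T V : K →L[ℂ] K) : Prop :=
  V ∈ unitary (K →L[ℂ] K) ∧ T = V * CFC.abs T

/-- The straight line `e^{iθ}ℝ` in the complex plane. -/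
def line (θ : ℝ) : Set ℂ :=
  {z | ∃ t : ℝ, z = Complex.exp (θ * Complex.I) * t}

end NormalDist

end

namespace NormalDist
open Set Filter Topology MeasureTheory
open scoped Real

/-! ### Decay of Fourier coefficients -/

section Fourier

/-! Put `w = e^{iθ}`. The Cayley map `z ↦ (z - iw)/(z + iw)` sends the line `wℝ` into the unit
circle, `0` to `-1` and `∞` to `1`, and the two half-lines to the lower and upper arcs. On the rest
of the spectrum it is bounded and bounded away from zero, so dividing by the modulus gives a unitary
`Z`, a function of `T`, with `‖[P,Z]‖ ≤ 260 ‖[P,T]‖` (`norm_commutator_linePhase_le`). The wanted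
operator is `w` times a function of `Z` equal to `1` on the lower arc and `-1` on the upper one.
Near `Z = 1`, that is for large `T`, the passage from `1` to `-1` can be made along the upper unit
semicircle. Near `Z = -1`, that is near `T = 0`, only the values `±1` are allowed, so the function
must jump, and a discontinuous function of `Z` need neither lie in `M₂(A)` nor almost commute with
`P`.

The jump is therefore taken from another unitary `v`, close to `Z`, which commutes exactly with `P`
and has finite spectrum, so that every function of it is admissible. In `exists_unitary_of_close`
the operator is the unitary polar part of `F(Z) + a J(v) a`, where `F` is smooth, `a` is a smooth
cut-off of `Z` near `-1`, and `J` is the real jump that makes `F + J` unimodular. As `J(v)` commutes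
with `P` and smooth functions on the circle are operator Lipschitz (`exists_operatorLipschitz`), the
commutator with `P` is linear in `[P,Z]`. Where `|T| < 2` the operator is self-adjoint, so its
square is `1`; multiplication by `w` gives the spectrum `±w`. It is close to `(F + J)(v)`, whose
spectrum lies in the closed upper half plane, and this puts its block diagonal part in the identity
component.

The unitary `v` exists because the block diagonal part of `Z` is connected to `1` when those of `T ±
iw` are (`lineCayley_mem_idComponent`, `linePhase_mem_idComponent`), and because in real rank zero
the unitary part of an element of the identity component is a limit of unitaries with finite
spectrum (`isLimitFiniteSpectrum_polar`). The latter is a clopen argument: a unitary within a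
universal distance of one with finite spectrum is already such a limit
(`exists_isLimitFiniteSpectrum_of_close`). The same device works there. The real coordinate of the
circle jumps at `1`; taking the jump from the nearby unitary of finite spectrum gives a self-adjoint
`k` whose Cayley transform agrees with the given unitary away from `1`. Approximating `k` splits the
unitary, up to a small error, into a block of finite spectrum and a block near `1`
(`exists_unitary_gap_of_block`). The resulting unitary has a spectral gap, hence is a rotated Cayley
transform of a self-adjoint element, to which real rank zero applies. -/

theorem norm_fourierCoeffOn_le {g : ℝ → ℂ} {M : ℝ} (hM : ∀ t, ‖g t‖ ≤ M) (n : ℤ) :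
    ‖fourierCoeffOn Real.two_pi_pos g n‖ ≤ M := by
  rw [fourierCoeffOn_eq_integral, norm_smul]
  have h : ‖∫ x in (0 : ℝ)..2 * π, fourier (-n) (x : AddCircle (2 * π - 0)) • g x‖
      ≤ M * |2 * π - 0| := by
    refine intervalIntegral.norm_integral_le_of_norm_le_const fun x _ => ?_
    rw [norm_smul, fourier_apply, Circle.norm_coe, one_mul]
    exact hM x
  rw [sub_zero, abs_of_pos Real.two_pi_pos] at h
  rw [sub_zero, Real.norm_of_nonneg (by positivity)]
  calc 1 / (2 * π) * _ ≤ 1 / (2 * π) * (M * (2 * π)) := by gcongr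
    _ = M := by field_simp

theorem norm_fourierCoeffOn_of_hasDerivAt {g g' : ℝ → ℂ} (hg : ∀ t, HasDerivAt g (g' t) t)
    (hc : Continuous g') (hper : g (2 * π) = g 0) {n : ℤ} (hn : n ≠ 0) :
    ‖fourierCoeffOn Real.two_pi_pos g n‖ =
      |(n : ℝ)|⁻¹ * ‖fourierCoeffOn Real.two_pi_pos g' n‖ := by
  rw [fourierCoeffOn_of_hasDerivAt Real.two_pi_pos hn (fun x _ => hg x)
    (hc.intervalIntegrable _ _), hper]
  have : |(n : ℝ)| ≠ 0 := by positivity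
  simp [abs_of_pos Real.pi_pos]
  field_simp

theorem fourierCoeff_eq_fourierCoeffOn [Fact (0 < 2 * π)] (f : AddCircle (2 * π) → ℂ) (n : ℤ) :
    fourierCoeff f n = fourierCoeffOn Real.two_pi_pos (fun t : ℝ => f t) n := by
  rw [fourierCoeff_eq_intervalIntegral f n 0, fourierCoeffOn_eq_integral]
  simp [fourier_coe_apply']

/-- Three integrations by parts give decay `|n|⁻³`. The weight `|n|` is the Lipschitz constant of
the `n`-th power on unitaries; the extra `1` also yields absolute convergence of the Fourier series.
-/
theorem summable_norm_fourierCoeff [Fact (0 < 2 * π)] (f : AddCircle (2 * π) → ℂ)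
    (hf : ContDiff ℝ 3 (fun t : ℝ => f t)) :
    Summable fun n : ℤ => (|(n : ℝ)| + 1) * ‖fourierCoeff f n‖ := by
  set g : ℝ → ℂ := fun t => f t with hg
  have hp : Function.Periodic g (2 * π) := fun t => by simp [hg]
  have hp' : ∀ {h : ℝ → ℂ}, Function.Periodic h (2 * π) → Function.Periodic (deriv h) (2 * π) := by
    intro h hh t
    have : (fun s => h (s + 2 * π)) = h := funext hh
    rw [← deriv_comp_add_const, this]
  have key : ∀ {h : ℝ → ℂ}, Function.Periodic h (2 * π) → ContDiff ℝ 1 h → ∀ n : ℤ, n ≠ 0 →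
      ‖fourierCoeffOn Real.two_pi_pos h n‖ =
        |(n : ℝ)|⁻¹ * ‖fourierCoeffOn Real.two_pi_pos (deriv h) n‖ := by
    intro h hh hd n hn
    exact norm_fourierCoeffOn_of_hasDerivAt
      (fun t => (hd.differentiable (by norm_num) t).hasDerivAt)
      (hd.continuous_deriv (by norm_num)) (by simpa using hh 0) hn
  have h1 : ContDiff ℝ 2 (deriv g) := ContDiff.deriv' (by norm_num; exact hf)
  have h2 : ContDiff ℝ 1 (deriv (deriv g)) := ContDiff.deriv' (by norm_num; exact h1)
  have h3 : Continuous (deriv (deriv (deriv g))) := h2.continuous_deriv (by norm_num)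
  have hp3 := hp' (hp' (hp' hp))
  obtain ⟨M, hM⟩ : ∃ M, ∀ t, ‖deriv (deriv (deriv g)) t‖ ≤ M := by
    obtain ⟨M, hM⟩ := isCompact_Icc.exists_bound_of_continuousOn
      (s := Icc (0 : ℝ) (2 * π)) h3.continuousOn
    refine ⟨M, fun t => ?_⟩
    obtain ⟨y, hy, hyt⟩ := hp3.exists_mem_Ico₀ Real.two_pi_pos t
    rw [hyt]
    exact hM y (Ico_subset_Icc_self hy)
  have hb : ∀ n : ℤ, n ≠ 0 → ‖fourierCoeff f n‖ ≤ M * (|(n : ℝ)| ^ 3)⁻¹ := by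
    intro n hn
    rw [fourierCoeff_eq_fourierCoeffOn, key hp (hf.of_le (by norm_num)) n hn,
      key (hp' hp) (h1.of_le (by norm_num)) n hn, key (hp' (hp' hp)) h2 n hn]
    have := norm_fourierCoeffOn_le hM n
    have hn' : 0 < |(n : ℝ)| := by positivity
    calc _ = (|(n : ℝ)| ^ 3)⁻¹ * ‖fourierCoeffOn Real.two_pi_pos (deriv (deriv (deriv g))) n‖ := by
          field_simp
      _ ≤ (|(n : ℝ)| ^ 3)⁻¹ * M := by gcongr
      _ = _ := mul_comm _ _
  have hM0 : 0 ≤ M := (norm_nonneg _).trans (hM 0)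
  have hs : Summable fun n : ℤ => 2 * M * |(n : ℝ) ^ 2|⁻¹ := by
    have := (Real.summable_one_div_int_pow (p := 2)).2 (by norm_num)
    simpa [abs_inv] using this.mul_left (2 * M)
  refine Summable.of_norm_bounded_eventually hs ?_
  have : ∀ᶠ n : ℤ in cofinite, n ≠ 0 := by
    rw [eventually_cofinite]
    simp
  filter_upwards [this] with n hn
  rw [Real.norm_of_nonneg (by positivity)]
  have hn' : (1 : ℝ) ≤ |(n : ℝ)| := by
    exact_mod_cast Int.one_le_abs hn
  calc (|(n : ℝ)| + 1) * ‖fourierCoeff f n‖ ≤ (2 * |(n : ℝ)|) * (M * (|(n : ℝ)| ^ 3)⁻¹) := by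
        gcongr
        · linarith
        · exact hb n hn
    _ = 2 * M * |(n : ℝ) ^ 2|⁻¹ := by rw [abs_pow]; field_simp

end Fourier

/-! ### Operator Lipschitz estimates for unitaries -/

section OperatorLipschitz
variable {B : Type*} [CStarAlgebra B]

/-- The intertwined form `x f(a) - f(b) x` covers both uses at once: `a = b` gives commutators, `x =
1` gives differences `f(a) - f(b)`. -/
theorem norm_mul_sub_mul_cfc_le_of_limit {f : ℂ → ℂ} {a b x : B} {K : ℝ} (ha : a ∈ unitary B)
    (hb : b ∈ unitary B)
    (hf : ContinuousOn f (Metric.sphere 0 1))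
    (h : ∀ ε > 0, ∃ p : ℂ → ℂ, ContinuousOn p (Metric.sphere 0 1) ∧
      (∀ z ∈ Metric.sphere (0 : ℂ) 1, ‖f z - p z‖ ≤ ε) ∧ ‖x * cfc p a - cfc p b * x‖ ≤ K) :
    ‖x * cfc f a - cfc f b * x‖ ≤ K := by
  have sa := spectrum.subset_circle_of_unitary (𝕜 := ℂ) ha
  have sb := spectrum.subset_circle_of_unitary (𝕜 := ℂ) hb
  have na : IsStarNormal a := isStarNormal_of_mem_unitary ha
  have nb : IsStarNormal b := isStarNormal_of_mem_unitary hb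
  refine le_of_forall_pos_le_add fun ε hε => ?_
  obtain ⟨p, hp, hfp, hK⟩ := h (ε / (2 * (‖x‖ + 1))) (by positivity)
  have e1 : ‖cfc f a - cfc p a‖ ≤ ε / (2 * (‖x‖ + 1)) := by
    rw [← cfc_sub f p a (hf.mono sa) (hp.mono sa)]
    exact norm_cfc_le (by positivity) fun z hz => hfp z (sa hz)
  have e2 : ‖cfc f b - cfc p b‖ ≤ ε / (2 * (‖x‖ + 1)) := by
    rw [← cfc_sub f p b (hf.mono sb) (hp.mono sb)]
    exact norm_cfc_le (by positivity) fun z hz => hfp z (sb hz)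
  have : x * cfc f a - cfc f b * x = (x * cfc p a - cfc p b * x) + x * (cfc f a - cfc p a)
      - (cfc f b - cfc p b) * x := by noncomm_ring
  rw [this]
  calc _ ≤ ‖x * cfc p a - cfc p b * x‖ + ‖x‖ * ‖cfc f a - cfc p a‖
        + ‖cfc f b - cfc p b‖ * ‖x‖ := by
        refine (norm_sub_le _ _).trans (add_le_add ((norm_add_le _ _).trans ?_) (norm_mul_le _ _))
        gcongr
        exact norm_mul_le _ _
    _ ≤ K + ‖x‖ * (ε / (2 * (‖x‖ + 1))) + (ε / (2 * (‖x‖ + 1))) * ‖x‖ := by gcongr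
    _ = K + ε * (‖x‖ / (‖x‖ + 1)) := by field_simp; ring
    _ ≤ K + ε * 1 := by
        gcongr
        exact div_le_one_of_le₀ (by linarith) (by positivity)
    _ = K + ε := by ring

theorem norm_le_one_of_mem_unitary {a : B} (ha : a ∈ unitary B) : ‖a‖ ≤ 1 := by
  rcases subsingleton_or_nontrivial B with h | h
  · simp [Subsingleton.elim a 0]
  · exact (CStarRing.norm_of_mem_unitary ha).le

theorem norm_mul_pow_sub_le {a b x : B} (ha : a ∈ unitary B) (hb : b ∈ unitary B) (n : ℕ) :
    ‖x * a ^ n - b ^ n * x‖ ≤ n * ‖x * a - b * x‖ := by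
  induction n with
  | zero => simp
  | succ n ih =>
    have : x * a ^ (n + 1) - b ^ (n + 1) * x = (x * a ^ n - b ^ n * x) * a
        + b ^ n * (x * a - b * x) := by rw [pow_succ, pow_succ]; noncomm_ring
    rw [this]
    have hbn : ‖b ^ n‖ ≤ 1 := norm_le_one_of_mem_unitary (pow_mem hb n)
    have han : ‖a‖ ≤ 1 := norm_le_one_of_mem_unitary ha
    calc _ ≤ ‖x * a ^ n - b ^ n * x‖ * ‖a‖ + ‖b ^ n‖ * ‖x * a - b * x‖ :=
          (norm_add_le _ _).trans (add_le_add (norm_mul_le _ _) (norm_mul_le _ _))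
      _ ≤ n * ‖x * a - b * x‖ * 1 + 1 * ‖x * a - b * x‖ := by gcongr
      _ = _ := by push_cast; ring

theorem norm_mul_star_sub_le {a b x : B} (ha : a ∈ unitary B) (hb : b ∈ unitary B) :
    ‖x * star a - star b * x‖ ≤ ‖x * a - b * x‖ := by
  have : x * star a - star b * x = -(star b * (x * a - b * x) * star a) := by
    have h1 := Unitary.mul_star_self_of_mem ha
    have h2 := Unitary.star_mul_self_of_mem hb
    calc _ = (star b * b) * x * star a - star b * x * (a * star a) := by rw [h1, h2]; simp
      _ = _ := by noncomm_ring
  rw [this, norm_neg]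
  have h1 : ‖star b‖ ≤ 1 := norm_le_one_of_mem_unitary (Unitary.star_mem hb)
  have h2 : ‖star a‖ ≤ 1 := norm_le_one_of_mem_unitary (Unitary.star_mem ha)
  calc _ ≤ ‖star b‖ * ‖x * a - b * x‖ * ‖star a‖ :=
        (norm_mul_le _ _).trans (by gcongr; exact norm_mul_le _ _)
    _ ≤ 1 * ‖x * a - b * x‖ * 1 := by gcongr
    _ = _ := by ring

theorem continuousOn_zpow_sphere (n : ℤ) :
    ContinuousOn (fun z : ℂ => z ^ n) (Metric.sphere 0 1) := by
  intro z hz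
  refine (continuousAt_zpow₀ z n (Or.inl ?_)).continuousWithinAt
  rintro rfl
  simp at hz

/-- Positive powers telescope. On the circle negative powers are powers of the adjoint, and passing
to adjoints does not increase the intertwining error. -/
theorem norm_mul_cfc_zpow_sub_le {a b x : B} (ha : a ∈ unitary B) (hb : b ∈ unitary B) (n : ℤ) :
    ‖x * cfc (fun z : ℂ => z ^ n) a - cfc (fun z : ℂ => z ^ n) b * x‖
      ≤ |(n : ℝ)| * ‖x * a - b * x‖ := by
  have na : IsStarNormal a := isStarNormal_of_mem_unitary ha
  have nb : IsStarNormal b := isStarNormal_of_mem_unitary hb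
  obtain ⟨m, rfl | rfl⟩ := n.eq_nat_or_neg
  · simp only [zpow_natCast]
    rw [cfc_pow_id a m, cfc_pow_id b m]
    simpa using norm_mul_pow_sub_le ha hb m (x := x)
  · have key : ∀ c ∈ unitary B, cfc (fun z : ℂ => z ^ (-(m : ℤ))) c = star c ^ m := by
      intro c hc
      have nc : IsStarNormal c := isStarNormal_of_mem_unitary hc
      have sc := spectrum.subset_circle_of_unitary (𝕜 := ℂ) hc
      rw [← cfc_star_id (R := ℂ) (a := c), ← cfc_pow (fun z : ℂ => star z) m c]
      refine cfc_congr fun z hz => ?_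
      have hz1 : ‖z‖ = 1 := by simpa using sc hz
      simp only [zpow_neg, zpow_natCast, ← inv_pow]
      rw [Complex.inv_def, Complex.normSq_eq_norm_sq, hz1]
      simp
    rw [key a ha, key b hb]
    have := norm_mul_pow_sub_le (x := x) (Unitary.star_mem ha) (Unitary.star_mem hb) m
    refine this.trans ?_
    simp only [Int.cast_neg, Int.cast_natCast, abs_neg, Nat.abs_cast]
    gcongr
    exact norm_mul_star_sub_le ha hb

end OperatorLipschitz

/-- A function that is smooth on the unit circle is operator Lipschitz on unitaries, with a
constant that does not depend on the algebra. -/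
theorem exists_operatorLipschitz {F : ℂ → ℂ} (hF' : ContDiff ℝ 3 F) :
    ∃ C : ℝ, 0 ≤ C ∧ ∀ {B : Type u} [CStarAlgebra B] {a b : B} (x : B), a ∈ unitary B →
      b ∈ unitary B → ‖x * cfc F a - cfc F b * x‖ ≤ C * ‖x * a - b * x‖ := by
  have hFc : ContinuousOn F (Metric.sphere 0 1) := hF'.continuous.continuousOn
  have hF : ContDiff ℝ 3 (fun t : ℝ => F (Complex.exp (t * Complex.I))) :=
    hF'.comp (((Complex.contDiff_exp (𝕜 := ℂ)).restrict_scalars ℝ).comp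
      (Complex.ofRealCLM.contDiff.mul contDiff_const))
  have : Fact (0 < 2 * π) := ⟨Real.two_pi_pos⟩
  let f : C(AddCircle (2 * π), ℂ) :=
    ⟨fun θ => F (AddCircle.toCircle θ), hFc.comp_continuous (by fun_prop)
      (fun θ => mem_sphere_zero_iff_norm.2 (Circle.norm_coe _))⟩
  have hexp : ∀ t : ℝ, ((AddCircle.toCircle (t : AddCircle (2 * π)) : Circle) : ℂ)
      = Complex.exp (t * Complex.I) := by
    intro t
    rw [AddCircle.toCircle_apply_mk, Circle.coe_exp]
    congr 2
    rw [div_self Real.two_pi_pos.ne', one_mul]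
  have hfs : Summable fun n : ℤ => (|(n : ℝ)| + 1) * ‖fourierCoeff f n‖ := by
    refine summable_norm_fourierCoeff f ?_
    convert hF using 2 with t
    exact congrArg F (hexp t)
  have hf1 : Summable (fourierCoeff f) := by
    refine Summable.of_norm_bounded hfs fun n => ?_
    nlinarith [norm_nonneg (fourierCoeff f n), abs_nonneg (n : ℝ)]
  have hsum := hasSum_fourier_series_of_summable hf1
  -- The constant depends only on the Fourier coefficients of `F` on the circle, hence not on the
  -- algebra.
  refine ⟨∑' n : ℤ, (|(n : ℝ)| + 1) * ‖fourierCoeff f n‖, tsum_nonneg fun n => by positivity, ?_⟩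
  intro B _ a b x ha hb
  refine norm_mul_sub_mul_cfc_le_of_limit ha hb hFc fun ε hε => ?_
  obtain ⟨s, hs⟩ : ∃ s : Finset ℤ, ‖f - ∑ n ∈ s, fourierCoeff f n • fourier n‖ < ε := by
    have := (Metric.tendsto_nhds.1 hsum ε hε).exists
    obtain ⟨s, hs⟩ := this
    exact ⟨s, by rwa [dist_comm, dist_eq_norm] at hs⟩
  have hpc : ∀ n ∈ s, ContinuousOn (fun z : ℂ => fourierCoeff f n * z ^ n) (Metric.sphere 0 1) :=
    fun n _ => continuousOn_const.mul (continuousOn_zpow_sphere n)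
  refine ⟨fun z => ∑ n ∈ s, fourierCoeff f n * z ^ n, continuousOn_finsetSum s hpc, ?_, ?_⟩
  · intro z hz
    obtain ⟨t, rfl⟩ : ∃ t : ℝ, z = Complex.exp (t * Complex.I) := by
      refine ⟨z.arg, ?_⟩
      have := Complex.norm_mul_exp_arg_mul_I z
      rw [mem_sphere_zero_iff_norm.1 hz] at this
      simpa using this.symm
    refine le_trans (le_of_eq ?_)
      (((f - ∑ n ∈ s, fourierCoeff f n • fourier n).norm_coe_le_norm (t : AddCircle (2 * π))).trans
        hs.le)
    congr 1
    simp only [ContinuousMap.sub_apply, ContinuousMap.coe_sum, Finset.sum_apply,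
      ContinuousMap.smul_apply, smul_eq_mul, fourier_apply, AddCircle.toCircle_zsmul,
      Circle.coe_zpow, hexp]
    simp [f, hexp]
  · have sa := spectrum.subset_circle_of_unitary (𝕜 := ℂ) ha
    have sb := spectrum.subset_circle_of_unitary (𝕜 := ℂ) hb
    have na : IsStarNormal a := isStarNormal_of_mem_unitary ha
    have nb : IsStarNormal b := isStarNormal_of_mem_unitary hb
    have hsum' : ∀ c ∈ unitary B, cfc (fun z : ℂ => ∑ n ∈ s, fourierCoeff f n * z ^ n) c
        = ∑ n ∈ s, fourierCoeff f n • cfc (fun z : ℂ => z ^ n) c := by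
      intro c hc
      have nc : IsStarNormal c := isStarNormal_of_mem_unitary hc
      have sc := spectrum.subset_circle_of_unitary (𝕜 := ℂ) hc
      have := cfc_sum (fun n (z : ℂ) => fourierCoeff f n * z ^ n) c s
        (fun n hn => (hpc n hn).mono sc)
      rw [show (fun z : ℂ => ∑ n ∈ s, fourierCoeff f n * z ^ n)
        = ∑ n ∈ s, fun z : ℂ => fourierCoeff f n * z ^ n by ext z; simp, this]
      refine Finset.sum_congr rfl fun n hn => ?_
      exact cfc_const_mul _ _ c ((continuousOn_zpow_sphere n).mono sc)
    rw [hsum' a ha, hsum' b hb, Finset.mul_sum, Finset.sum_mul, ← Finset.sum_sub_distrib]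
    calc _ ≤ ∑ n ∈ s, (|(n : ℝ)| + 1) * ‖fourierCoeff f n‖ * ‖x * a - b * x‖ := by
          refine norm_sum_le_of_le s fun n _ => ?_
          rw [mul_smul_comm, smul_mul_assoc, ← smul_sub, norm_smul]
          have := norm_mul_cfc_zpow_sub_le (x := x) ha hb n
          calc _ ≤ ‖fourierCoeff f n‖ * (|(n : ℝ)| * ‖x * a - b * x‖) := by gcongr
            _ ≤ _ := by
              nlinarith [mul_nonneg (norm_nonneg (fourierCoeff f n)) (norm_nonneg (x * a - b * x))]
      _ ≤ _ := by
          rw [← Finset.sum_mul]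
          gcongr
          exact hfs.sum_le_tsum s fun n _ => by positivity
end NormalDist

namespace NormalDist
open Set Filter Topology

/-! ### Unitary polar parts of invertible elements -/

section Polar
variable {B : Type*} [CStarAlgebra B]

/-- `(G⋆G)^{-1/2}`. -/
noncomputable def absInv (G : B) : B := cfc (fun t : ℝ => (√t)⁻¹) (star G * G)

/-- The unitary part `G (G⋆G)^{-1/2}` of the polar decomposition of an invertible element. -/
noncomputable def polar (G : B) : B := G * absInv G

theorem abs_sub_one_le_of_mem_spectrum {h : B} {t : ℝ} (ht : t ∈ spectrum ℝ h) :
    |t - 1| ≤ ‖h - 1‖ := by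
  rcases subsingleton_or_nontrivial B with hB | hB
  · simp [spectrum.of_subsingleton] at ht
  have : t - 1 ∈ spectrum ℝ (h - 1) := by
    have := spectrum.sub_singleton_eq (R := ℝ) h 1
    rw [map_one] at this
    rw [← this]
    exact Set.sub_mem_sub ht rfl
  simpa using spectrum.norm_le_norm_of_mem this

theorem isSelfAdjoint_absInv (G : B) : IsSelfAdjoint (absInv G) := cfc_predicate _ _

theorem continuousOn_inv_sqrt {s : Set ℝ} (hs : ∀ t ∈ s, 0 < t) :
    ContinuousOn (fun t : ℝ => (√t)⁻¹) s :=
  Real.continuous_sqrt.continuousOn.inv₀ fun t ht => (Real.sqrt_pos.2 (hs t ht)).ne'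

theorem commute_absInv (G : B) : Commute (absInv G) (star G * G) :=
  (IsSelfAdjoint.commute_cfc (IsSelfAdjoint.star_mul_self G) (Commute.refl _) _).symm.symm

theorem absInv_sq_mul {G : B} (hG : ∀ t ∈ spectrum ℝ (star G * G), 0 < t) :
    absInv G * absInv G * (star G * G) = 1 := by
  have hc := continuousOn_inv_sqrt hG
  have hsa : IsSelfAdjoint (star G * G) := IsSelfAdjoint.star_mul_self G
  rw [absInv, ← cfc_mul _ _ _ hc hc]
  nth_rewrite 2 [← cfc_id' ℝ (star G * G)]
  rw [← cfc_mul (fun t : ℝ => (√t)⁻¹ * (√t)⁻¹) (fun t => t) _ (hc.mul hc) continuousOn_id,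
    ← cfc_one ℝ (star G * G)]
  refine cfc_congr fun t ht => ?_
  have := hG t ht
  simp only [Pi.one_apply]
  rw [← mul_inv, Real.mul_self_sqrt this.le, inv_mul_cancel₀ this.ne']

theorem star_polar_mul_polar {G : B} (hG : ∀ t ∈ spectrum ℝ (star G * G), 0 < t) :
    star (polar G) * polar G = 1 := by
  rw [polar, star_mul, (isSelfAdjoint_absInv G).star_eq]
  calc _ = absInv G * ((star G * G) * absInv G) := by noncomm_ring
    _ = absInv G * (absInv G * (star G * G)) := by rw [(commute_absInv G).eq]
    _ = 1 := by rw [← mul_assoc, absInv_sq_mul hG]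

theorem isUnit_absInv {G : B} (hG : ∀ t ∈ spectrum ℝ (star G * G), 0 < t) :
    IsUnit (absInv G) := by
  have h := absInv_sq_mul hG
  refine ⟨⟨absInv G, absInv G * (star G * G), by rw [← mul_assoc, h], ?_⟩, rfl⟩
  rw [mul_assoc, ← (commute_absInv G).eq, ← mul_assoc, h]

theorem pos_of_mem_spectrum_of_isUnit {G : B} (hG : IsUnit G) :
    ∀ t ∈ spectrum ℝ (star G * G), 0 < t := by
  intro t ht
  have h0 : 0 ≤ t := spectrum_star_mul_self_nonneg t ht
  refine lt_of_le_of_ne h0 ?_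
  rintro rfl
  exact spectrum.zero_notMem ℝ (hG.star.mul hG) ht

theorem polar_mem_unitary {G : B} (hG : IsUnit G) : polar G ∈ unitary B := by
  have hp := pos_of_mem_spectrum_of_isUnit hG
  have h1 := star_polar_mul_polar hp
  have hu : IsUnit (polar G) := hG.mul (isUnit_absInv hp)
  refine Unitary.mem_iff.2 ⟨h1, ?_⟩
  obtain ⟨v, hv⟩ := hu
  rw [← hv] at h1 ⊢
  rw [left_inv_eq_right_inv h1 v.mul_inv, v.mul_inv]

/-- After centring at the midpoint of `[M⁻¹, m⁻¹]` the remainder is smaller than the midpoint by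
exactly `M⁻¹`; this margin makes the equation `Y r + r Y = ...` in `norm_commutator_polar_le`
solvable for `Y`. In the zero algebra the spectral hypothesis does not order `m` and `M`, whence the
alternative. -/
theorem norm_absInv_sub_le {G : B} {m M : ℝ} (hm : 0 < m) (hM : 0 < M)
    (hG : ∀ t ∈ spectrum ℝ (star G * G), m ^ 2 ≤ t ∧ t ≤ M ^ 2) :
    ‖absInv G - algebraMap ℝ B ((m⁻¹ + M⁻¹) / 2)‖ ≤ (m⁻¹ - M⁻¹) / 2 ∨ Subsingleton B := by
  rcases subsingleton_or_nontrivial B with hB | hB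
  · exact Or.inr hB
  left
  have hsa : IsSelfAdjoint (star G * G) := IsSelfAdjoint.star_mul_self G
  have hc := continuousOn_inv_sqrt (s := spectrum ℝ (star G * G))
    fun t ht => lt_of_lt_of_le (by positivity) (hG t ht).1
  rw [absInv, ← cfc_const ((m⁻¹ + M⁻¹) / 2) (star G * G) hsa,
    ← cfc_sub _ _ _ hc continuousOn_const]
  have hb : ∀ t ∈ spectrum ℝ (star G * G), M⁻¹ ≤ (√t)⁻¹ ∧ (√t)⁻¹ ≤ m⁻¹ := by
    intro t ht
    obtain ⟨h1, h2⟩ := hG t ht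
    have h3 : m ≤ √t := Real.le_sqrt_of_sq_le h1
    have h4 : √t ≤ M := Real.sqrt_le_iff.2 ⟨hM.le, h2⟩
    exact ⟨by gcongr; linarith, by gcongr⟩
  obtain ⟨t0, ht0⟩ := (ContinuousFunctionalCalculus.spectrum_nonempty (R := ℝ) (star G * G) hsa)
  refine norm_cfc_le (by linarith [hb t0 ht0]) fun t ht => ?_
  rw [Real.norm_eq_abs, abs_le]
  constructor <;> linarith [hb t ht]

theorem norm_commutator_star {x a : B} (hx : IsSelfAdjoint x) :
    ‖x * star a - star a * x‖ = ‖x * a - a * x‖ := by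
  rw [← norm_star (x * a - a * x), ← norm_neg]
  simp [hx.star_eq]

/-- The commutator with the unitary part of the polar decomposition is controlled by the
commutator with the element itself. -/
theorem norm_commutator_polar_le {G x : B} {m M : ℝ} (hm : 0 < m) (hM : 0 < M)
    (hG : ∀ t ∈ spectrum ℝ (star G * G), m ^ 2 ≤ t ∧ t ≤ M ^ 2) (hx : IsSelfAdjoint x) :
    ‖x * polar G - polar G * x‖ ≤ (m⁻¹ + M ^ 3 * (m⁻¹) ^ 4) * ‖x * G - G * x‖ := by
  rcases norm_absInv_sub_le hm hM hG with hr' | hB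
  swap
  · have : ∀ y : B, y = 0 := fun y => Subsingleton.elim _ _
    rw [this (x * polar G - polar G * x), norm_zero]; positivity
  rcases subsingleton_or_nontrivial B with hB | hB
  · have : ∀ y : B, y = 0 := fun y => Subsingleton.elim _ _
    rw [this (x * polar G - polar G * x), norm_zero]; positivity
  set r := absInv G with hr
  set d := ‖x * G - G * x‖ with hd
  set h := star G * G with hh
  have hpos : ∀ t ∈ spectrum ℝ h, 0 < t := fun t ht => lt_of_lt_of_le (by positivity) (hG t ht).1
  have hsa : IsSelfAdjoint h := IsSelfAdjoint.star_mul_self G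
  have hrn : ‖r‖ ≤ m⁻¹ := by
    refine norm_cfc_le (by positivity) fun t ht => ?_
    rw [Real.norm_of_nonneg (by positivity)]
    have : m ≤ √t := Real.le_sqrt_of_sq_le (hG t ht).1
    gcongr
  have hGn : ‖G‖ ≤ M := by
    have h1 : ‖h‖ ≤ M ^ 2 := by
      rw [← cfc_id' ℝ h]
      refine norm_cfc_le (by positivity) fun t ht => ?_
      rw [Real.norm_of_nonneg (hpos t ht).le]; exact (hG t ht).2
    rw [hh, CStarRing.norm_star_mul_self] at h1
    nlinarith [norm_nonneg G]
  set Y := x * r - r * x with hY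
  have hxh : ‖x * h - h * x‖ ≤ 2 * M * d := by
    have : x * h - h * x = (x * star G - star G * x) * G + star G * (x * G - G * x) := by
      rw [hh]; noncomm_ring
    rw [this]
    calc _ ≤ ‖x * star G - star G * x‖ * ‖G‖ + ‖star G‖ * ‖x * G - G * x‖ :=
          (norm_add_le _ _).trans (add_le_add (norm_mul_le _ _) (norm_mul_le _ _))
      _ ≤ d * M + M * d := by rw [norm_commutator_star hx, norm_star]; gcongr
      _ = _ := by ring
  have hsq := absInv_sq_mul hpos
  have hsq' : h * (r * r) = 1 := by
    have hc := commute_absInv G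
    rw [← (hc.mul_left hc).eq]; exact hsq
  -- The left side is `[x, r²]`, and `r²` is the inverse of `h`.
  have hY1 : Y * r + r * Y = -((r * r) * (x * h - h * x) * (r * r)) := by
    have : (r * r) * (x * h - h * x) * (r * r)
        = (r * r) * x * (h * (r * r)) - ((r * r) * h) * x * (r * r) := by noncomm_ring
    rw [this, hsq', hsq, hY]; noncomm_ring
  have hY2 : ‖Y * r + r * Y‖ ≤ (m⁻¹) ^ 4 * (2 * M * d) := by
    rw [hY1, norm_neg]
    have : ‖r * r‖ ≤ m⁻¹ * m⁻¹ := (norm_mul_le _ _).trans (by gcongr)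
    calc _ ≤ ‖r * r‖ * ‖x * h - h * x‖ * ‖r * r‖ :=
          (norm_mul_le _ _).trans (by gcongr; exact norm_mul_le _ _)
      _ ≤ (m⁻¹ * m⁻¹) * (2 * M * d) * (m⁻¹ * m⁻¹) := by gcongr
      _ = _ := by ring
  have hY3 : ‖Y‖ ≤ M ^ 2 * (m⁻¹) ^ 4 * d := by
    set c : ℝ := (m⁻¹ + M⁻¹) / 2 with hc
    set r' := r - algebraMap ℝ B c with hr'
    -- The equation for `Y` is compared with the scalar case `r = c`; the deviation `r'` costs at
    -- most `(m⁻¹ - M⁻¹) ‖Y‖`, which leaves the coefficient `2 M⁻¹`.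
    have e : (2 * c) • Y = (Y * r + r * Y) - Y * r' - r' * Y := by
      rw [hr', Algebra.algebraMap_eq_smul_one, two_mul, add_smul]
      simp only [mul_sub, sub_mul, mul_smul_comm, smul_mul_assoc, mul_one, one_mul]
      abel
    have hc0 : 0 < c := by positivity
    have n1 : 2 * c * ‖Y‖ ≤ (m⁻¹) ^ 4 * (2 * M * d) + ‖Y‖ * ((m⁻¹ - M⁻¹) / 2)
        + ((m⁻¹ - M⁻¹) / 2) * ‖Y‖ := by
      have : ‖(2 * c) • Y‖ = 2 * c * ‖Y‖ := by
        rw [norm_smul, Real.norm_of_nonneg (by positivity)]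
      rw [← this, e]
      refine (norm_sub_le _ _).trans (add_le_add ((norm_sub_le _ _).trans (add_le_add hY2 ?_)) ?_)
      · exact (norm_mul_le _ _).trans (by gcongr)
      · exact (norm_mul_le _ _).trans (by gcongr)
    have n2 : 2 * M⁻¹ * ‖Y‖ ≤ (m⁻¹) ^ 4 * (2 * M * d) := by rw [hc] at n1; linarith
    have n3 : ‖Y‖ = M / 2 * (2 * M⁻¹ * ‖Y‖) := by field_simp
    rw [n3]
    calc _ ≤ M / 2 * ((m⁻¹) ^ 4 * (2 * M * d)) := by gcongr
      _ = _ := by ring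
  have : x * polar G - polar G * x = (x * G - G * x) * r + G * Y := by
    rw [polar, hY]; noncomm_ring
  rw [this]
  calc _ ≤ ‖x * G - G * x‖ * ‖r‖ + ‖G‖ * ‖Y‖ :=
        (norm_add_le _ _).trans (add_le_add (norm_mul_le _ _) (norm_mul_le _ _))
    _ ≤ d * m⁻¹ + M * (M ^ 2 * (m⁻¹) ^ 4 * d) := by gcongr
    _ = _ := by ring

/-- The function `t^{-1/2} - 1` is `t - 1` times a continuous function, so it kills whatever `G⋆G -
1` kills. Hence the polar part agrees with `G` where `G` is already isometric. -/
theorem absInv_mul_of_star_mul_self_mul {G y : B} (hG : ∀ t ∈ spectrum ℝ (star G * G), 0 < t)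
    (hy : star G * G * y = y) : absInv G * y = y := by
  have hsa : IsSelfAdjoint (star G * G) := IsSelfAdjoint.star_mul_self G
  have hc := continuousOn_inv_sqrt hG
  have hg : ContinuousOn (fun t : ℝ => -((√t)⁻¹ * (1 + √t)⁻¹)) (spectrum ℝ (star G * G)) := by
    refine (hc.mul (ContinuousOn.inv₀ (by fun_prop) fun t _ => ?_)).neg
    positivity
  have e : absInv G - 1
      = cfc (fun t : ℝ => -((√t)⁻¹ * (1 + √t)⁻¹)) (star G * G) * (star G * G - 1) := by
    have h1 : star G * G - 1 = cfc (fun t : ℝ => t - 1) (star G * G) := by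
      rw [cfc_sub (fun t : ℝ => t) (fun _ => 1) _, cfc_id' ℝ (star G * G), cfc_const_one ℝ _]
    rw [absInv, h1, ← cfc_const_one ℝ (star G * G), ← cfc_sub _ _ _ hc continuousOn_const,
      ← cfc_mul _ _ _ hg (by fun_prop)]
    refine cfc_congr fun t ht => ?_
    have h2 := Real.sqrt_pos.2 (hG t ht)
    have h3 := Real.sq_sqrt (hG t ht).le
    have h4 : (1 + √t) ≠ 0 := by positivity
    field_simp
    nlinarith
  have : (absInv G - 1) * y = 0 := by
    rw [e, mul_assoc, sub_mul, hy, one_mul, sub_self, mul_zero]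
  rwa [sub_mul, one_mul, sub_eq_zero] at this

/-- One has `t^{-1/2} - 1 = (1 - t)/(√t (1 + √t))`, and the denominator is at least `1` for `t ≥
1/2`. -/
theorem norm_absInv_sub_one_le {G : B} (hG : ‖star G * G - 1‖ ≤ 1 / 2) :
    ‖absInv G - 1‖ ≤ ‖star G * G - 1‖ := by
  have hsa : IsSelfAdjoint (star G * G) := IsSelfAdjoint.star_mul_self G
  have hh : ∀ t ∈ spectrum ℝ (star G * G), |t - 1| ≤ ‖star G * G - 1‖ := fun t ht =>
    abs_sub_one_le_of_mem_spectrum ht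
  have hpos : ∀ t ∈ spectrum ℝ (star G * G), 1 / 2 ≤ t := fun t ht => by
    have := abs_le.1 ((hh t ht).trans hG); linarith
  rw [absInv, ← cfc_const_one ℝ (star G * G), ← cfc_sub _ _ _
    (continuousOn_inv_sqrt fun t ht => by linarith [hpos t ht]) continuousOn_const,
    cfc_const_one ℝ (star G * G)]
  refine norm_cfc_le (norm_nonneg _) fun t ht => le_trans ?_ (hh t ht)
  have h0 := hpos t ht
  have h1 : 0 < √t := Real.sqrt_pos.2 (by linarith)
  have h2 := Real.sq_sqrt (show 0 ≤ t by linarith)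
  have h5 : (7 / 10 : ℝ) ≤ √t := Real.le_sqrt_of_sq_le (by linarith)
  have h6 : 1 ≤ √t * (1 + √t) := by nlinarith
  have e : (√t)⁻¹ - 1 = (1 - t) / (√t * (1 + √t)) := by
    field_simp; nlinarith
  rw [Real.norm_eq_abs, e, abs_div, abs_of_pos (by positivity : 0 < √t * (1 + √t)), abs_sub_comm]
  exact div_le_self (abs_nonneg _) h6

theorem norm_polar_sub_le {G : B} (hG : ‖star G * G - 1‖ ≤ 1 / 2) :
    ‖polar G - G‖ ≤ ‖G‖ * ‖star G * G - 1‖ := by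
  have : polar G - G = G * (absInv G - 1) := by rw [polar]; noncomm_ring
  rw [this]
  exact (norm_mul_le _ _).trans (by gcongr; exact norm_absInv_sub_one_le hG)

theorem polar_of_mem_unitary {G : B} (hG : G ∈ unitary B) : polar G = G := by
  have h : star G * G = 1 := Unitary.star_mul_self_of_mem hG
  have := norm_absInv_sub_one_le (G := G) (by simp [h])
  rw [h, sub_self, norm_zero, norm_le_zero_iff, sub_eq_zero] at this
  rw [polar, this, mul_one]

theorem commute_polar {G x : B} (h1 : Commute x G) (h2 : Commute x (star G)) :
    Commute x (polar G) :=
  h1.mul_right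
    (IsSelfAdjoint.commute_cfc (IsSelfAdjoint.star_mul_self G) (h2.mul_right h1).symm _).symm

theorem continuous_polar : Continuous fun g : Bˣ => polar (g : B) := by
  unfold polar absInv
  refine Units.continuous_val.mul ?_
  have hc : Continuous fun g : Bˣ => star (g : B) * (g : B) :=
    (continuous_star.comp Units.continuous_val).mul Units.continuous_val
  refine Continuous.cfc_of_mem_nhdsSet (s := Ioi 0) _ ?_ hc
    (fun g => IsSelfAdjoint.star_mul_self (g : B)) (continuousOn_inv_sqrt fun t ht => ht)
  refine isOpen_Ioi.mem_nhdsSet.2 (iUnion_subset fun g t ht => ?_)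
  exact pos_of_mem_spectrum_of_isUnit g.isUnit t ht

end Polar
end NormalDist

namespace NormalDist
open Set Filter Topology

/-! ### Smooth cut-offs on the circle -/

section CircleFunctions

/-- A smooth function of `Re z` that is `0` for `Re z ≤ a` and `1` for `b ≤ Re z`. -/
noncomputable def reStep (a b : ℝ) (z : ℂ) : ℂ := (Real.smoothTransition ((z.re - a) / (b - a)) : ℝ)

theorem contDiff_re : ContDiff ℝ 3 fun z : ℂ => z.re := Complex.reCLM.contDiff

theorem contDiff_im : ContDiff ℝ 3 fun z : ℂ => z.im := Complex.imCLM.contDiff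

theorem contDiff_ofReal_comp {f : ℂ → ℝ} (hf : ContDiff ℝ 3 f) :
    ContDiff ℝ 3 fun z : ℂ => (f z : ℂ) := Complex.ofRealCLM.contDiff.comp hf

theorem contDiff_reStep (a b : ℝ) : ContDiff ℝ 3 (reStep a b) :=
  contDiff_ofReal_comp (Real.smoothTransition.contDiff.comp
    ((contDiff_re.sub contDiff_const).div_const _))

@[fun_prop]
theorem continuous_reStep (a b : ℝ) : Continuous (reStep a b) := (contDiff_reStep a b).continuous

theorem reStep_of_le {a b : ℝ} (hab : a < b) {z : ℂ} (hz : z.re ≤ a) : reStep a b z = 0 := by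
  rw [reStep, Real.smoothTransition.zero_of_nonpos, Complex.ofReal_zero]
  exact div_nonpos_of_nonpos_of_nonneg (by linarith) (by linarith)

theorem reStep_of_ge {a b : ℝ} (hab : a < b) {z : ℂ} (hz : b ≤ z.re) : reStep a b z = 1 := by
  rw [reStep, Real.smoothTransition.one_of_one_le, Complex.ofReal_one]
  rw [le_div_iff₀ (by linarith)]; linarith

theorem norm_reStep_le (a b : ℝ) (z : ℂ) : ‖reStep a b z‖ ≤ 1 := by
  rw [reStep, Complex.norm_real, Real.norm_of_nonneg (Real.smoothTransition.nonneg _)]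
  exact Real.smoothTransition.le_one _

theorem norm_one_sub_reStep_le (a b : ℝ) (z : ℂ) : ‖1 - reStep a b z‖ ≤ 1 := by
  rw [reStep, ← Complex.ofReal_one, ← Complex.ofReal_sub, Complex.norm_real,
    Real.norm_of_nonneg (by linarith [Real.smoothTransition.le_one ((z.re - a) / (b - a))])]
  linarith [Real.smoothTransition.nonneg ((z.re - a) / (b - a))]

theorem star_reStep (a b : ℝ) (z : ℂ) : star (reStep a b z) = reStep a b z :=
  Complex.conj_ofReal _

theorem re_sq_add_im_sq_of_mem_sphere {z : ℂ} (hz : z ∈ Metric.sphere (0 : ℂ) 1) :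
    z.re ^ 2 + z.im ^ 2 = 1 := by
  have : ‖z‖ ^ 2 = 1 := by simp [mem_sphere_zero_iff_norm.1 hz]
  rw [← Complex.normSq_eq_norm_sq, Complex.normSq_apply] at this
  linarith

theorem norm_sub_one_sq_of_mem_sphere {z : ℂ} (hz : z ∈ Metric.sphere (0 : ℂ) 1) :
    ‖z - 1‖ ^ 2 = 2 - 2 * z.re := by
  have := re_sq_add_im_sq_of_mem_sphere hz
  rw [← Complex.normSq_eq_norm_sq, Complex.normSq_apply]
  simp; nlinarith

end CircleFunctions

/-! ### Cayley transforms of self-adjoint elements -/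

section Unitaries
variable {B : Type*} [CStarAlgebra B]

theorem isSelfAdjoint_cfc_of_star_eq {f : ℂ → ℂ} (hf : ∀ z, star (f z) = f z) (a : B) :
    IsSelfAdjoint (cfc f a) := by
  rw [IsSelfAdjoint, ← cfc_star]
  simp [hf]

theorem cfc_mul_of_eqOn {a : B} {f g h : ℂ → ℂ} (hf : ContinuousOn f (spectrum ℂ a))
    (hg : ContinuousOn g (spectrum ℂ a)) (hh : ∀ z ∈ spectrum ℂ a, f z * g z = h z) :
    cfc f a * cfc g a = cfc h a := by
  rw [← cfc_mul f g a hf hg]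
  exact cfc_congr hh

theorem norm_cfc_le_of_mem_unitary {a : B} (ha : a ∈ unitary B) {f : ℂ → ℂ} {c : ℝ} (hc : 0 ≤ c)
    (h : ∀ z ∈ Metric.sphere (0 : ℂ) 1, ‖f z‖ ≤ c) : ‖cfc f a‖ ≤ c :=
  norm_cfc_le hc fun z hz => h z (spectrum.subset_circle_of_unitary (𝕜 := ℂ) ha hz)

theorem continuousOn_spectrum_of_finite {a : B} (ha : (spectrum ℂ a).Finite) (f : ℂ → ℂ) :
    ContinuousOn f (spectrum ℂ a) := ha.continuousOn f

/-- The resolvent of a self-adjoint element at `i`. -/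
noncomputable def resolventI (k : B) : B := cfc (fun z : ℂ => (z - Complex.I)⁻¹) k

/-- The Cayley transform of a self-adjoint element. -/
noncomputable def cayley (k : B) : B := cfc (fun z : ℂ => (z + Complex.I) / (z - Complex.I)) k

theorem sub_I_ne_zero_of_im_eq_zero {z : ℂ} (hz : z.im = 0) : z - Complex.I ≠ 0 := by
  intro h
  have := congrArg Complex.im h
  simp [hz] at this

theorem one_le_norm_sub_I_of_im_eq_zero {z : ℂ} (hz : z.im = 0) : 1 ≤ ‖z - Complex.I‖ := by
  have := Complex.abs_im_le_norm (z - Complex.I)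
  simpa [hz] using this

theorem im_eq_zero_of_mem_spectrum {k : B} (hk : IsSelfAdjoint k) {z : ℂ}
    (hz : z ∈ spectrum ℂ k) : z.im = 0 := by
  rw [hk.mem_spectrum_eq_re hz]; simp

theorem continuousOn_inv_sub_I {k : B} (hk : IsSelfAdjoint k) :
    ContinuousOn (fun z : ℂ => (z - Complex.I)⁻¹) (spectrum ℂ k) :=
  ContinuousOn.inv₀ (by fun_prop) fun _ hz =>
    sub_I_ne_zero_of_im_eq_zero (im_eq_zero_of_mem_spectrum hk hz)

theorem continuousOn_cayley {k : B} (hk : IsSelfAdjoint k) :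
    ContinuousOn (fun z : ℂ => (z + Complex.I) / (z - Complex.I)) (spectrum ℂ k) :=
  ContinuousOn.div (by fun_prop) (by fun_prop) fun _ hz =>
    sub_I_ne_zero_of_im_eq_zero (im_eq_zero_of_mem_spectrum hk hz)

theorem norm_resolventI_le {k : B} (hk : IsSelfAdjoint k) : ‖resolventI k‖ ≤ 1 := by
  refine norm_cfc_le zero_le_one fun z hz => ?_
  rw [norm_inv]
  exact inv_le_one_of_one_le₀ (one_le_norm_sub_I_of_im_eq_zero (im_eq_zero_of_mem_spectrum hk hz))

theorem cfc_sub_I {k : B} (hk : IsSelfAdjoint k) :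
    cfc (fun z : ℂ => z - Complex.I) k = k - algebraMap ℂ B Complex.I := by
  have := hk.isStarNormal
  rw [cfc_sub (fun z : ℂ => z) (fun _ => Complex.I) k, cfc_id' ℂ k, cfc_const Complex.I k]

theorem resolventI_mul {k : B} (hk : IsSelfAdjoint k) :
    resolventI k * (k - algebraMap ℂ B Complex.I) = 1 := by
  have := hk.isStarNormal
  rw [← cfc_sub_I hk, resolventI, ← cfc_mul _ _ k (continuousOn_inv_sub_I hk) (by fun_prop),
    ← cfc_const_one ℂ k]
  refine cfc_congr fun z hz => ?_
  exact inv_mul_cancel₀ (sub_I_ne_zero_of_im_eq_zero (im_eq_zero_of_mem_spectrum hk hz))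

theorem mul_resolventI {k : B} (hk : IsSelfAdjoint k) :
    (k - algebraMap ℂ B Complex.I) * resolventI k = 1 := by
  have := hk.isStarNormal
  rw [← cfc_sub_I hk, resolventI, ← cfc_mul _ _ k (by fun_prop) (continuousOn_inv_sub_I hk),
    ← cfc_const_one ℂ k]
  refine cfc_congr fun z hz => ?_
  exact mul_inv_cancel₀ (sub_I_ne_zero_of_im_eq_zero (im_eq_zero_of_mem_spectrum hk hz))

theorem cayley_eq {k : B} (hk : IsSelfAdjoint k) :
    cayley k = (k + algebraMap ℂ B Complex.I) * resolventI k := by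
  have := hk.isStarNormal
  have h : cfc (fun z : ℂ => z + Complex.I) k = k + algebraMap ℂ B Complex.I := by
    rw [cfc_add k (fun z : ℂ => z) (fun _ => Complex.I), cfc_id' ℂ k, cfc_const Complex.I k]
  rw [← h, resolventI, ← cfc_mul _ _ k (by fun_prop) (continuousOn_inv_sub_I hk), cayley]
  rfl

theorem cayley_mul {k : B} (hk : IsSelfAdjoint k) :
    cayley k * (k - algebraMap ℂ B Complex.I) = k + algebraMap ℂ B Complex.I := by
  rw [cayley_eq hk, mul_assoc, resolventI_mul hk, mul_one]

theorem cayley_mem_unitary {k : B} (hk : IsSelfAdjoint k) : cayley k ∈ unitary B := by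
  have := hk.isStarNormal
  rw [cayley, cfc_unitary_iff _ k this (continuousOn_cayley hk)]
  intro z hz
  have h := im_eq_zero_of_mem_spectrum hk hz
  have h1 := sub_I_ne_zero_of_im_eq_zero h
  have hz' : star z = z := by
    rw [hk.mem_spectrum_eq_re hz]; simp
  have h2 : z + Complex.I ≠ 0 := by
    intro h'
    have := congrArg Complex.im h'
    simp [h] at this
  have e : star ((z + Complex.I) / (z - Complex.I)) = (z - Complex.I) / (z + Complex.I) := by
    rw [star_div₀, star_add, star_sub, hz']
    simp [sub_eq_add_neg]
  rw [e]; field_simp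

/-- Since `(k + i)(k - i)⁻¹ = 1 + 2i (k - i)⁻¹`, the resolvent identity gives the bound. -/
theorem norm_cayley_sub_le {k l : B} (hk : IsSelfAdjoint k) (hl : IsSelfAdjoint l) :
    ‖cayley k - cayley l‖ ≤ 2 * ‖k - l‖ := by
  have h : ∀ {k : B}, IsSelfAdjoint k → cayley k = 1 + (2 * Complex.I) • resolventI k := by
    intro k hk
    have : k + algebraMap ℂ B Complex.I
        = (k - algebraMap ℂ B Complex.I) + (2 * Complex.I) • (1 : B) := by
      rw [Algebra.algebraMap_eq_smul_one, mul_smul, two_smul]; abel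
    rw [cayley_eq hk, this, add_mul, mul_resolventI hk, smul_mul_assoc, one_mul]
  have e : cayley k - cayley l = (2 * Complex.I) • (resolventI k * (l - k) * resolventI l) := by
    rw [h hk, h hl, add_sub_add_left_eq_sub, ← smul_sub]
    congr 1
    calc resolventI k - resolventI l
        = resolventI k * ((l - algebraMap ℂ B Complex.I) * resolventI l)
          - (resolventI k * (k - algebraMap ℂ B Complex.I)) * resolventI l := by
          rw [mul_resolventI hl, resolventI_mul hk, mul_one, one_mul]
      _ = _ := by noncomm_ring
  rw [e, norm_smul]
  have h1 := norm_resolventI_le hk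
  have h2 := norm_resolventI_le hl
  have h3 : ‖(2 * Complex.I : ℂ)‖ = 2 := by simp
  rw [h3]
  calc _ ≤ 2 * (‖resolventI k‖ * ‖l - k‖ * ‖resolventI l‖) := by
        gcongr
        exact (norm_mul_le _ _).trans (by gcongr; exact norm_mul_le _ _)
    _ ≤ 2 * (1 * ‖l - k‖ * 1) := by gcongr
    _ = _ := by rw [norm_sub_rev]; ring

theorem finite_spectrum_cfc {k : B} (hn : IsStarNormal k) (hk : (spectrum ℂ k).Finite)
    (f : ℂ → ℂ) : (spectrum ℂ (cfc f k)).Finite := by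
  rw [cfc_map_spectrum f k hn (hk.continuousOn f)]
  exact hk.image f

theorem commute_cayley {k x : B} (hk : IsSelfAdjoint k) (h : Commute x k) :
    Commute x (cayley k) := (IsSelfAdjoint.commute_cfc hk h.symm _).symm

end Unitaries
end NormalDist

namespace NormalDist
open Set Filter Topology

/-! ### Unitaries with a spectral gap -/

section FiniteSpectrumApproximation
variable {B : Type*} [CStarAlgebra B]

/-- Self-adjoint elements are norm limits of self-adjoint elements with finite spectrum. -/
def HasRealRankZero (B : Type*) [CStarAlgebra B] : Prop :=
  ∀ a : B, IsSelfAdjoint a → ∀ ε : ℝ, 0 < ε →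
    ∃ b : B, IsSelfAdjoint b ∧ (spectrum ℂ b).Finite ∧ ‖a - b‖ < ε

/-- `Z` is a norm limit of unitaries with finite spectrum. -/
def IsLimitFiniteSpectrum (Z : B) : Prop :=
  ∀ ε : ℝ, 0 < ε → ∃ v ∈ unitary B, (spectrum ℂ v).Finite ∧ ‖Z - v‖ < ε

/-- The real coordinate on the circle punctured at `1` which is inverse to the Cayley map. -/
noncomputable def cayleyCoord (z : ℂ) : ℂ := ((z.im / (1 - z.re) : ℝ) : ℂ)

theorem one_sub_re_pos {z : ℂ} (hz : z ∈ Metric.sphere (0 : ℂ) 1) (h1 : z ≠ 1) : 0 < 1 - z.re := by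
  have h := norm_sub_one_sq_of_mem_sphere hz
  have : 0 < ‖z - 1‖ := norm_pos_iff.2 (sub_ne_zero.2 h1)
  nlinarith

theorem cayleyCoord_mul {z : ℂ} (hz : z ∈ Metric.sphere (0 : ℂ) 1) (h1 : z.re < 1) :
    z * (cayleyCoord z - Complex.I) = cayleyCoord z + Complex.I := by
  have h2 : (1 - z.re) ≠ 0 := by linarith
  have h3 := re_sq_add_im_sq_of_mem_sphere hz
  have h4 : z.re ^ 2 = 1 - z.im ^ 2 := by linarith
  apply Complex.ext
  · simp only [cayleyCoord, Complex.mul_re, Complex.sub_re, Complex.sub_im, Complex.add_re,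
      Complex.ofReal_re, Complex.ofReal_im, Complex.I_re, Complex.I_im]
    field_simp; ring
  · simp only [cayleyCoord, Complex.mul_im, Complex.sub_re, Complex.sub_im, Complex.add_im,
      Complex.ofReal_re, Complex.ofReal_im, Complex.I_re, Complex.I_im]
    field_simp; ring_nf; rw [h4]; ring

/-- When `1` is missing from the spectrum, the Cayley coordinate is continuous there and `W` is the
Cayley transform of a self-adjoint element, to which real rank zero applies. -/
theorem isLimitFiniteSpectrum_of_one_notMem (hB : HasRealRankZero B) {W : B} (hW : W ∈ unitary B)
    (h1 : (1 : ℂ) ∉ spectrum ℂ W) : IsLimitFiniteSpectrum W := by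
  have nW : IsStarNormal W := isStarNormal_of_mem_unitary hW
  have sW := spectrum.subset_circle_of_unitary (𝕜 := ℂ) hW
  have hre : ∀ z ∈ spectrum ℂ W, 0 < 1 - z.re := fun z hz =>
    one_sub_re_pos (sW hz) (by rintro rfl; exact h1 hz)
  have hc : ContinuousOn cayleyCoord (spectrum ℂ W) := by
    refine Complex.continuous_ofReal.comp_continuousOn ?_
    exact ContinuousOn.div (by fun_prop) (by fun_prop) fun z hz => (hre z hz).ne'
  set k := cfc cayleyCoord W with hk
  have ksa : IsSelfAdjoint k := isSelfAdjoint_cfc_of_star_eq (fun z => Complex.conj_ofReal _) W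
  have hcay : cayley k = W := by
    have e : W * (k - algebraMap ℂ B Complex.I) = k + algebraMap ℂ B Complex.I := by
      have e1 : k - algebraMap ℂ B Complex.I = cfc (fun z => cayleyCoord z - Complex.I) W := by
        rw [cfc_sub cayleyCoord (fun _ => Complex.I) W hc, cfc_const Complex.I W]
      have e2 : k + algebraMap ℂ B Complex.I = cfc (fun z => cayleyCoord z + Complex.I) W := by
        rw [cfc_add W cayleyCoord (fun _ => Complex.I) hc, cfc_const Complex.I W]
      rw [e1, e2]
      nth_rewrite 1 [← cfc_id' ℂ W]
      rw [← cfc_mul (fun z => z) (fun z => cayleyCoord z - Complex.I) W (by fun_prop)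
        (hc.sub continuousOn_const)]
      exact cfc_congr fun z hz => cayleyCoord_mul (sW hz) (by linarith [hre z hz])
    rw [cayley_eq ksa, ← e, mul_assoc, mul_resolventI ksa, mul_one]
  intro ε hε
  obtain ⟨l, hl, hlf, hkl⟩ := hB k ksa (ε / 2) (by positivity)
  refine ⟨cayley l, cayley_mem_unitary hl, finite_spectrum_cfc hl.isStarNormal hlf _, ?_⟩
  rw [← hcay]
  linarith [norm_cayley_sub_le ksa hl]

theorem smul_mem_unitary {ω : ℂ} (hω : ‖ω‖ = 1) {W : B} (hW : W ∈ unitary B) :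
    ω • W ∈ unitary B := by
  have : star ω * ω = 1 := by
    have := Complex.normSq_eq_conj_mul_self (z := ω)
    rw [Complex.normSq_eq_norm_sq, hω] at this
    simpa using this.symm
  have h' : ω * star ω = 1 := by rw [mul_comm]; exact this
  rw [Unitary.mem_iff] at hW ⊢
  simp only [star_smul, smul_mul_smul_comm, this, h', one_smul, hW, and_self]

/-- In real rank zero, a unitary with a gap in its spectrum is a limit of unitaries with finite
spectrum. -/
theorem isLimitFiniteSpectrum_of_notMem (hB : HasRealRankZero B) {W : B} (hW : W ∈ unitary B)
    {ω : ℂ} (hω : ‖ω‖ = 1) (h1 : ω ∉ spectrum ℂ W) : IsLimitFiniteSpectrum W := by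
  have hω0 : ω ≠ 0 := by rintro rfl; simp at hω
  have hω' : ‖ω⁻¹‖ = 1 := by simp [hω]
  have h2 : (1 : ℂ) ∉ spectrum ℂ (ω⁻¹ • W) := by
    intro h
    apply h1
    have := (spectrum.smul_mem_smul_iff (r := Units.mk0 ω hω0) (s := (1 : ℂ)) (a := ω⁻¹ • W)).2 h
    simpa [Units.smul_def, smul_smul, mul_inv_cancel₀ hω0] using this
  intro ε hε
  obtain ⟨v, hv, hvf, hd⟩ := isLimitFiniteSpectrum_of_one_notMem hB (smul_mem_unitary hω' hW) h2 ε hε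
  refine ⟨ω • v, smul_mem_unitary hω hv, ?_, ?_⟩
  · have nv : IsStarNormal v := isStarNormal_of_mem_unitary hv
    have := finite_spectrum_cfc nv hvf (fun z => ω * z)
    rwa [cfc_const_mul_id ω v] at this
  · have : W - ω • v = ω • (ω⁻¹ • W - v) := by rw [smul_sub, smul_smul, mul_inv_cancel₀ hω0, one_smul]
    rw [this, norm_smul, hω, one_mul]
    exact hd

theorem exists_unit_notMem_of_finite {s : Set ℂ} (hs : s.Finite) :
    ∃ ω : ℂ, ‖ω‖ = 1 ∧ ‖ω - 1‖ ≤ 1 / 2 ∧ -ω ∉ s := by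
  have hinf : ((fun t : ℝ => -Complex.exp (t * Complex.I)) '' Ioo 0 (1 / 2)).Infinite := by
    refine (Ioo_infinite (by norm_num)).image fun a ha b hb hab => ?_
    have h : ∀ t ∈ Ioo (0 : ℝ) (1 / 2), (Complex.exp (t * Complex.I)).arg = t := fun t ht => by
      rw [Complex.arg_exp_mul_I, toIocMod_eq_self]
      constructor <;> linarith [ht.1, ht.2, Real.pi_gt_three]
    rw [← h a ha, ← h b hb, neg_injective hab]
  obtain ⟨_, ⟨t, ht, rfl⟩, hts⟩ := (hinf.sdiff hs).nonempty
  refine ⟨Complex.exp (t * Complex.I), Complex.norm_exp_ofReal_mul_I t, ?_, hts⟩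
  rw [mul_comm]
  refine (Real.norm_exp_I_mul_ofReal_sub_one_le).trans ?_
  rw [Real.norm_of_nonneg ht.1.le]
  exact ht.2.le

end FiniteSpectrumApproximation
end NormalDist

namespace NormalDist
open Set Filter Topology

/-! ### Replacing an almost block diagonal unitary by one with a gap -/

section BlockDecomposition
variable {B : Type*} [CStarAlgebra B]

/-- If `Z` is close to `c` on a projection `q` commuting with `c` and close to `1` on `1 - q`, then
any spectral gap of `c` near `-1` is inherited by a unitary close to `Z`. -/
theorem exists_unitary_gap_of_block {Z c q : B} (hZ : Z ∈ unitary B) (hc : c ∈ unitary B)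
    (hq : IsSelfAdjoint q) (hqq : q * q = q) (hcq : Commute q c) {τ : ℝ} (hτ : τ ≤ 1 / 10)
    (h1 : ‖q * (Z - c)‖ ≤ τ) (h2 : ‖(Z - c) * q‖ ≤ τ)
    (h3 : ‖(1 - q) * (Z - 1) * (1 - q)‖ ≤ 4 / 5) {ω : ℂ} (hω : ‖ω - 1‖ ≤ 1 / 2)
    (hωc : -ω ∉ spectrum ℂ c) :
    ∃ G ∈ unitary B, -ω ∉ spectrum ℂ G ∧ ‖Z - G‖ ≤ 4 * τ := by
  have hτ0 : 0 ≤ τ := (norm_nonneg _).trans h1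
  obtain ⟨p, hp⟩ : ∃ p, p = 1 - q := ⟨_, rfl⟩
  rw [← hp] at h3
  have hpsa : IsSelfAdjoint p := hp ▸ (IsSelfAdjoint.one B).sub hq
  have hpp : p * p = p := by
    simp only [hp, mul_sub, sub_mul, hqq, one_mul, mul_one, sub_self, sub_zero]
  have hpq : p * q = 0 := by rw [hp, sub_mul, hqq, one_mul, sub_self]
  have hqp : q * p = 0 := by rw [hp, mul_sub, hqq, mul_one, sub_self]
  have hpq1 : p + q = 1 := by rw [hp]; abel
  have hpn : ‖p‖ ≤ 1 := (IsStarProjection.mk hpp hpsa).norm_le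
  have hcq' : Commute p c := hp ▸ (Commute.one_left c).sub_left hcq
  -- The compression of `Z` to `p`, completed by the identity on `q` so that it is invertible in the
  -- whole algebra. Its polar part `t` replaces `Z` on `p`, while `c` replaces it on `q`.
  obtain ⟨s, hs⟩ : ∃ s, s = q + p * Z * p := ⟨_, rfl⟩
  have hsp : s * p = p * Z * p := by rw [hs, add_mul, hqp, zero_add, mul_assoc _ p p, hpp]
  have hps : p * s = p * Z * p := by rw [hs, mul_add, hpq, zero_add, ← mul_assoc, ← mul_assoc, hpp]
  have hs1 : s - 1 = p * (Z - 1) * p := by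
    rw [mul_sub, sub_mul, mul_one, hpp, hs, ← hpq1]; abel
  have hsu : IsUnit s := by
    have : ‖1 - s‖ < 1 := by rw [norm_sub_rev, hs1]; linarith
    have := isUnit_one_sub_of_norm_lt_one this
    simpa using this
  have hqZp : ‖q * Z * p‖ ≤ τ := by
    have : q * Z * p = q * (Z - c) * p := by
      have : q * c * p = 0 := by rw [hcq.eq, mul_assoc, hqp, mul_zero]
      rw [mul_sub, sub_mul, this, sub_zero]
    rw [this]
    calc _ ≤ ‖q * (Z - c)‖ * ‖p‖ := norm_mul_le _ _
      _ ≤ τ * 1 := by gcongr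
      _ = τ := mul_one _
  have hss : star s = q + p * star Z * p := by
    rw [hs]; simp [hq.star_eq, hpsa.star_eq, mul_assoc]
  -- The defect of unitarity comes only from the off-diagonal corner `q Z p`, and it is quadratic in
  -- it.
  have hs2 : star s * s - 1 = -(star (q * Z * p) * (q * Z * p)) := by
    have e1 : star s * s = q + p * star Z * p * Z * p := by
      rw [hss, hs]
      calc _ = q * q + (q * p) * Z * p + p * star Z * (p * q) + p * star Z * (p * p) * Z * p := by
            noncomm_ring
        _ = _ := by rw [hqq, hqp, hpq, hpp]; simp
    have e2 : star (q * Z * p) * (q * Z * p) = p * star Z * q * Z * p := by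
      rw [star_mul, star_mul, hq.star_eq, hpsa.star_eq]
      calc _ = p * star Z * (q * q) * Z * p := by noncomm_ring
        _ = _ := by rw [hqq]
    have e3 : p * star Z * q * Z * p + p * star Z * p * Z * p = p := by
      calc _ = p * star Z * (p + q) * Z * p := by noncomm_ring
        _ = p * (star Z * Z) * p := by rw [hpq1]; noncomm_ring
        _ = p := by rw [Unitary.star_mul_self_of_mem hZ, mul_one, hpp]
    have e4 : p * star Z * p * Z * p = p - p * star Z * q * Z * p := by
      rw [eq_sub_iff_add_eq, add_comm]; exact e3
    rw [e1, e2, ← hpq1, e4]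
    abel
  have hs3 : ‖star s * s - 1‖ ≤ τ := by
    rw [hs2, norm_neg, CStarRing.norm_star_mul_self]
    nlinarith [norm_nonneg (q * Z * p)]
  have hsn : ‖s‖ ≤ 2 := by
    have hq1 : ‖q‖ ≤ 1 := (IsStarProjection.mk hqq hq).norm_le
    have hZ1 := norm_le_one_of_mem_unitary hZ
    rw [hs]
    calc _ ≤ ‖q‖ + ‖p‖ * ‖Z‖ * ‖p‖ :=
          (norm_add_le _ _).trans (by
            gcongr
            exact (norm_mul_le _ _).trans (by gcongr; exact norm_mul_le _ _))
      _ ≤ 1 + 1 * 1 * 1 := by gcongr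
      _ = 2 := by norm_num
  set t := polar s with ht
  have htu : t ∈ unitary B := polar_mem_unitary hsu
  have hts : ‖t - s‖ ≤ 2 * τ := by
    refine (norm_polar_sub_le (by linarith)).trans ?_
    gcongr
  have hps' : Commute p s := by rw [Commute, SemiconjBy, hps, hsp]
  have hpst : Commute p (star s) := by
    have := hps'.star_star; rwa [hpsa.star_eq] at this
  have hpt : Commute p t := commute_polar hps' hpst
  have hqeq : q = 1 - p := by rw [hp]; abel
  have hqt : Commute q t := by rw [hqeq]; exact (Commute.one_left t).sub_left hpt
  have hpt' : Commute p (star t) := by have := hpt.star_star; rwa [hpsa.star_eq] at this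
  have hqc' : Commute q (star c) := by have := hcq.star_star; rwa [hq.star_eq] at this
  have hG1 : star (t * p + c * q) = star t * p + star c * q := by
    rw [star_add, star_mul, star_mul, hpsa.star_eq, hq.star_eq, hpt'.eq, hqc'.eq]
  have hmul : ∀ a b a' b' : B, Commute p a → Commute q b → Commute p a' → Commute q b' →
      (a * p + b * q) * (a' * p + b' * q) = (a * a') * p + (b * b') * q := by
    intro a b a' b' _ _ ha' hb'
    calc _ = a * (p * a') * p + a * (p * b') * q + b * (q * a') * p + b * (q * b') * q := by
          noncomm_ring
      _ = a * a' * (p * p) + a * p * (b' * q) + b * q * (a' * p) + b * b' * (q * q) := by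
          rw [ha'.eq, hb'.eq]; noncomm_ring
      _ = a * a' * (p * p) + a * (p * q) * b' + b * (q * p) * a' + b * b' * (q * q) := by
          rw [← ha'.eq, ← hb'.eq]; noncomm_ring
      _ = _ := by rw [hpp, hqq, hpq, hqp]; simp
  refine ⟨t * p + c * q, ?_, ?_, ?_⟩
  · rw [Unitary.mem_iff, hG1, hmul _ _ _ _ hpt' hqc' hpt hcq, hmul _ _ _ _ hpt hcq hpt' hqc']
    rw [Unitary.star_mul_self_of_mem htu, Unitary.star_mul_self_of_mem hc,
      Unitary.mul_star_self_of_mem htu, Unitary.mul_star_self_of_mem hc]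
    simp [hpq1]
  -- The constants fit: `‖1 - t‖ ≤ 4/5 + 2τ ≤ 1`, whereas `|1 + ω| ≥ 3/2`.
  · have hu1 : IsUnit (t + algebraMap ℂ B ω) := by
      have hω2 : 3 / 2 ≤ ‖1 + ω‖ := by
        have : (1 + ω) = 2 - (1 - ω) := by ring
        rw [this]
        have h4 := norm_sub_norm_le (2 : ℂ) (1 - ω)
        rw [norm_sub_rev 1 ω] at h4
        have : ‖(2 : ℂ)‖ = 2 := by simp
        linarith
      have hω3 : (1 + ω) ≠ 0 := by intro h; rw [h, norm_zero] at hω2; linarith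
      have hn : ‖(1 + ω)⁻¹ • (1 - t)‖ < 1 := by
        rw [norm_smul, norm_inv, inv_mul_lt_iff₀ (by linarith)]
        have : ‖1 - t‖ ≤ ‖s - 1‖ + ‖t - s‖ := by
          rw [norm_sub_rev 1 t]
          calc ‖t - 1‖ = ‖(s - 1) + (t - s)‖ := by congr 1; abel
            _ ≤ _ := norm_add_le _ _
        rw [hs1] at this
        linarith
      have := (isUnit_one_sub_of_norm_lt_one hn)
      have e : t + algebraMap ℂ B ω = (1 + ω) • (1 - (1 + ω)⁻¹ • (1 - t)) := by
        rw [smul_sub, smul_smul, mul_inv_cancel₀ hω3, Algebra.algebraMap_eq_smul_one, add_smul,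
          one_smul, one_smul]; abel
      rw [e]
      exact this.smul (Units.mk0 (1 + ω) hω3)
    have hu2 : IsUnit (c + algebraMap ℂ B ω) := by
      rw [spectrum.notMem_iff] at hωc
      have e : c + algebraMap ℂ B ω = -(algebraMap ℂ B (-ω) - c) := by rw [map_neg]; abel
      rw [e]; exact hωc.neg
    rw [spectrum.notMem_iff]
    have e : algebraMap ℂ B (-ω) - (t * p + c * q)
        = -((t + algebraMap ℂ B ω) * p + (c + algebraMap ℂ B ω) * q) := by
      rw [add_mul, add_mul, map_neg]
      have : algebraMap ℂ B ω = algebraMap ℂ B ω * p + algebraMap ℂ B ω * q := by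
        rw [← mul_add, hpq1, mul_one]
      nth_rewrite 1 [this]
      abel
    rw [e, IsUnit.neg_iff]
    obtain ⟨v, hv⟩ := hu1
    obtain ⟨w, hw⟩ := hu2
    have cv : Commute p (v : B) := by
      rw [hv]; exact hpt.add_right (Algebra.commutes ω p).symm
    have cw : Commute q (w : B) := by
      rw [hw]; exact hcq.add_right (Algebra.commutes ω q).symm
    rw [← hv, ← hw]
    refine ⟨⟨(v : B) * p + w * q, (↑v⁻¹ : B) * p + (↑w⁻¹ : B) * q, ?_, ?_⟩, rfl⟩
    · rw [hmul _ _ _ _ cv cw cv.units_inv_right cw.units_inv_right]; simp [hpq1]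
    · rw [hmul _ _ _ _ cv.units_inv_right cw.units_inv_right cv cw]; simp [hpq1]
  · have e : Z - (t * p + c * q) = -((t - s) * p) + (Z - c) * q + q * Z * p := by
      have e1 : Z = p * Z * p + q * Z * p + Z * q := by
        calc Z = (p + q) * Z * p + Z * q := by rw [hpq1, one_mul, ← mul_add, hpq1, mul_one]
          _ = _ := by noncomm_ring
      rw [sub_mul, hsp, sub_mul]
      nth_rewrite 1 [e1]
      abel
    rw [e]
    have n1 : ‖(t - s) * p‖ ≤ 2 * τ * 1 := (norm_mul_le _ _).trans (by gcongr)
    calc _ ≤ ‖(t - s) * p‖ + ‖(Z - c) * q‖ + ‖q * Z * p‖ := by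
          refine (norm_add_le _ _).trans (add_le_add ((norm_add_le _ _).trans ?_) le_rfl)
          rw [norm_neg]
      _ ≤ 2 * τ * 1 + τ + τ := by gcongr
      _ = _ := by ring
end BlockDecomposition
end NormalDist

namespace NormalDist
open Set Filter Topology

/-! ### A self-adjoint coordinate with the jump taken from a nearby unitary -/

section ApproximateCoordinate

/-- A globally smooth function that agrees with `cayleyCoord` on the part `Re z ≤ 0.999` of the
circle. -/
noncomputable def cutCoord (z : ℂ) : ℂ :=
  ((z.im / ((1 - z.re) * (1 - Real.smoothTransition ((z.re - 0.999) / 0.0005))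
    + Real.smoothTransition ((z.re - 0.999) / 0.0005)) : ℝ) : ℂ)

theorem le_cutCoord_denom (z : ℂ) :
    0.0005 ≤ (1 - z.re) * (1 - Real.smoothTransition ((z.re - 0.999) / 0.0005))
    + Real.smoothTransition ((z.re - 0.999) / 0.0005) := by
  rcases le_total z.re 0.9995 with h | h
  · have h0 := Real.smoothTransition.nonneg ((z.re - 0.999) / 0.0005)
    have h1 := Real.smoothTransition.le_one ((z.re - 0.999) / 0.0005)
    nlinarith
  · rw [Real.smoothTransition.one_of_one_le]
    · norm_num
    · rw [le_div_iff₀ (by norm_num)]; linarith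

theorem contDiff_cutCoord : ContDiff ℝ 3 cutCoord := by
  have hS : ContDiff ℝ 3 fun z : ℂ => Real.smoothTransition ((z.re - 0.999) / 0.0005) :=
    Real.smoothTransition.contDiff.comp ((contDiff_re.sub contDiff_const).div_const _)
  refine contDiff_ofReal_comp (contDiff_im.div (((contDiff_const.sub contDiff_re).mul
    (contDiff_const.sub hS)).add hS) fun z => ?_)
  have := le_cutCoord_denom z
  intro h
  rw [h] at this
  norm_num at this

theorem cutCoord_eq {z : ℂ} (hz : z.re ≤ 0.999) : cutCoord z = cayleyCoord z := by
  rw [cutCoord, cayleyCoord, Real.smoothTransition.zero_of_nonpos]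
  · simp
  · exact div_nonpos_of_nonpos_of_nonneg (by linarith) (by norm_num)

theorem norm_cutCoord_le {z : ℂ} (hz : z ∈ Metric.sphere (0 : ℂ) 1) : ‖cutCoord z‖ ≤ 2000 := by
  have h := le_cutCoord_denom z
  have h1 : |z.im| ≤ 1 := (Complex.abs_im_le_norm z).trans (mem_sphere_zero_iff_norm.1 hz).le
  rw [cutCoord, Complex.norm_real, Real.norm_eq_abs, abs_div,
    abs_of_pos (lt_of_lt_of_le (by norm_num) h), div_le_iff₀ (lt_of_lt_of_le (by norm_num) h)]
  linarith

open Classical in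
/-- An everywhere defined, discontinuous inverse of the Cayley map up to a small error. -/
noncomputable def jumpCoord (z : ℂ) : ℂ := if z.re ≤ 0.999 then cayleyCoord z else 50

theorem norm_jumpCoord_sub_le {z : ℂ} (hz : z ∈ Metric.sphere (0 : ℂ) 1) :
    ‖jumpCoord z - cutCoord z‖ ≤ 2050 := by
  rw [jumpCoord]
  split_ifs with h
  · rw [cutCoord_eq h]; simp
  · refine (norm_sub_le _ _).trans ?_
    have : ‖(50 : ℂ)‖ = 50 := by simp
    linarith [norm_cutCoord_le hz]

theorem star_jumpCoord (z : ℂ) : star (jumpCoord z) = jumpCoord z := by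
  rw [jumpCoord]
  split_ifs
  · exact Complex.conj_ofReal _
  · simp

theorem star_cutCoord (z : ℂ) : star (cutCoord z) = cutCoord z := Complex.conj_ofReal _

/-- The two coordinates differ only for `Re z > 0.999`, where the cut-off equals `1`. Sandwiching
therefore changes nothing for the function of `u`, but lets the cut-offs be replaced by functions of
`Z`. -/
theorem reStep_mul_jump (z : ℂ) : reStep 0.998 0.999 z * (jumpCoord z - cutCoord z)
    * reStep 0.998 0.999 z = jumpCoord z - cutCoord z := by
  rcases le_total z.re 0.999 with h | h
  · rw [jumpCoord, if_pos h, cutCoord_eq h]; simp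
  · rw [reStep_of_ge (by norm_num) h]; simp

theorem jumpCoord_im (z : ℂ) : (jumpCoord z).im = 0 := by
  rw [← Complex.conj_eq_iff_im]; exact star_jumpCoord z

/-- For `Re z ≤ 0.999` the inversion is exact. Beyond that, `z` is within `0.05` of `1`, and the
Cayley image of the constant `50` is within `0.04` of `1`. -/
theorem norm_cayley_jumpCoord_sub_le {z : ℂ} (hz : z ∈ Metric.sphere (0 : ℂ) 1) :
    ‖(jumpCoord z + Complex.I) / (jumpCoord z - Complex.I) - z‖ ≤ 0.1 := by
  have h0 := sub_I_ne_zero_of_im_eq_zero (jumpCoord_im z)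
  have hn := one_le_norm_sub_I_of_im_eq_zero (jumpCoord_im z)
  have e : (jumpCoord z + Complex.I) / (jumpCoord z - Complex.I) - z
      = (jumpCoord z + Complex.I - z * (jumpCoord z - Complex.I)) / (jumpCoord z - Complex.I) := by
    field_simp
  by_cases h : z.re ≤ 0.999
  · rw [e]
    have : jumpCoord z = cayleyCoord z := if_pos h
    rw [this, cayleyCoord_mul hz (by linarith), sub_self, zero_div, norm_zero]
    norm_num
  · have hj : jumpCoord z = 50 := if_neg h
    rw [hj] at h0 ⊢
    have e1 : (50 + Complex.I) / (50 - Complex.I) - z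
        = 2 * Complex.I / (50 - Complex.I) - (z - 1) := by
      field_simp; ring
    have h1 : 50 ≤ ‖(50 - Complex.I : ℂ)‖ := by
      have := Complex.abs_re_le_norm (50 - Complex.I)
      simpa using this
    have h2 : ‖2 * Complex.I / (50 - Complex.I)‖ ≤ 0.04 := by
      rw [norm_div, div_le_iff₀ (by linarith)]
      simp only [Complex.norm_mul, Complex.norm_I, Complex.norm_ofNat]
      linarith
    have h3 : ‖z - 1‖ ≤ 0.05 := by
      have := norm_sub_one_sq_of_mem_sphere hz
      nlinarith [norm_nonneg (z - 1)]
    rw [e1]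
    refine (norm_sub_le _ _).trans ?_
    linarith

variable {B : Type u} [CStarAlgebra B]

/-- A unitary close to one with finite spectrum has a self-adjoint Cayley coordinate away from an
arc around `1`. -/
theorem exists_approximate_coord : ∃ ε₀ : ℝ, 0 < ε₀ ∧ ∀ {B : Type u} [CStarAlgebra B] {Z u : B},
    Z ∈ unitary B → u ∈ unitary B → (spectrum ℂ u).Finite → ‖Z - u‖ ≤ ε₀ →
    ∃ k : B, IsSelfAdjoint k ∧ Commute (cfc (reStep 0.996 0.997) Z) k ∧
      Commute (cfc (reStep 0.997 0.998) Z) k ∧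
      (1 - cfc (reStep 0.997 0.998) Z) * cayley k = (1 - cfc (reStep 0.997 0.998) Z) * Z ∧
      ‖Z - cayley k‖ ≤ 0.12 := by
  obtain ⟨C₁, hC₁, H₁⟩ := exists_operatorLipschitz.{u} contDiff_cutCoord
  obtain ⟨C₂, hC₂, H₂⟩ := exists_operatorLipschitz.{u} (contDiff_reStep 0.998 0.999)
  refine ⟨0.001 / (1 + C₁ + 4100 * C₂), by positivity, ?_⟩
  intro B _ Z u hZ hu huf hZu
  set ε₀ := 0.001 / (1 + C₁ + 4100 * C₂) with hε₀
  have nZ : IsStarNormal Z := isStarNormal_of_mem_unitary hZ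
  have nu : IsStarNormal u := isStarNormal_of_mem_unitary hu
  have sZ := spectrum.subset_circle_of_unitary (𝕜 := ℂ) hZ
  have cu : ∀ f : ℂ → ℂ, ContinuousOn f (spectrum ℂ u) := fun f => huf.continuousOn f
  have cc : ∀ s, ContinuousOn cutCoord s := fun s => contDiff_cutCoord.continuous.continuousOn
  have cr : ∀ (a b : ℝ) s, ContinuousOn (reStep a b) s := fun a b s =>
    (continuous_reStep a b).continuousOn
  set X := cfc (reStep 0.998 0.999) Z with hX
  set Xu := cfc (reStep 0.998 0.999) u with hXu
  set R := cfc (fun z => jumpCoord z - cutCoord z) u with hR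
  set l := cfc cutCoord Z with hl
  have Xsa : IsSelfAdjoint X := isSelfAdjoint_cfc_of_star_eq (star_reStep _ _) Z
  have Rsa : IsSelfAdjoint R := isSelfAdjoint_cfc_of_star_eq
    (fun z => by rw [star_sub, star_jumpCoord, star_cutCoord]) u
  have lsa : IsSelfAdjoint l := isSelfAdjoint_cfc_of_star_eq star_cutCoord Z
  have XRX : IsSelfAdjoint (X * R * X) := by
    have := Rsa.conjugate X
    rwa [Xsa.star_eq] at this
  -- The smooth part comes from `Z`, the jump from `u`, whose finite spectrum makes every function
  -- continuous on it. Sandwiching by `X` confines the jump to the arc near `1` as seen by `Z`.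
  obtain ⟨k, hk⟩ : ∃ k, k = l + X * R * X := ⟨_, rfl⟩
  have ksa : IsSelfAdjoint k := hk ▸ lsa.add XRX
  set k₀ := cfc jumpCoord u with hk₀
  have k₀sa : IsSelfAdjoint k₀ := isSelfAdjoint_cfc_of_star_eq star_jumpCoord u
  have hRn : ‖R‖ ≤ 2050 := norm_cfc_le_of_mem_unitary hu (by norm_num)
    fun z hz => norm_jumpCoord_sub_le hz
  have hXn : ‖X‖ ≤ 1 := norm_cfc_le_of_mem_unitary hZ zero_le_one fun z _ => norm_reStep_le _ _ z
  have hXun : ‖Xu‖ ≤ 1 := norm_cfc_le_of_mem_unitary hu zero_le_one fun z _ => norm_reStep_le _ _ z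
  have hk₀' : k₀ = cfc cutCoord u + Xu * R * Xu := by
    have : Xu * R * Xu = R := by
      rw [hXu, hR, ← cfc_mul _ _ u (cu _) (cu _), ← cfc_mul _ _ u (cu _) (cu _)]
      exact congrArg (fun f => cfc f u) (funext reStep_mul_jump)
    rw [this, hR, cfc_sub jumpCoord cutCoord u (cu _) (cu _)]; abel
  have hkk : ‖k - k₀‖ ≤ 0.001 := by
    have e : k - k₀ = (l - cfc cutCoord u) + (X - Xu) * R * X + Xu * R * (X - Xu) := by
      rw [hk, hk₀']; noncomm_ring
    have n1 : ‖l - cfc cutCoord u‖ ≤ C₁ * ε₀ := by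
      have := H₁ 1 hZ hu
      simp only [one_mul, mul_one] at this
      exact this.trans (by gcongr)
    have n2 : ‖X - Xu‖ ≤ C₂ * ε₀ := by
      have := H₂ 1 hZ hu
      simp only [one_mul, mul_one] at this
      exact this.trans (by gcongr)
    rw [e]
    calc _ ≤ ‖l - cfc cutCoord u‖ + ‖X - Xu‖ * ‖R‖ * ‖X‖ + ‖Xu‖ * ‖R‖ * ‖X - Xu‖ := by
          refine (norm_add_le _ _).trans (add_le_add ((norm_add_le _ _).trans
            (add_le_add le_rfl ?_)) ?_)
          · exact (norm_mul_le _ _).trans (by gcongr; exact norm_mul_le _ _)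
          · exact (norm_mul_le _ _).trans (by gcongr; exact norm_mul_le _ _)
      _ ≤ C₁ * ε₀ + (C₂ * ε₀) * 2050 * 1 + 1 * 2050 * (C₂ * ε₀) := by gcongr
      _ = (C₁ + 4100 * C₂) * ε₀ := by ring
      _ ≤ (1 + C₁ + 4100 * C₂) * ε₀ := by gcongr; linarith
      _ = 0.001 := by rw [hε₀]; field_simp
  have hε₀1 : ε₀ ≤ 0.001 := by
    rw [hε₀]
    exact div_le_self (by norm_num) (by nlinarith)
  -- A cut-off equal to `1` on the support of the one defining `X` acts as the identity on both
  -- sides of `X R X`.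
  have comm : ∀ {a b : ℝ}, a < b → b ≤ 0.998 → Commute (cfc (reStep a b) Z) k := by
    intro a b hab hb
    have h1 : cfc (reStep a b) Z * X = X := by
      rw [hX, ← cfc_mul _ _ Z (cr _ _ _) (cr _ _ _)]
      congr 1
      ext z
      rcases le_total z.re 0.998 with h | h
      · rw [reStep_of_le (by norm_num) h, mul_zero]
      · rw [reStep_of_ge hab (hb.trans h), one_mul]
    have h2 : X * cfc (reStep a b) Z = X := by
      have : Commute (cfc (reStep a b) Z) X := cfc_commute_cfc _ _ Z
      rw [← this.eq, h1]
    rw [hk]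
    refine Commute.add_right (cfc_commute_cfc _ _ Z) ?_
    rw [Commute, SemiconjBy, ← mul_assoc, ← mul_assoc, h1, mul_assoc (X * R) X, h2]
  have ce := comm (a := 0.997) (b := 0.998) (by norm_num) le_rfl
  refine ⟨k, ksa, comm (by norm_num) (by norm_num), ce, ?_, ?_⟩
  · set e := cfc (reStep 0.997 0.998) Z with he
    have e3 : 1 - e = cfc (fun z => 1 - reStep 0.997 0.998 z) Z := by
      rw [cfc_sub (fun _ => 1) (reStep 0.997 0.998) Z continuousOn_const (cr _ _ _),
        cfc_const_one ℂ Z]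
    have heX : (1 - e) * X = 0 := by
      rw [e3, hX, ← cfc_const_zero ℂ Z]
      refine cfc_mul_of_eqOn (continuousOn_const.sub (cr _ _ _)) (cr _ _ _) fun z _ => ?_
      rcases le_total z.re 0.998 with h | h
      · simp [reStep_of_le (show (0.998 : ℝ) < 0.999 by norm_num) h]
      · simp [reStep_of_ge (show (0.997 : ℝ) < 0.998 by norm_num) h]
    have hek : (1 - e) * k = (1 - e) * l := by
      rw [hk, mul_add, ← mul_assoc, ← mul_assoc, heX, zero_mul, zero_mul, add_zero]
    have c1 : Commute (1 - e) k := (Commute.one_left k).sub_left ce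
    have c2 : Commute (1 - e) (cayley k) := commute_cayley ksa c1
    have cZ : Commute (1 - e) Z := by
      have h : Commute e Z := by
        have := cfc_commute_cfc (reStep 0.997 0.998) (fun z : ℂ => z) Z
        rwa [cfc_id' ℂ Z] at this
      exact (Commute.one_left Z).sub_left h
    have hl' : (1 - e) * (l + algebraMap ℂ B Complex.I)
        = (1 - e) * (Z * (l - algebraMap ℂ B Complex.I)) := by
      have e1 : l - algebraMap ℂ B Complex.I = cfc (fun z => cutCoord z - Complex.I) Z := by
        rw [cfc_sub cutCoord (fun _ => Complex.I) Z (cc _), cfc_const Complex.I Z]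
      have e2 : l + algebraMap ℂ B Complex.I = cfc (fun z => cutCoord z + Complex.I) Z := by
        rw [cfc_add Z cutCoord (fun _ => Complex.I) (cc _), cfc_const Complex.I Z]
      have e4 : Z * (l - algebraMap ℂ B Complex.I)
          = cfc (fun z => z * (cutCoord z - Complex.I)) Z := by
        rw [cfc_mul (fun z : ℂ => z) (fun z => cutCoord z - Complex.I) Z continuousOn_id
          ((cc _).sub continuousOn_const), cfc_id' ℂ Z, ← e1]
      have e5 : (1 - e) * cfc (fun z => z * (cutCoord z - Complex.I)) Z
          = cfc (fun z => (1 - reStep 0.997 0.998 z) * (z * (cutCoord z - Complex.I))) Z := by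
        rw [e3]
        exact cfc_mul_of_eqOn (continuousOn_const.sub (cr _ _ _))
          (continuousOn_id.mul ((cc _).sub continuousOn_const)) fun z _ => rfl
      rw [e4, e2, e5, e3]
      refine cfc_mul_of_eqOn (continuousOn_const.sub (cr _ _ _))
        ((cc _).add continuousOn_const) fun z hz => ?_
      rcases le_total z.re 0.998 with h | h
      · rw [cutCoord_eq (by linarith), cayleyCoord_mul (sZ hz) (by linarith)]
      · simp [reStep_of_ge (show (0.997 : ℝ) < 0.998 by norm_num) h]
    have h1 : (1 - e) * cayley k * (k - algebraMap ℂ B Complex.I)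
        = (1 - e) * Z * (k - algebraMap ℂ B Complex.I) := by
      -- Under `1 - e` the jump term disappears, so `k` may be exchanged for the function `l` of
      -- `Z`, where the Cayley relation holds pointwise.
      have hek' : (1 - e) * (k + algebraMap ℂ B Complex.I)
          = (1 - e) * (l + algebraMap ℂ B Complex.I) := by
        rw [mul_add (1 - e) k, mul_add, hek]
      have hek'' : (1 - e) * (k - algebraMap ℂ B Complex.I)
          = (1 - e) * (l - algebraMap ℂ B Complex.I) := by
        rw [mul_sub (1 - e) k, mul_sub, hek]
      rw [mul_assoc, cayley_mul ksa, hek', hl', cZ.eq, mul_assoc Z, hek'', ← mul_assoc Z, ← cZ.eq,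
        mul_assoc]
    calc (1 - e) * cayley k
        = (1 - e) * cayley k * ((k - algebraMap ℂ B Complex.I) * resolventI k) := by
          rw [mul_resolventI ksa, mul_one]
      _ = (1 - e) * Z * ((k - algebraMap ℂ B Complex.I) * resolventI k) := by
          rw [← mul_assoc, h1, mul_assoc]
      _ = _ := by rw [mul_resolventI ksa, mul_one]
  -- The bound `0.12` collects `‖Z - u‖ ≤ 0.001`, this error `0.1`, and `2 ‖k - k₀‖ ≤ 0.002`.
  · have h1 : ‖cayley k₀ - u‖ ≤ 0.1 := by
      have : cayley k₀ - u = cfc (fun z => (jumpCoord z + Complex.I) / (jumpCoord z - Complex.I) - z) u := by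
        rw [cfc_sub _ (fun z => z) u (cu _) (cu _), cfc_id' ℂ u, cayley, hk₀,
          ← cfc_comp (fun z : ℂ => (z + Complex.I) / (z - Complex.I)) jumpCoord u nu
            ((huf.image _).continuousOn _) (cu _)]
        rfl
      rw [this]
      exact norm_cfc_le_of_mem_unitary hu (by norm_num) fun z hz => norm_cayley_jumpCoord_sub_le hz
    have h2 := norm_cayley_sub_le ksa k₀sa
    have : Z - cayley k = (Z - u) - (cayley k₀ - u) - (cayley k - cayley k₀) := by abel
    rw [this]
    refine (norm_sub_le _ _).trans ?_
    have := norm_sub_le (Z - u) (cayley k₀ - u)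
    linarith

end ApproximateCoordinate
end NormalDist

namespace NormalDist
open Set Filter Topology

/-! ### Finite spectrum approximation on the identity component -/

section LimitsOfFiniteSpectrum

/-- A continuous function which is the inverse of `z - 1` for `|z - 1| ≥ 1 / 2`. -/
noncomputable def cutInv (z : ℂ) : ℂ := star (z - 1) * ((max (‖z - 1‖ ^ 2) (1 / 4))⁻¹ : ℝ)

theorem continuous_cutInv : Continuous cutInv := by
  refine Continuous.mul (by fun_prop) (Complex.continuous_ofReal.comp (Continuous.inv₀ (by fun_prop) ?_))
  intro z
  positivity

theorem norm_cutInv_le (z : ℂ) : ‖cutInv z‖ ≤ 2 := by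
  have h : 0 < max (‖z - 1‖ ^ 2) (1 / 4) := by positivity
  rw [cutInv, norm_mul, norm_star, Complex.norm_real, norm_inv, Real.norm_of_nonneg h.le,
    ← div_eq_mul_inv, div_le_iff₀ h]
  rcases le_total ‖z - 1‖ (1 / 2) with h1 | h1
  · have := le_max_right (‖z - 1‖ ^ 2) (1 / 4); linarith
  · have := le_max_left (‖z - 1‖ ^ 2) (1 / 4); nlinarith

theorem sub_one_mul_cutInv {z : ℂ} (hz : 1 / 2 ≤ ‖z - 1‖) : (z - 1) * cutInv z = 1 := by
  have h : max (‖z - 1‖ ^ 2) (1 / 4) = ‖z - 1‖ ^ 2 := max_eq_left (by nlinarith)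
  have h0 : ‖z - 1‖ ^ 2 ≠ 0 := by positivity
  rw [cutInv, h, ← mul_assoc, RCLike.star_def, Complex.mul_conj, Complex.normSq_eq_norm_sq,
    ← Complex.ofReal_mul, mul_inv_cancel₀ h0, Complex.ofReal_one]

/-- Two unitaries which are both close to `1` on `e'`, in the presence of commutation, have no
joint spectrum on `e` far from `1`. -/
theorem cfc_mul_eq_zero_of_near_one {B : Type*} [CStarAlgebra B] {c e e' : B} (hc : c ∈ unitary B)
    (hee : e' * e = e) (hec : Commute e c) (hesa : IsSelfAdjoint e)
    (hn : ‖e' * (c - 1)‖ < 1 / 2) :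
    e * cfc (fun z => 1 - reStep 0.82 0.875 z) c = 0 := by
  have nc : IsStarNormal c := isStarNormal_of_mem_unitary hc
  have sc := spectrum.subset_circle_of_unitary (𝕜 := ℂ) hc
  set f := cfc (fun z => 1 - reStep 0.82 0.875 z) c with hf
  have hcf : ContinuousOn (fun z => 1 - reStep 0.82 0.875 z) (spectrum ℂ c) := by fun_prop
  have hcg : ContinuousOn cutInv (spectrum ℂ c) := continuous_cutInv.continuousOn
  have comm : ∀ g : ℂ → ℂ, Commute e (cfc g c) := by
    intro g
    have : Commute e (star c) := by have := hec.star_star; rwa [hesa.star_eq] at this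
    exact (Commute.cfc hec.symm this.symm g).symm
  have h1 : cfc (fun z : ℂ => z - 1) c = c - 1 := by
    rw [cfc_sub (fun z : ℂ => z) (fun _ => 1) c, cfc_id' ℂ c, cfc_const_one ℂ c]
  have h2 : (c - 1) * cfc cutInv c * f = f := by
    rw [← h1, cfc_mul_of_eqOn (h := fun z => (z - 1) * cutInv z) (by fun_prop) hcg fun z _ => rfl]
    refine cfc_mul_of_eqOn (ContinuousOn.mul (by fun_prop) hcg) hcf fun z hz => ?_
    have hz' := norm_sub_one_sq_of_mem_sphere (sc hz)
    rcases le_total z.re 0.875 with h | h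
    · rw [sub_one_mul_cutInv, one_mul]
      nlinarith [norm_nonneg (z - 1)]
    · rw [reStep_of_ge (by norm_num) h]; simp
  -- On the support of `f` the inverse of `c - 1` has norm at most `2`, while `e' (c - 1)` has norm
  -- below `1/2`. So `e f` is strictly smaller than itself in norm unless it vanishes. The threshold
  -- `0.875` is where `|z - 1| = 1/2` on the circle.
  have h3 : e * f = (e' * (c - 1)) * (cfc cutInv c * (e * f)) := by
    calc e * f = e' * e * ((c - 1) * cfc cutInv c * f) := by rw [hee, h2]
      _ = e' * (e * (c - 1)) * cfc cutInv c * f := by noncomm_ring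
      _ = e' * ((c - 1) * e) * cfc cutInv c * f := by
          rw [((hec.sub_right (Commute.one_right e)).eq : e * (c - 1) = (c - 1) * e)]
      _ = (e' * (c - 1)) * ((e * cfc cutInv c) * f) := by noncomm_ring
      _ = _ := by rw [(comm cutInv).eq]; noncomm_ring
  have h4 : ‖cfc cutInv c‖ ≤ 2 := norm_cfc_le (by norm_num) fun z _ => norm_cutInv_le z
  have h5 : ‖e * f‖ ≤ ‖e' * (c - 1)‖ * (2 * ‖e * f‖) := by
    nth_rewrite 1 [h3]
    refine (norm_mul_le _ _).trans ?_
    gcongr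
    exact (norm_mul_le _ _).trans (by gcongr)
  rw [← norm_le_zero_iff]
  by_contra! hpos
  nlinarith

/-- In real rank zero, a unitary uniformly close to one with finite spectrum is a limit of unitaries
with finite spectrum. -/
theorem exists_isLimitFiniteSpectrum_of_close : ∃ ε₀ : ℝ, 0 < ε₀ ∧
    ∀ {B : Type u} [CStarAlgebra B] {Z u : B}, HasRealRankZero B →
    Z ∈ unitary B → u ∈ unitary B → (spectrum ℂ u).Finite → ‖Z - u‖ ≤ ε₀ →
    IsLimitFiniteSpectrum Z := by
  obtain ⟨ε₀, hε₀, H⟩ := exists_approximate_coord.{u}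
  obtain ⟨K, hK, HK⟩ := exists_operatorLipschitz.{u}
    (contDiff_const.sub (contDiff_reStep 0.82 0.875) : ContDiff ℝ 3 fun z : ℂ => 1 - reStep 0.82 0.875 z)
  refine ⟨ε₀, hε₀, ?_⟩
  intro B _ Z u hB hZ hu huf hZu ε hε
  obtain ⟨k, ksa, ce', ce, hek, hZk⟩ := H hZ hu huf hZu
  have cr : ∀ (a b : ℝ) s, ContinuousOn (reStep a b) s := fun a b s =>
    (continuous_reStep a b).continuousOn
  have nZ : IsStarNormal Z := isStarNormal_of_mem_unitary hZ
  have sZ := spectrum.subset_circle_of_unitary (𝕜 := ℂ) hZ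
  set e := cfc (reStep 0.997 0.998) Z with he
  set e' := cfc (reStep 0.996 0.997) Z with he'
  set c := cayley k with hc
  have hcu : c ∈ unitary B := cayley_mem_unitary ksa
  have esa : IsSelfAdjoint e := isSelfAdjoint_cfc_of_star_eq (star_reStep _ _) Z
  have hen : ‖e‖ ≤ 1 := norm_cfc_le_of_mem_unitary hZ zero_le_one fun z _ => norm_reStep_le _ _ z
  have hen' : ‖e'‖ ≤ 1 := norm_cfc_le_of_mem_unitary hZ zero_le_one fun z _ => norm_reStep_le _ _ z
  have cec : Commute e c := commute_cayley ksa ce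
  have hee : e' * e = e := by
    refine cfc_mul_of_eqOn (cr _ _ _) (cr _ _ _) fun z _ => ?_
    rcases le_total z.re 0.997 with h | h
    · rw [reStep_of_le (show (0.997 : ℝ) < 0.998 by norm_num) h, mul_zero]
    · rw [reStep_of_ge (by norm_num) h, one_mul]
  have hn : ‖e' * (c - 1)‖ < 1 / 2 := by
    have h1 : ‖e' * (Z - 1)‖ ≤ 0.1 := by
      have : e' * (Z - 1) = cfc (fun z => reStep 0.996 0.997 z * (z - 1)) Z := by
        have : Z - 1 = cfc (fun z : ℂ => z - 1) Z := by
          rw [cfc_sub (fun z : ℂ => z) (fun _ => 1) Z, cfc_id' ℂ Z, cfc_const_one ℂ Z]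
        rw [this]
        exact cfc_mul_of_eqOn (cr _ _ _) (by fun_prop) fun z _ => rfl
      rw [this]
      refine norm_cfc_le_of_mem_unitary hZ (by norm_num) fun z hz => ?_
      rcases le_total z.re 0.996 with h | h
      · rw [reStep_of_le (by norm_num) h]; simp; norm_num
      · rw [norm_mul]
        have h2 := norm_reStep_le 0.996 0.997 z
        have h3 : ‖z - 1‖ ≤ 0.1 := by
          have := norm_sub_one_sq_of_mem_sphere hz
          nlinarith [norm_nonneg (z - 1)]
        nlinarith [norm_nonneg (z - 1), norm_nonneg (reStep 0.996 0.997 z)]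
    have h2 : e' * (c - 1) = e' * (Z - 1) - e' * (Z - c) := by noncomm_ring
    have h3 : ‖e' * (Z - c)‖ ≤ 1 * 0.12 := (norm_mul_le _ _).trans (by gcongr)
    rw [h2]
    linarith [norm_sub_le (e' * (Z - 1)) (e' * (Z - c))]
  have hef := cfc_mul_eq_zero_of_near_one hcu hee cec esa hn
  set F : ℂ → ℂ := fun z => 1 - reStep 0.82 0.875 z with hF
  -- The first entry keeps `τ` below `1/10` and the perturbations below `0.15`; the second makes the
  -- final error `4τ` at most `ε/2`.
  set η := min (0.01 / (1 + 4 * K)) (ε / (32 * (1 + 4 * K))) with hη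
  have hη0 : 0 < η := by positivity
  obtain ⟨k₁, k₁sa, k₁f, hkk⟩ := hB k ksa η hη0
  set c₁ := cayley k₁ with hc₁
  have hc₁u : c₁ ∈ unitary B := cayley_mem_unitary k₁sa
  have hc₁f : (spectrum ℂ c₁).Finite := finite_spectrum_cfc k₁sa.isStarNormal k₁f _
  have nc₁ : IsStarNormal c₁ := isStarNormal_of_mem_unitary hc₁u
  have sc₁ := spectrum.subset_circle_of_unitary (𝕜 := ℂ) hc₁u
  have hcc : ‖c - c₁‖ ≤ 2 * η := (norm_cayley_sub_le ksa k₁sa).trans (by gcongr)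
  have cf : ∀ g : ℂ → ℂ, ContinuousOn g (spectrum ℂ c₁) := fun g => hc₁f.continuousOn g
  classical
  -- A discontinuous indicator is admissible because `c₁` has finite spectrum; `q` is the spectral
  -- projection of `c₁` on the part far from `1`.
  set I : ℂ → ℂ := fun z => if z.re ≤ 0.82 then 1 else 0 with hI
  set q := cfc I c₁ with hq
  have qsa : IsSelfAdjoint q := isSelfAdjoint_cfc_of_star_eq
    (fun z => by simp only [hI]; split_ifs <;> simp) c₁
  have hqq : q * q = q := cfc_mul_of_eqOn (cf _) (cf _) fun z _ => by
    simp only [hI]; split_ifs <;> simp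
  have hqn : ‖q‖ ≤ 1 := (IsStarProjection.mk hqq qsa).norm_le
  have hqF : q * cfc F c₁ = q := cfc_mul_of_eqOn (cf _) (cf _) fun z _ => by
    simp only [hI, hF]
    split_ifs with h
    · rw [reStep_of_le (by norm_num) h]; simp
    · simp
  have cqc : Commute q c₁ := by
    have := cfc_commute_cfc I (fun z : ℂ => z) c₁
    rwa [cfc_id' ℂ c₁] at this
  have hFe : cfc F c * e = 0 := by
    have := congrArg star hef
    rw [star_mul, esa.star_eq, star_zero, ← cfc_star] at this
    simpa [star_reStep, hF] using this
  -- The projection `q` is almost orthogonal to `e`, which carries all of `Z - c`: it is absorbed by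
  -- `F(c₁)`, whereas `F(c) e = 0`, and `F` is operator Lipschitz.
  have hqe : ‖q * e‖ ≤ K * (2 * η) := by
    have h1 : q * e = q * (cfc F c₁ - cfc F c) * e := by
      rw [mul_sub, sub_mul, hqF, mul_assoc q (cfc F c), hFe, mul_zero, sub_zero]
    have h2 : ‖cfc F c₁ - cfc F c‖ ≤ K * (2 * η) := by
      have := HK 1 hc₁u hcu
      simp only [one_mul, mul_one] at this
      rw [norm_sub_rev c₁] at this
      exact this.trans (by gcongr)
    rw [h1]
    calc _ ≤ ‖q‖ * ‖cfc F c₁ - cfc F c‖ * ‖e‖ :=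
          (norm_mul_le _ _).trans (by gcongr; exact norm_mul_le _ _)
      _ ≤ 1 * (K * (2 * η)) * 1 := by gcongr
      _ = _ := by ring
  have heq : ‖e * q‖ ≤ K * (2 * η) := by
    have : e * q = star (q * e) := by rw [star_mul, esa.star_eq, qsa.star_eq]
    rw [this, norm_star]; exact hqe
  have hZc1 : Z - c = e * (Z - c) := by
    have : (1 - e) * (Z - c) = 0 := by rw [mul_sub, hek, sub_self]
    rw [sub_mul, one_mul, sub_eq_zero] at this
    exact this
  have ceZ : Commute e Z := by
    have := cfc_commute_cfc (reStep 0.997 0.998) (fun z : ℂ => z) Z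
    rwa [cfc_id' ℂ Z] at this
  have hZc2 : Z - c = (Z - c) * e := by
    rw [← (ceZ.sub_right cec).eq]; exact hZc1
  have hZcn : ‖Z - c‖ ≤ 1 := hZk.trans (by norm_num)
  set τ := (2 * K + 2) * η with hτ
  have t1 : ‖q * (Z - c₁)‖ ≤ τ := by
    have : q * (Z - c₁) = q * e * (Z - c) + q * (c - c₁) := by
      rw [mul_assoc, ← hZc1]; noncomm_ring
    rw [this]
    calc _ ≤ ‖q * e‖ * ‖Z - c‖ + ‖q‖ * ‖c - c₁‖ :=
          (norm_add_le _ _).trans (add_le_add (norm_mul_le _ _) (norm_mul_le _ _))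
      _ ≤ K * (2 * η) * 1 + 1 * (2 * η) := by gcongr
      _ = τ := by rw [hτ]; ring
  have t2 : ‖(Z - c₁) * q‖ ≤ τ := by
    have : (Z - c₁) * q = (Z - c) * (e * q) + (c - c₁) * q := by
      rw [← mul_assoc, ← hZc2]; noncomm_ring
    rw [this]
    calc _ ≤ ‖Z - c‖ * ‖e * q‖ + ‖c - c₁‖ * ‖q‖ :=
          (norm_add_le _ _).trans (add_le_add (norm_mul_le _ _) (norm_mul_le _ _))
      _ ≤ 1 * (K * (2 * η)) + (2 * η) * 1 := by gcongr
      _ = τ := by rw [hτ]; ring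
  have hη1 : (1 + 4 * K) * η ≤ 0.01 := by
    calc _ ≤ (1 + 4 * K) * (0.01 / (1 + 4 * K)) := by gcongr; exact min_le_left _ _
      _ = _ := by field_simp
  have hη2 : (1 + 4 * K) * η ≤ ε / 32 := by
    calc _ ≤ (1 + 4 * K) * (ε / (32 * (1 + 4 * K))) := by gcongr; exact min_le_right _ _
      _ = _ := by field_simp
  have hKη : 0 ≤ K * η := by positivity
  -- For `Re z > 0.82` on the circle `|z - 1| < 0.6`; replacing `c₁` by `Z` costs at most `0.15`,
  -- and the sum is below `4/5`.
  have t3 : ‖(1 - q) * (Z - 1) * (1 - q)‖ ≤ 4 / 5 := by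
    have hp : (1 - q) = cfc (fun z => 1 - I z) c₁ := by
      rw [cfc_sub (fun _ => 1) I c₁ continuousOn_const (cf _), cfc_const_one ℂ c₁]
    have hpn : ‖1 - q‖ ≤ 1 := by
      rw [hp]
      refine norm_cfc_le_of_mem_unitary hc₁u zero_le_one fun z _ => ?_
      simp only [hI]; split_ifs <;> simp
    have h1 : ‖(1 - q) * (c₁ - 1)‖ ≤ 0.6 := by
      have : c₁ - 1 = cfc (fun z : ℂ => z - 1) c₁ := by
        rw [cfc_sub (fun z : ℂ => z) (fun _ => 1) c₁, cfc_id' ℂ c₁, cfc_const_one ℂ c₁]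
      rw [this, hp, cfc_mul_of_eqOn (h := fun z => (1 - I z) * (z - 1)) (cf _) (cf _) fun z _ => rfl]
      refine norm_cfc_le_of_mem_unitary hc₁u (by norm_num) fun z hz => ?_
      simp only [hI]
      split_ifs with h
      · simp; norm_num
      · have := norm_sub_one_sq_of_mem_sphere hz
        rw [sub_zero, one_mul]
        nlinarith [norm_nonneg (z - 1)]
    have h2 : (1 - q) * (Z - 1) * (1 - q) = (1 - q) * (c₁ - 1) * (1 - q)
        + (1 - q) * ((Z - c) + (c - c₁)) * (1 - q) := by noncomm_ring
    have h3 : ‖(Z - c) + (c - c₁)‖ ≤ 0.15 := (norm_add_le _ _).trans (by nlinarith)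
    rw [h2]
    calc _ ≤ ‖(1 - q) * (c₁ - 1)‖ * ‖1 - q‖ + ‖1 - q‖ * ‖(Z - c) + (c - c₁)‖ * ‖1 - q‖ :=
          (norm_add_le _ _).trans (add_le_add (norm_mul_le _ _)
            ((norm_mul_le _ _).trans (by gcongr; exact norm_mul_le _ _)))
      _ ≤ 0.6 * 1 + 1 * 0.15 * 1 := by gcongr
      _ ≤ _ := by norm_num
  obtain ⟨ω, hω1, hω2, hω3⟩ := exists_unit_notMem_of_finite hc₁f
  obtain ⟨G, hG, hGω, hZG⟩ := exists_unitary_gap_of_block hZ hc₁u qsa hqq cqc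
    (τ := τ) (by rw [hτ]; nlinarith) t1 t2 t3 hω2 hω3
  obtain ⟨v, hv, hvf, hGv⟩ := isLimitFiniteSpectrum_of_notMem hB hG (by rwa [norm_neg]) hGω (ε / 2)
    (by positivity)
  refine ⟨v, hv, hvf, ?_⟩
  have : Z - v = (Z - G) + (G - v) := by abel
  rw [this]
  refine (norm_add_le _ _).trans_lt ?_
  have : 4 * τ ≤ ε / 2 := by rw [hτ]; nlinarith
  linarith

/-- In real rank zero, the unitary part of any element of the connected component of the identity in
the group of invertible elements is a limit of unitaries with finite spectrum. -/
theorem isLimitFiniteSpectrum_polar {B : Type u} [CStarAlgebra B] (hB : HasRealRankZero B) {g : Bˣ}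
    (hg : g ∈ connectedComponent (1 : Bˣ)) : IsLimitFiniteSpectrum (polar (g : B)) := by
  obtain ⟨ε₀, hε₀, H⟩ := exists_isLimitFiniteSpectrum_of_close.{u}
  have hpu : ∀ g : Bˣ, polar (g : B) ∈ unitary B := fun g => polar_mem_unitary g.isUnit
  -- Openness is where the universal `ε₀` is needed: a neighbour of a limit lies within `ε₀` of some
  -- unitary with finite spectrum, hence is itself a limit.
  have hopen : IsOpen {g : Bˣ | IsLimitFiniteSpectrum (polar (g : B))} := by
    rw [isOpen_iff_mem_nhds]
    intro g hg
    obtain ⟨v, hv, hvf, hgv⟩ := hg (ε₀ / 2) (by positivity)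
    have := (continuous_polar (B := B)).continuousAt (x := g)
    rw [Metric.continuousAt_iff'] at this
    filter_upwards [this (ε₀ / 2) (by positivity)] with h hh
    refine H hB (hpu h) hv hvf ?_
    rw [dist_eq_norm] at hh
    have e : polar (h : B) - v = (polar (h : B) - polar (g : B)) + (polar (g : B) - v) := by abel
    rw [e]
    refine (norm_add_le _ _).trans ?_
    linarith
  have hclosed : IsClosed {g : Bˣ | IsLimitFiniteSpectrum (polar (g : B))} := by
    rw [← closure_subset_iff_isClosed]
    intro g hg ε hε
    have := (continuous_polar (B := B)).continuousAt (x := g)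
    rw [Metric.continuousAt_iff'] at this
    obtain ⟨h, hh, hh'⟩ := (mem_closure_iff_nhds.1 hg) _ (this (ε / 2) (by positivity))
    obtain ⟨v, hv, hvf, hd⟩ := hh' (ε / 2) (by positivity)
    refine ⟨v, hv, hvf, ?_⟩
    have hh2 : ‖polar (h : B) - polar (g : B)‖ < ε / 2 := by rw [← dist_eq_norm]; exact hh
    rw [norm_sub_rev] at hh2
    have e : polar (g : B) - v = (polar (g : B) - polar (h : B)) + (polar (h : B) - v) := by abel
    rw [e]
    refine (norm_add_le _ _).trans_lt ?_
    linarith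
  have h1 : (1 : Bˣ) ∈ {g : Bˣ | IsLimitFiniteSpectrum (polar (g : B))} := by
    intro ε hε
    refine ⟨1, one_mem _, ?_, ?_⟩
    · rcases subsingleton_or_nontrivial B with hB | hB
      · rw [spectrum.of_subsingleton]; exact finite_empty
      · rw [spectrum.one_eq]; exact finite_singleton _
    · rw [Units.val_one, polar_of_mem_unitary (one_mem _), sub_self, norm_zero]; exact hε
  exact IsClopen.connectedComponent_subset ⟨hclosed, hopen⟩ h1 hg

end LimitsOfFiniteSpectrum
end NormalDist

namespace NormalDist
open Set Filter Topology

/-! ### The identity component of the invertible group -/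

section IdentityComponent
variable {D : Type*} [CStarAlgebra D]

/-- The elements of the connected component of `1` in the group of invertible elements. -/
def idComponent (D : Type*) [CStarAlgebra D] : Set D :=
  {a | ∃ g : Dˣ, g ∈ connectedComponent (1 : Dˣ) ∧ (g : D) = a}

theorem isUnit_of_mem_idComponent {x : D} (hx : x ∈ idComponent D) : IsUnit x := by
  obtain ⟨g, -, rfl⟩ := hx
  exact g.isUnit

theorem one_mem_idComponent : (1 : D) ∈ idComponent D := ⟨1, mem_connectedComponent, rfl⟩

theorem mul_mem_idComponent {x y : D} (hx : x ∈ idComponent D) (hy : y ∈ idComponent D) :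
    x * y ∈ idComponent D := by
  obtain ⟨g, hg, rfl⟩ := hx
  obtain ⟨k, hk, rfl⟩ := hy
  exact ⟨g * k, (Subgroup.connectedComponentOfOne Dˣ).mul_mem hg hk, rfl⟩

theorem mem_idComponent_of_mul_left {x y : D} (hx : x ∈ idComponent D)
    (h : y * x ∈ idComponent D) : y ∈ idComponent D := by
  obtain ⟨g, hg, rfl⟩ := hx
  obtain ⟨k, hk, hk'⟩ := h
  refine ⟨k * g⁻¹, (Subgroup.connectedComponentOfOne Dˣ).mul_mem hk
    ((Subgroup.connectedComponentOfOne Dˣ).inv_mem hg), ?_⟩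
  rw [Units.val_mul, hk', mul_assoc, g.mul_inv, mul_one]

/-- The units embed as an open subset, so a segment of invertible elements is connected in the
topology of the unit group. -/
theorem mem_idComponent_of_segment {x y : D} (hx : x ∈ idComponent D)
    (h : ∀ z ∈ segment ℝ x y, IsUnit z) : y ∈ idComponent D := by
  obtain ⟨g, hg, rfl⟩ := hx
  have h1 : IsPreconnected (Units.val ⁻¹' segment ℝ (g : D) y) := by
    rw [← Units.isOpenEmbedding_val.isInducing.isPreconnected_image,
      image_preimage_eq_of_subset fun z hz => ?_]
    · exact (convex_segment _ _).isPreconnected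
    · exact h z hz
  obtain ⟨k, hk⟩ := h y (right_mem_segment ℝ _ _)
  refine ⟨k, ?_, hk⟩
  rw [connectedComponent_eq hg]
  exact h1.subset_connectedComponent (left_mem_segment ℝ (g : D) y)
    (by rw [mem_preimage, hk]; exact right_mem_segment ℝ _ _)

theorem mem_idComponent_of_norm_lt {g : Dˣ} {y : D} (hg : (g : D) ∈ idComponent D)
    (h : ‖((g⁻¹ : Dˣ) : D)‖ * ‖(g : D) - y‖ < 1) : y ∈ idComponent D := by
  refine mem_idComponent_of_segment hg fun z hz => ?_
  have h1 : ‖(g : D) - z‖ ≤ ‖(g : D) - y‖ := by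
    obtain ⟨a, b, ha, hb, hab, rfl⟩ := hz
    have : (g : D) - (a • (g : D) + b • y) = b • ((g : D) - y) := by
      rw [show a = 1 - b by linarith]
      module
    rw [this, norm_smul, Real.norm_of_nonneg hb]
    exact mul_le_of_le_one_left (norm_nonneg _) (by linarith)
  have h2 : ‖((g⁻¹ : Dˣ) : D) * ((g : D) - z)‖ < 1 :=
    (norm_mul_le _ _).trans_lt ((by gcongr : _ ≤ ‖((g⁻¹ : Dˣ) : D)‖ * ‖(g : D) - y‖).trans_lt h)
  have h3 := g.isUnit.mul (isUnit_one_sub_of_norm_lt_one h2)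
  convert h3 using 1
  rw [mul_sub, ← mul_assoc, g.mul_inv]
  simp

theorem mem_idComponent_of_smul_add_ne {ω ν : ℂ} (h : ∀ a b : ℝ, 0 ≤ a → 0 ≤ b → a + b = 1 →
    (a : ℂ) * ω + (b : ℂ) * ν ≠ 0) (hω : ω • (1 : D) ∈ idComponent D) :
    ν • (1 : D) ∈ idComponent D := by
  refine mem_idComponent_of_segment hω fun z hz => ?_
  obtain ⟨a, b, ha, hb, hab, rfl⟩ := hz
  have : a • ω • (1 : D) + b • ν • (1 : D) = algebraMap ℂ D (a * ω + b * ν) := by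
    rw [Algebra.algebraMap_eq_smul_one, add_smul, mul_smul, mul_smul]
    simp
  rw [this]
  exact (IsUnit.mk0 _ (h a b ha hb hab)).map (algebraMap ℂ D)

theorem smul_one_mem_idComponent {ω : ℂ} (hω : ω ∈ Complex.slitPlane) :
    ω • (1 : D) ∈ idComponent D := by
  refine mem_idComponent_of_smul_add_ne (ω := 1) (fun a b ha hb hab h0 => ?_)
    (by rw [one_smul]; exact one_mem_idComponent)
  have h1 := congrArg Complex.re h0
  have h2 := congrArg Complex.im h0
  simp at h1 h2
  rcases Complex.mem_slitPlane_iff.1 hω with h | h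
  · rcases hb.eq_or_lt with rfl | hb
    · simp at h1; linarith
    · nlinarith
  · rcases h2 with rfl | h2
    · simp at h1; linarith
    · exact h h2

/-- A unitary whose spectrum lies in the closed upper half plane is connected to `1`. -/
theorem mem_idComponent_of_neg_I_notMem {W : D} (hW : W ∈ unitary D)
    (h : -Complex.I ∉ spectrum ℂ W) : W ∈ idComponent D := by
  have hI : Complex.I • (1 : D) ∈ idComponent D :=
    smul_one_mem_idComponent (Complex.mem_slitPlane_iff.2 (Or.inr (by simp)))
  refine mem_idComponent_of_segment hI fun z hz => ?_
  obtain ⟨a, b, ha, hb, hab, rfl⟩ := hz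
  rcases hb.eq_or_lt with rfl | hb
  · rw [show a = 1 by linarith]
    simpa using isUnit_of_mem_idComponent hI
  have hb' : (b : ℂ) ≠ 0 := by exact_mod_cast hb.ne'
  -- On the negative imaginary axis the spectrum of a unitary can only meet `-i`, which is excluded.
  have h1 : -((a / b : ℝ) : ℂ) * Complex.I ∉ spectrum ℂ W := by
    intro hm
    have h2 := spectrum.subset_circle_of_unitary (𝕜 := ℂ) hW hm
    rw [mem_sphere_zero_iff_norm, norm_mul, norm_neg, Complex.norm_I, mul_one, Complex.norm_real,
      Real.norm_of_nonneg (by positivity)] at h2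
    rw [h2] at hm
    simp at hm
    exact h hm
  rw [spectrum.notMem_iff] at h1
  have h3 := h1.mul ((IsUnit.mk0 _ (neg_ne_zero.2 hb')).map (algebraMap ℂ D))
  convert h3 using 1
  rw [Algebra.algebraMap_eq_smul_one, Algebra.algebraMap_eq_smul_one, sub_mul, smul_mul_smul_comm,
    mul_smul_comm, mul_one, mul_one]
  have : -((a / b : ℝ) : ℂ) * Complex.I * -(b : ℂ) = a * Complex.I := by
    push_cast
    field_simp
  rw [this, neg_smul, sub_neg_eq_add, mul_smul]
  simp

end IdentityComponent

/-! ### Block diagonal parts with respect to a projection -/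

section Blocks
variable {E : Type*} [CStarAlgebra E]

/-- `P X P + (1 - P) X (1 - P)`. -/
def blockDiag (P X : E) : E := P * X * P + (1 - P) * X * (1 - P)

theorem blockDiag_sub (P X Y : E) : blockDiag P (X - Y) = blockDiag P X - blockDiag P Y := by
  unfold blockDiag; noncomm_ring

theorem blockDiag_add (P X Y : E) : blockDiag P (X + Y) = blockDiag P X + blockDiag P Y := by
  unfold blockDiag; noncomm_ring

theorem blockDiag_smul (P X : E) (c : ℂ) : blockDiag P (c • X) = c • blockDiag P X := by
  simp [blockDiag]

variable {P : E}

theorem commute_blockDiag (hP : P * P = P) (X : E) : Commute P (blockDiag P X) := by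
  have h1 : P * (1 - P) = 0 := by rw [mul_sub, hP, mul_one, sub_self]
  have h2 : (1 - P) * P = 0 := by rw [sub_mul, hP, one_mul, sub_self]
  rw [Commute, SemiconjBy, blockDiag, mul_add, add_mul]
  calc _ = (P * P) * X * P + P * (1 - P) * X * (1 - P) := by noncomm_ring
    _ = P * X * (P * P) + (1 - P) * X * ((1 - P) * P) := by rw [hP, h1, h2]; noncomm_ring
    _ = _ := by noncomm_ring

theorem blockDiag_of_commute (hP : P * P = P) {X : E} (h : Commute P X) : blockDiag P X = X := by
  have h1 : (1 - P) * (1 - P) = 1 - P := by rw [mul_sub, sub_mul, sub_mul, hP]; noncomm_ring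
  rw [blockDiag, h.eq, mul_assoc, hP, ((Commute.one_left X).sub_left h).eq, mul_assoc, h1]
  noncomm_ring

theorem blockDiag_star (hPs : IsSelfAdjoint P) (X : E) :
    blockDiag P (star X) = star (blockDiag P X) := by
  simp only [blockDiag, star_add, star_mul, star_sub, star_one, hPs.star_eq]
  noncomm_ring

theorem one_sub_two_smul_mem_unitary (hP : P * P = P) (hPs : IsSelfAdjoint P) :
    1 - P - P ∈ unitary E := by
  have hs : star (1 - P - P) = 1 - P - P := by simp [hPs.star_eq]
  have : (1 - P - P) * (1 - P - P) = 1 := by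
    calc _ = 1 - 4 • P + 4 • (P * P) := by noncomm_ring
      _ = 1 := by rw [hP]; noncomm_ring
  exact Unitary.mem_iff.2 ⟨by rw [hs, this], by rw [hs, this]⟩

/-- The off-diagonal part is `[P, X]` times the symmetry `1 - 2P`. -/
theorem norm_sub_blockDiag_le (hP : P * P = P) (hPs : IsSelfAdjoint P) (X : E) :
    ‖X - blockDiag P X‖ ≤ ‖P * X - X * P‖ := by
  have h : X - blockDiag P X = (P * X - X * P) * (1 - P - P) := by
    unfold blockDiag
    calc _ = P * X + X * P - 2 • (P * X * P) := by noncomm_ring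
      _ = P * X + 2 • (X * (P * P)) - X * P - 2 • (P * X * P) := by rw [hP]; noncomm_ring
      _ = _ := by noncomm_ring
  rw [h]
  calc _ ≤ _ := norm_mul_le _ _
    _ ≤ ‖P * X - X * P‖ * 1 := by
      gcongr
      exact norm_le_one_of_mem_unitary (one_sub_two_smul_mem_unitary hP hPs)
    _ = _ := mul_one _

/-- The block diagonal part is the average of `X` and its conjugate by the symmetry `1 - 2P`. -/
theorem norm_blockDiag_le (hP : P * P = P) (hPs : IsSelfAdjoint P) (X : E) :
    ‖blockDiag P X‖ ≤ ‖X‖ := by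
  have hS := norm_le_one_of_mem_unitary (one_sub_two_smul_mem_unitary hP hPs)
  have h : (2 : ℂ) • blockDiag P X = X + (1 - P - P) * X * (1 - P - P) := by
    unfold blockDiag
    rw [ofNat_smul_eq_nsmul]
    noncomm_ring
  have h1 : ‖(1 - P - P) * X * (1 - P - P)‖ ≤ 1 * ‖X‖ * 1 :=
    (norm_mul_le _ _).trans (by gcongr; exact (norm_mul_le _ _).trans (by gcongr))
  have h2 := congrArg norm h
  rw [norm_smul] at h2
  have := norm_add_le X ((1 - P - P) * X * (1 - P - P))
  simp at h2
  linarith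

/-- If `X Y = W`, the product of the block diagonal parts of `X` and `Y` is close to that of
`W`. -/
theorem norm_blockDiag_mul_sub_le (hP : P * P = P) (hPs : IsSelfAdjoint P) (X Y : E) :
    ‖blockDiag P X * blockDiag P Y - blockDiag P (X * Y)‖ ≤
      ‖P * X - X * P‖ * ‖P * Y - Y * P‖ := by
  -- Taking the block diagonal part is a bimodule map over the commutant of `P`, so only the product
  -- of the two off-diagonal parts survives. This makes the error quadratic in commutators.
  have h1 : blockDiag P X * blockDiag P Y - blockDiag P (X * Y) =
      -blockDiag P ((X - blockDiag P X) * (Y - blockDiag P Y)) := by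
    have hX := commute_blockDiag hP X
    have hY := commute_blockDiag hP Y
    obtain ⟨x, hx⟩ : ∃ x, x = blockDiag P X := ⟨_, rfl⟩
    obtain ⟨y, hy⟩ : ∃ y, y = blockDiag P Y := ⟨_, rfl⟩
    rw [← hx] at hX
    rw [← hy] at hY
    have e1 : blockDiag P (x * Y) = x * y := by
      rw [hy]
      unfold blockDiag
      calc _ = (P * x) * Y * P + ((1 - P) * x) * Y * (1 - P) := by noncomm_ring
        _ = (x * P) * Y * P + (x * (1 - P)) * Y * (1 - P) := by
          rw [hX.eq, ((Commute.one_left x).sub_left hX).eq]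
        _ = _ := by noncomm_ring
    have e2 : blockDiag P (X * y) = x * y := by
      rw [hx]
      unfold blockDiag
      calc _ = P * X * (y * P) + (1 - P) * X * (y * (1 - P)) := by noncomm_ring
        _ = P * X * (P * y) + (1 - P) * X * ((1 - P) * y) := by
          rw [hY.eq, ((Commute.one_left y).sub_left hY).eq]
        _ = _ := by noncomm_ring
    have e3 : blockDiag P (x * y) = x * y := blockDiag_of_commute hP (hX.mul_right hY)
    rw [← hx, ← hy, show (X - x) * (Y - y) = X * Y - x * Y - X * y + x * y by noncomm_ring,
      blockDiag_add, blockDiag_sub, blockDiag_sub, e1, e2, e3]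
    abel
  rw [h1, norm_neg]
  refine (norm_blockDiag_le hP hPs _).trans ((norm_mul_le _ _).trans ?_)
  gcongr <;> exact norm_sub_blockDiag_le hP hPs _

/-- `ι` identifies `D` with the commutant of the projection `P`. -/
structure IsBlockHom {D : Type*} [CStarAlgebra D] (ι : D →⋆ₐ[ℂ] E) (P : E) : Prop where
  injective : Function.Injective ι
  commute : ∀ y, Commute P (ι y)
  surjective : ∀ X, Commute P X → ∃ y, ι y = X
  idem : P * P = P
  isSelfAdjoint : IsSelfAdjoint P

namespace IsBlockHom
variable {D : Type*} [CStarAlgebra D] {ι : D →⋆ₐ[ℂ] E}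

theorem norm_map (h : IsBlockHom ι P) (y : D) : ‖ι y‖ = ‖y‖ :=
  NonUnitalStarAlgHom.norm_map ι h.injective y

/-- The commutant of `P` is closed under inverses. -/
theorem isUnit_of_isUnit_map (h : IsBlockHom ι P) {y : D} (hy : IsUnit (ι y)) : IsUnit y := by
  obtain ⟨g, hg⟩ := hy
  have hc : Commute P ((g⁻¹ : Eˣ) : E) := Commute.units_inv_right (by rw [hg]; exact h.commute y)
  obtain ⟨r, hr⟩ := h.surjective _ hc
  refine ⟨⟨y, r, h.injective ?_, h.injective ?_⟩, rfl⟩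
  · rw [map_mul, hr, ← hg, g.mul_inv, map_one]
  · rw [map_mul, hr, ← hg, g.inv_mul, map_one]

theorem exists_map_eq (h : IsBlockHom ι P) (X : E) : ∃ y, ι y = blockDiag P X :=
  h.surjective _ (commute_blockDiag h.idem X)

/-- If an invertible element almost commutes with `P`, its block diagonal part is invertible. -/
theorem isUnit_of_map_eq (h : IsBlockHom ι P) {X R : E} {k : ℝ} (hR : X * R = 1) (hR' : R * X = 1)
    (hk : ‖R‖ ≤ k) (hX : k * ‖P * X - X * P‖ < 1) {y : D} (hy : ι y = blockDiag P X) :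
    IsUnit y := by
  refine h.isUnit_of_isUnit_map ?_
  have h1 : ‖R * (X - blockDiag P X)‖ < 1 := by
    refine (norm_mul_le _ _).trans_lt (lt_of_le_of_lt ?_ hX)
    gcongr
    · exact (norm_nonneg _).trans hk
    · exact norm_sub_blockDiag_le h.idem h.isSelfAdjoint X
  have h2 := (isUnit_one_sub_of_norm_lt_one h1)
  have h3 := (Units.isUnit (⟨X, R, hR, hR'⟩ : Eˣ)).mul h2
  rw [hy]
  convert h3 using 1
  rw [mul_sub, ← mul_assoc, hR]
  noncomm_ring

/-- Expanding the inverse around `R` gives a bound of the form `‖Y‖ ≤ 1 + ‖Y‖/2`, which is solved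
for `‖Y‖`. -/
theorem norm_inv_le_of_map_eq (h : IsBlockHom ι P) {X R : E} (hR' : R * X = 1) (hk : ‖R‖ ≤ 1)
    (hX : ‖P * X - X * P‖ ≤ 1 / 2) {g : Dˣ} (hy : ι g = blockDiag P X) :
    ‖((g⁻¹ : Dˣ) : D)‖ ≤ 2 := by
  have h1 : ι ((g⁻¹ : Dˣ) : D) = R + R * (blockDiag P X - X) * -ι ((g⁻¹ : Dˣ) : D) := by
    have : ι g * ι ((g⁻¹ : Dˣ) : D) = 1 := by rw [← map_mul, g.mul_inv, map_one]
    rw [← hy]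
    calc _ = R * X * ι ((g⁻¹ : Dˣ) : D) + R * (1 - ι g * ι ((g⁻¹ : Dˣ) : D)) := by
          rw [hR', this]; simp
      _ = _ := by noncomm_ring
  have h2 : ‖ι ((g⁻¹ : Dˣ) : D)‖ ≤ 1 + 1 * (1 / 2) * ‖ι ((g⁻¹ : Dˣ) : D)‖ := by
    conv_lhs => rw [h1]
    refine (norm_add_le _ _).trans ?_
    gcongr
    refine (norm_mul_le _ _).trans ?_
    rw [norm_neg]
    gcongr
    refine (norm_mul_le _ _).trans ?_
    gcongr
    rw [norm_sub_rev]
    exact (norm_sub_blockDiag_le h.idem h.isSelfAdjoint X).trans hX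
  rw [h.norm_map] at h2
  linarith

end IsBlockHom
end Blocks
end NormalDist

namespace NormalDist
open Set Filter Topology
open scoped Real

/-! ### The unimodular function on the circle and its jump at `-1` -/

section ArcFunctions

/-- The cosine of an angle which is `0` for `Im z ≤ -1 / 2` and `π` for `Im z ≥ 1 / 2`. -/
noncomputable def arcCos (z : ℂ) : ℂ := (Real.cos (π * Real.smoothTransition (z.im + 1 / 2)) : ℝ)

/-- The sine of the angle in `arcCos`, cut off to the right half plane. -/
noncomputable def arcSin (z : ℂ) : ℂ :=
  (Real.sin (π * Real.smoothTransition (z.im + 1 / 2)) : ℝ) * reStep 0 0.8 z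

noncomputable def arcFun (z : ℂ) : ℂ := arcCos z + Complex.I * arcSin z

/-- Smooth cut-off to the left half plane. -/
noncomputable def lowCut (z : ℂ) : ℂ := 1 - reStep (-0.8) (-0.6) z

open Classical in
/-- The correction which turns `arcFun` into a unimodular function on the circle, with a jump
at `-1`. -/
noncomputable def arcJump (z : ℂ) : ℂ :=
  if z.re < 0 then (if 0 ≤ z.im then -1 else 1) - arcCos z else 0

theorem contDiff_arcCos : ContDiff ℝ 3 arcCos :=
  contDiff_ofReal_comp (Real.contDiff_cos.comp (contDiff_const.mul
    (Real.smoothTransition.contDiff.comp (contDiff_im.add contDiff_const))))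

theorem contDiff_arcSin : ContDiff ℝ 3 arcSin :=
  (contDiff_ofReal_comp (Real.contDiff_sin.comp (contDiff_const.mul
    (Real.smoothTransition.contDiff.comp (contDiff_im.add contDiff_const))))).mul
    (contDiff_reStep _ _)

theorem contDiff_arcFun : ContDiff ℝ 3 arcFun :=
  contDiff_arcCos.add (contDiff_const.mul contDiff_arcSin)

theorem contDiff_lowCut : ContDiff ℝ 3 lowCut := contDiff_const.sub (contDiff_reStep _ _)

@[fun_prop]
theorem continuous_arcCos : Continuous arcCos := contDiff_arcCos.continuous
@[fun_prop]
theorem continuous_arcSin : Continuous arcSin := contDiff_arcSin.continuous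
@[fun_prop]
theorem continuous_arcFun : Continuous arcFun := contDiff_arcFun.continuous
@[fun_prop]
theorem continuous_lowCut : Continuous lowCut := contDiff_lowCut.continuous

theorem star_arcCos (z : ℂ) : star (arcCos z) = arcCos z := Complex.conj_ofReal _

theorem star_arcSin (z : ℂ) : star (arcSin z) = arcSin z := by
  unfold arcSin reStep
  rw [← Complex.ofReal_mul]
  exact Complex.conj_ofReal _

theorem star_lowCut (z : ℂ) : star (lowCut z) = lowCut z := by
  rw [lowCut, star_sub, star_one, star_reStep]

theorem star_arcJump (z : ℂ) : star (arcJump z) = arcJump z := by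
  unfold arcJump
  split_ifs <;> simp only [star_sub, star_neg, star_one, star_zero, star_arcCos]

theorem arcCos_of_im_le {z : ℂ} (h : z.im ≤ -1 / 2) : arcCos z = 1 := by
  rw [arcCos, Real.smoothTransition.zero_of_nonpos (by linarith)]; simp

theorem arcCos_of_le_im {z : ℂ} (h : 1 / 2 ≤ z.im) : arcCos z = -1 := by
  rw [arcCos, Real.smoothTransition.one_of_one_le (by linarith)]; simp

theorem arcSin_of_le_abs_im {z : ℂ} (h : 1 / 2 ≤ |z.im|) : arcSin z = 0 := by
  rcases le_abs.1 h with h | h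
  · rw [arcSin, Real.smoothTransition.one_of_one_le (by linarith)]; simp
  · rw [arcSin, Real.smoothTransition.zero_of_nonpos (by linarith)]; simp

variable {z : ℂ}

theorem half_le_abs_im (hz : z ∈ Metric.sphere (0 : ℂ) 1) (h : -0.86 ≤ z.re) (h' : z.re ≤ 0.86) :
    1 / 2 ≤ |z.im| := by
  have := re_sq_add_im_sq_of_mem_sphere hz
  refine abs_le_of_sq_le_sq' ?_ (abs_nonneg _) |>.2
  rw [sq_abs]; nlinarith

theorem arcSin_of_re_le (hz : z ∈ Metric.sphere (0 : ℂ) 1) (h : z.re ≤ 0.6) : arcSin z = 0 := by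
  rcases le_or_gt z.re 0 with h0 | h0
  · rw [arcSin, reStep_of_le (by norm_num) h0, mul_zero]
  · exact arcSin_of_le_abs_im (half_le_abs_im hz (by linarith) (by linarith))

theorem lowCut_of_le (h : -0.6 ≤ z.re) : lowCut z = 0 := by
  rw [lowCut, reStep_of_ge (by norm_num) h, sub_self]

theorem norm_lowCut_le (z : ℂ) : ‖lowCut z‖ ≤ 1 := norm_one_sub_reStep_le _ _ z

theorem lowCut_mul_arcSin (z : ℂ) : lowCut z * arcSin z = 0 := by
  rcases le_total z.re (-0.6) with h | h
  · rw [arcSin, reStep_of_le (by norm_num) (by linarith), mul_zero, mul_zero]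
  · rw [lowCut_of_le h, zero_mul]

theorem norm_arcCos_le (z : ℂ) : ‖arcCos z‖ ≤ 1 := by
  rw [arcCos, Complex.norm_real]
  exact Real.abs_cos_le_one _

theorem norm_arcJump_le (z : ℂ) : ‖arcJump z‖ ≤ 2 := by
  unfold arcJump
  have := norm_arcCos_le z
  split_ifs
  · exact (norm_sub_le _ _).trans (by simp; linarith)
  · exact (norm_sub_le _ _).trans (by simp; linarith)
  · simp

/-- For `-0.8 ≤ Re z < 0` the point already has `|Im z| ≥ 1/2`, where `arcCos` is `±1`. So the jump
lives where the cut-off is `1`. -/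
theorem lowCut_mul_arcJump (hz : z ∈ Metric.sphere (0 : ℂ) 1) : lowCut z * arcJump z = arcJump z := by
  rcases le_total z.re (-0.8) with h | h
  · rw [lowCut, reStep_of_le (by norm_num) h, sub_zero, one_mul]
  have : arcJump z = 0 := by
    unfold arcJump
    split_ifs with h1 h2
    · have := half_le_abs_im hz (by linarith) (by linarith)
      rw [abs_of_nonneg h2] at this
      rw [arcCos_of_le_im this, sub_self]
    · have := half_le_abs_im hz (by linarith) (by linarith)
      rw [abs_of_neg (by linarith)] at this
      rw [arcCos_of_im_le (by linarith), sub_self]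
    · rfl
  rw [this, mul_zero]

theorem norm_arcFun (hz : z ∈ Metric.sphere (0 : ℂ) 1) (h : -0.6 ≤ z.re) : ‖arcFun z‖ = 1 := by
  rcases le_total z.re 0.8 with h1 | h1
  · have h2 := half_le_abs_im hz (by linarith) (by linarith)
    rw [arcFun, arcSin_of_le_abs_im h2, mul_zero, add_zero]
    rcases le_abs.1 h2 with h3 | h3
    · rw [arcCos_of_le_im h3]; simp
    · rw [arcCos_of_im_le (by linarith)]; simp
  · rw [arcFun, arcSin, arcCos, reStep_of_ge (by norm_num) h1, mul_one,
      mul_comm Complex.I, Complex.ofReal_cos, Complex.ofReal_sin, ← Complex.exp_mul_I]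
    exact Complex.norm_exp_ofReal_mul_I _

/-- In the left half plane the sum is `±1`, in the right half plane it lies on the upper unit
semicircle. The half plane matters later: it shows that the function of `v` is connected to `1`. -/
theorem arcFun_add_arcJump (hz : z ∈ Metric.sphere (0 : ℂ) 1) :
    ‖arcFun z + arcJump z‖ = 1 ∧ 0 ≤ (arcFun z + arcJump z).im := by
  rcases lt_or_ge z.re 0 with h | h
  · have h1 : arcSin z = 0 := by rw [arcSin, reStep_of_le (by norm_num) h.le, mul_zero]
    have h2 : arcFun z + arcJump z = if 0 ≤ z.im then -1 else 1 := by
      rw [arcFun, h1, arcJump, if_pos h]; ring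
    rw [h2]
    split_ifs <;> simp
  · have h1 : arcJump z = 0 := by rw [arcJump, if_neg (not_lt.2 h)]
    rw [h1, add_zero]
    refine ⟨norm_arcFun hz (by linarith), ?_⟩
    have h2 : arcFun z = (Real.cos (π * Real.smoothTransition (z.im + 1 / 2)) : ℝ) +
        (Real.sin (π * Real.smoothTransition (z.im + 1 / 2)) *
          Real.smoothTransition ((z.re - 0) / (0.8 - 0)) : ℝ) * Complex.I := by
      rw [arcFun, arcCos, arcSin, reStep]; push_cast; ring
    rw [h2]
    simp only [Complex.add_im, Complex.ofReal_im, Complex.im_ofReal_mul,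
      Complex.I_im, mul_one, zero_add]
    refine mul_nonneg (Real.sin_nonneg_of_nonneg_of_le_pi ?_ ?_) (Real.smoothTransition.nonneg _)
    · exact mul_nonneg Real.pi_pos.le (Real.smoothTransition.nonneg _)
    · exact mul_le_of_le_one_right Real.pi_pos.le (Real.smoothTransition.le_one _)

end ArcFunctions

/-! ### Assembling the unitary from `Z` and `v` -/

section ArcUnitary
variable {B : Type u} [CStarAlgebra B]

theorem cfc_arc_mem_unitary {v : B} (hv : v ∈ unitary B) (hf : (spectrum ℂ v).Finite) :
    cfc (fun z => arcFun z + arcJump z) v ∈ unitary B := by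
  have := isStarNormal_of_mem_unitary hv
  have hc := continuousOn_spectrum_of_finite hf
  rw [cfc_unitary_iff _ _ (hf := hc _)]
  intro z hz
  have h := (arcFun_add_arcJump (spectrum.subset_circle_of_unitary (𝕜 := ℂ) hv hz)).1
  rw [← starRingEnd_apply, ← Complex.normSq_eq_conj_mul_self, Complex.normSq_eq_norm_sq, h]
  simp

theorem cfc_arc_mem_idComponent {v : B} (hv : v ∈ unitary B) (hf : (spectrum ℂ v).Finite) :
    cfc (fun z => arcFun z + arcJump z) v ∈ idComponent B := by
  have := isStarNormal_of_mem_unitary hv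
  refine mem_idComponent_of_neg_I_notMem (cfc_arc_mem_unitary hv hf) fun h => ?_
  rw [cfc_map_spectrum _ v (hf := continuousOn_spectrum_of_finite hf _)] at h
  obtain ⟨z, hz, h1⟩ := h
  have h2 := (arcFun_add_arcJump (spectrum.subset_circle_of_unitary (𝕜 := ℂ) hv hz)).2
  simp only at h1
  rw [h1] at h2
  norm_num at h2

/-- A unitary `Z` close to a unitary `v` with finite spectrum which commutes with the projection
`P` gives rise to a unitary `U` which almost commutes with `P`, is close to a unitary function of `v`,
coincides with `arcFun Z` where the latter is unitary, and is self-adjoint where `arcSin Z`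
vanishes. -/
theorem exists_unitary_of_close : ∃ ε₀ K : ℝ, 0 < ε₀ ∧ 0 ≤ K ∧
    ∀ {B : Type u} [CStarAlgebra B] {P Z v : B}, IsSelfAdjoint P → Z ∈ unitary B →
    v ∈ unitary B → (spectrum ℂ v).Finite → Commute P v → ‖Z - v‖ ≤ ε₀ →
    ∃ U ∈ unitary B, ‖P * U - U * P‖ ≤ K * ‖P * Z - Z * P‖ ∧
      ‖U - cfc (fun z => arcFun z + arcJump z) v‖ ≤ 1 / 2 ∧
      (∀ y, cfc lowCut Z * y = 0 → cfc (fun z => star (arcFun z) * arcFun z) Z * y = y →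
        U * y = cfc arcFun Z * y) ∧
      (∀ y, cfc lowCut Z * y = 0 → cfc (fun z => star (arcFun z) * arcFun z) Z * y = y →
        star U * y = star (cfc arcFun Z) * y) ∧
      (∀ y, cfc arcSin Z * y = 0 → U * y = star U * y) := by
  obtain ⟨C₁, hC₁, H₁⟩ := exists_operatorLipschitz.{u} contDiff_arcFun
  obtain ⟨C₂, hC₂, H₂⟩ := exists_operatorLipschitz.{u} contDiff_lowCut
  refine ⟨1 / (10 * (1 + C₁ + 4 * C₂)), 130 * (C₁ + 4 * C₂), by positivity, by positivity, ?_⟩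
  intro B _ P Z v hP hZ hv hvf hPv hZv
  have nZ := isStarNormal_of_mem_unitary hZ
  have nv := isStarNormal_of_mem_unitary hv
  have cv := continuousOn_spectrum_of_finite hvf
  have hε : (C₁ + 4 * C₂) * ‖Z - v‖ ≤ 1 / 10 := by
    calc _ ≤ (1 + C₁ + 4 * C₂) * (1 / (10 * (1 + C₁ + 4 * C₂))) := by gcongr; linarith
      _ = 1 / 10 := by field_simp
  obtain ⟨a, ha⟩ : ∃ a, a = cfc lowCut Z := ⟨_, rfl⟩
  obtain ⟨b, hb⟩ : ∃ b, b = cfc lowCut v := ⟨_, rfl⟩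
  obtain ⟨R, hR⟩ : ∃ R, R = cfc arcJump v := ⟨_, rfl⟩
  obtain ⟨s, hs⟩ : ∃ s, s = cfc arcSin Z := ⟨_, rfl⟩
  obtain ⟨c, hc⟩ : ∃ c, c = cfc arcCos Z := ⟨_, rfl⟩
  obtain ⟨F, hF⟩ : ∃ F, F = cfc arcFun Z := ⟨_, rfl⟩
  obtain ⟨W, hW⟩ : ∃ W, W = cfc (fun z => arcFun z + arcJump z) v := ⟨_, rfl⟩
  have hWu : W ∈ unitary B := hW ▸ cfc_arc_mem_unitary hv hvf
  have asa : IsSelfAdjoint a := ha ▸ isSelfAdjoint_cfc_of_star_eq star_lowCut Z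
  have Rsa : IsSelfAdjoint R := hR ▸ isSelfAdjoint_cfc_of_star_eq star_arcJump v
  have ssa : IsSelfAdjoint s := hs ▸ isSelfAdjoint_cfc_of_star_eq star_arcSin Z
  have csa : IsSelfAdjoint c := hc ▸ isSelfAdjoint_cfc_of_star_eq star_arcCos Z
  have an : ‖a‖ ≤ 1 := ha ▸ norm_cfc_le_of_mem_unitary hZ zero_le_one fun z _ => norm_lowCut_le z
  have bn : ‖b‖ ≤ 1 := hb ▸ norm_cfc_le_of_mem_unitary hv zero_le_one fun z _ => norm_lowCut_le z
  have Rn : ‖R‖ ≤ 2 := hR ▸ norm_cfc_le_of_mem_unitary hv zero_le_two fun z _ => norm_arcJump_le z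
  have hPR : Commute P R := by
    have h : Commute v P := hPv.symm
    have h' : Commute (star v) P := by
      have := h.star_star
      rwa [hP.star_eq] at this
    rw [hR]
    exact (Commute.cfc h h' _).symm
  have has : a * s = 0 := by
    rw [ha, hs, cfc_mul_of_eqOn (h := fun _ => 0) (by fun_prop) (by fun_prop)
      fun z _ => lowCut_mul_arcSin z]
    exact cfc_const_zero ℂ Z
  have hsa : s * a = 0 := by
    rw [ha, hs, cfc_mul_of_eqOn (h := fun _ => 0) (by fun_prop) (by fun_prop)
      fun z _ => by rw [mul_comm, lowCut_mul_arcSin z]]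
    exact cfc_const_zero ℂ Z
  have hcs : c * s = s * c := by
    rw [hc, hs]; exact (cfc_commute_cfc _ _ Z).eq
  have hFcs : F = c + Complex.I • s := by
    rw [hF, hc, hs, ← cfc_const_mul _ _ Z, ← cfc_add (a := Z) _ _]
    rfl
  have hFs : star F = c - Complex.I • s := by
    rw [hFcs, star_add, star_smul, csa.star_eq, ssa.star_eq]
    simp [sub_eq_add_neg]
  have haF : Commute a F := by rw [ha, hF]; exact cfc_commute_cfc _ _ Z
  have hFF : cfc (fun z => star (arcFun z) * arcFun z) Z = star F * F := by
    rw [hF, ← cfc_star, cfc_mul_of_eqOn (by fun_prop) (by fun_prop) fun z _ => rfl]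
  have hFF' : F * star F = star F * F := by
    rw [hF, ← cfc_star]; exact (cfc_commute_cfc _ _ Z).eq
  have haF' : Commute a (star F) := by
    rw [ha, hF, ← cfc_star]; exact cfc_commute_cfc _ _ Z
  -- The smooth function is taken of `Z`, the jump of `v`, localised near `-1` by a cut-off of `Z`.
  obtain ⟨G, hG⟩ : ∃ G, G = F + a * R * a := ⟨_, rfl⟩
  have hGs : star G = star F + a * R * a := by
    rw [hG, star_add, star_mul, star_mul, asa.star_eq, Rsa.star_eq, mul_assoc]
  -- For `v` itself the cut-off is invisible, so `G` differs from the unitary `W` only through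
  -- differences of smooth functions of `Z` and `v`.
  have hbRb : b * R * b = R := by
    have h1 : b * R = R := by
      rw [hb, hR]
      exact cfc_mul_of_eqOn (cv _) (cv _) fun z hz =>
        lowCut_mul_arcJump (spectrum.subset_circle_of_unitary (𝕜 := ℂ) hv hz)
    have h2 : R * b = R := by
      rw [hb, hR]
      exact cfc_mul_of_eqOn (cv _) (cv _) fun z hz => by
        rw [mul_comm, lowCut_mul_arcJump (spectrum.subset_circle_of_unitary (𝕜 := ℂ) hv hz)]
    rw [h1, h2]
  have hGW : ‖G - W‖ ≤ 1 / 10 := by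
    have h1 := H₁ 1 hZ hv
    have h2 := H₂ 1 hZ hv
    simp only [one_mul, mul_one] at h1 h2
    rw [← ha, ← hb] at h2
    have e : G - W = (cfc arcFun Z - cfc arcFun v) + ((a - b) * R * a + b * R * (a - b)) := by
      rw [hG, hW, cfc_add (a := v) _ _ (cv _) (cv _), ← hF, ← hR]
      nth_rewrite 2 [← hbRb]
      noncomm_ring
    rw [e]
    have n1 : ‖(a - b) * R * a‖ ≤ (C₂ * ‖Z - v‖) * 2 * 1 :=
      (norm_mul_le _ _).trans (by gcongr; exact (norm_mul_le _ _).trans (by gcongr))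
    have n2 : ‖b * R * (a - b)‖ ≤ 1 * 2 * (C₂ * ‖Z - v‖) :=
      (norm_mul_le _ _).trans (by gcongr; exact (norm_mul_le _ _).trans (by gcongr))
    have := norm_add_le (cfc arcFun Z - cfc arcFun v) ((a - b) * R * a + b * R * (a - b))
    have := norm_add_le ((a - b) * R * a) (b * R * (a - b))
    nlinarith
  -- Since `R` commutes with `P`, only commutators of `P` with smooth functions of `Z` occur, and
  -- the jump enters just through `‖R‖ ≤ 2`.
  have hPG : ‖P * G - G * P‖ ≤ (C₁ + 4 * C₂) * ‖P * Z - Z * P‖ := by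
    have h1 := H₁ P hZ hZ
    have h2 := H₂ P hZ hZ
    rw [← ha] at h2
    rw [← hF] at h1
    have e : P * G - G * P = (P * F - F * P) + ((P * a - a * P) * R * a + a * R * (P * a - a * P)) := by
      rw [hG]
      calc _ = (P * F - F * P) + ((P * a - a * P) * R * a + a * R * (P * a - a * P))
            + (a * (P * R) * a - a * (R * P) * a) := by noncomm_ring
        _ = _ := by rw [hPR.eq]; noncomm_ring
    rw [e]
    have n1 : ‖(P * a - a * P) * R * a‖ ≤ (C₂ * ‖P * Z - Z * P‖) * 2 * 1 :=
      (norm_mul_le _ _).trans (by gcongr; exact (norm_mul_le _ _).trans (by gcongr))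
    have n2 : ‖a * R * (P * a - a * P)‖ ≤ 1 * 2 * (C₂ * ‖P * Z - Z * P‖) :=
      (norm_mul_le _ _).trans (by gcongr; exact (norm_mul_le _ _).trans (by gcongr))
    have := norm_add_le (P * F - F * P) ((P * a - a * P) * R * a + a * R * (P * a - a * P))
    have := norm_add_le ((P * a - a * P) * R * a) (a * R * (P * a - a * P))
    nlinarith
  have hWn : ‖W‖ ≤ 1 := norm_le_one_of_mem_unitary hWu
  have hGn : ‖G‖ ≤ 1.1 := by
    have := norm_add_le (G - W) W
    rw [sub_add_cancel] at this
    linarith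
  have hGG : ‖star G * G - 1‖ ≤ 0.21 := by
    have e : star G * G - 1 = star G * (G - W) + star (G - W) * W := by
      rw [star_sub, sub_mul, Unitary.star_mul_self_of_mem hWu]; noncomm_ring
    rw [e]
    have n1 : ‖star G * (G - W)‖ ≤ 1.1 * (1 / 10) :=
      (norm_mul_le _ _).trans (by gcongr; rwa [norm_star])
    have n2 : ‖star (G - W) * W‖ ≤ (1 / 10) * 1 :=
      (norm_mul_le _ _).trans (by gcongr; rwa [norm_star])
    exact (norm_add_le _ _).trans (by linarith)
  -- With `m = 1/2` and `M = 2` the constant `m⁻¹ + M³ m⁻⁴` of `norm_commutator_polar_le` equals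
  -- `130`.
  have hspec : ∀ t ∈ spectrum ℝ (star G * G), (1 / 2) ^ 2 ≤ t ∧ t ≤ 2 ^ 2 := fun t ht => by
    have := abs_le.1 ((abs_sub_one_le_of_mem_spectrum ht).trans hGG)
    constructor <;> linarith
  have hpos : ∀ t ∈ spectrum ℝ (star G * G), 0 < t := fun t ht => by linarith [(hspec t ht).1]
  have hGu : IsUnit G := by
    have h1 : ‖star W * (W - G)‖ < 1 := by
      refine (norm_mul_le _ _).trans_lt ?_
      rw [norm_star, norm_sub_rev]
      nlinarith [norm_nonneg (G - W), norm_nonneg W]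
    have h2 := (Unitary.toUnits ⟨W, hWu⟩).isUnit.mul (isUnit_one_sub_of_norm_lt_one h1)
    convert h2 using 1
    rw [mul_sub, ← mul_assoc]
    change _ = W * 1 - W * star W * (W - G)
    rw [Unitary.mul_star_self_of_mem hWu]
    noncomm_ring
  have key : ∀ y, a * y = 0 → star F * F * y = y → polar G * y = F * y ∧
      absInv G * y = y := by
    intro y h1 h2
    have h3 : G * y = F * y := by rw [hG, add_mul, mul_assoc (a * R), h1]; simp
    have h4 : absInv G * y = y := by
      refine absInv_mul_of_star_mul_self_mul hpos ?_
      rw [mul_assoc, h3, hGs, add_mul, mul_assoc (a * R), ← mul_assoc a F, haF.eq, mul_assoc F, h1,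
        ← mul_assoc, h2]
      simp
    exact ⟨by rw [polar, mul_assoc, h4, h3], h4⟩
  refine ⟨polar G, polar_mem_unitary hGu, ?_, ?_, fun y h1 h2 => ?_, fun y h1 h2 => ?_,
    fun y h1 => ?_⟩
  · refine (norm_commutator_polar_le (by norm_num) (by norm_num) hspec hP).trans ?_
    calc _ = 130 * ‖P * G - G * P‖ := by norm_num
      _ ≤ 130 * ((C₁ + 4 * C₂) * ‖P * Z - Z * P‖) := by gcongr
      _ = _ := by ring
  · rw [← hW]
    have h1 := norm_polar_sub_le (G := G) (hGG.trans (by norm_num))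
    have h2 : ‖G‖ * ‖star G * G - 1‖ ≤ 1.1 * 0.21 := by gcongr
    have := norm_add_le (polar G - G) (G - W)
    rw [sub_add_sub_cancel] at this
    linarith
  · rw [← ha] at h1
    rw [hFF] at h2
    rw [(key y h1 h2).1, hF]
  · rw [← ha] at h1
    rw [hFF] at h2
    have h3 : star G * y = star F * y := by rw [hGs, add_mul, mul_assoc (a * R), h1]; simp
    rw [polar, star_mul, (isSelfAdjoint_absInv G).star_eq, mul_assoc, h3, ← hF]
    refine (key _ ?_ ?_).2
    · rw [← mul_assoc, haF'.eq, mul_assoc, h1, mul_zero]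
    · rw [mul_assoc, ← mul_assoc F, hFF', h2]
  · rw [← hs] at h1
    -- The real part `c + aRa` commutes with the imaginary part `s`, because `a s = 0`. Thus `G` is
    -- normal, its modulus commutes with it, and the polar part inherits self-adjointness where `s`
    -- vanishes.
    have hn : G * star G = star G * G := by
      obtain ⟨q, hq⟩ : ∃ q, q = a * R * a := ⟨_, rfl⟩
      have h2 : q * s = 0 := by rw [hq, mul_assoc, has, mul_zero]
      have h3 : s * q = 0 := by rw [hq, ← mul_assoc, ← mul_assoc, hsa, zero_mul, zero_mul]
      rw [hGs, hG, ← hq, hFs, hFcs]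
      simp only [add_mul, mul_add, mul_sub, sub_mul, smul_mul_assoc, mul_smul_comm, h2, h3, hcs,
        smul_zero, smul_add, smul_sub]
      abel
    have h2 : (G - star G) * y = 0 := by
      have : G - star G = (2 * Complex.I) • s := by
        rw [hGs, hG, hFs, hFcs, mul_smul, two_smul]; abel
      rw [this, smul_mul_assoc, h1, smul_zero]
    have hc1 : Commute (absInv G) G :=
      IsSelfAdjoint.commute_cfc (IsSelfAdjoint.star_mul_self G)
        (show Commute (star G * G) G by
          rw [Commute, SemiconjBy, ← mul_assoc, hn]) _
    rw [polar, star_mul, (isSelfAdjoint_absInv G).star_eq, ← hc1.eq, ← sub_eq_zero, ← sub_mul,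
      ← mul_sub, mul_assoc, h2, mul_zero]

end ArcUnitary
end NormalDist

namespace NormalDist
open Set Filter Topology

/-! ### Cayley phase relative to the line: pointwise facts -/

section Phase

/-- The Cayley transform with respect to the line `w ℝ`. -/
noncomputable def lineCayley (w z : ℂ) : ℂ := (z - Complex.I * w) / (z + Complex.I * w)

/-- The phase of the Cayley transform with respect to the line `w ℝ`. -/
noncomputable def linePhase (w z : ℂ) : ℂ := lineCayley w z / ‖lineCayley w z‖

variable {w z : ℂ}

theorem norm_ofReal_add_I_sq (x : ℝ) : ‖(x : ℂ) + Complex.I‖ ^ 2 = x ^ 2 + 1 := by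
  rw [← Complex.normSq_eq_norm_sq, Complex.normSq_apply]; simp; ring

theorem norm_ofReal_sub_I (x : ℝ) : ‖(x : ℂ) - Complex.I‖ = ‖(x : ℂ) + Complex.I‖ := by
  rw [← norm_star ((x : ℂ) - Complex.I)]
  congr 1
  simp

theorem one_le_norm_add (hw : ‖w‖ = 1) (hz : ‖z‖ < 3 → ∃ x : ℝ, z = w * x) :
    1 ≤ ‖z + Complex.I * w‖ := by
  rcases lt_or_ge ‖z‖ 3 with h | h
  · obtain ⟨x, rfl⟩ := hz h
    have : w * x + Complex.I * w = w * (x + Complex.I) := by ring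
    rw [this, norm_mul, hw, one_mul]
    have := norm_ofReal_add_I_sq x
    nlinarith [norm_nonneg ((x : ℂ) + Complex.I), sq_nonneg x]
  · have h1 := norm_sub_norm_le z (-(Complex.I * w))
    rw [sub_neg_eq_add, norm_neg, norm_mul, hw, Complex.norm_I] at h1
    linarith

theorem one_le_norm_sub (hw : ‖w‖ = 1) (hz : ‖z‖ < 3 → ∃ x : ℝ, z = w * x) :
    1 ≤ ‖z - Complex.I * w‖ := by
  have := one_le_norm_add (w := -w) (z := z) (by rwa [norm_neg]) fun h => by
    obtain ⟨x, hx⟩ := hz h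
    exact ⟨-x, by rw [hx]; push_cast; ring⟩
  rwa [mul_neg, ← sub_eq_add_neg] at this

theorem add_ne_zero_of_line (hw : ‖w‖ = 1) (hz : ‖z‖ < 3 → ∃ x : ℝ, z = w * x) :
    z + Complex.I * w ≠ 0 := by
  rw [← norm_pos_iff]; linarith [one_le_norm_add hw hz]

theorem sub_ne_zero_of_line (hw : ‖w‖ = 1) (hz : ‖z‖ < 3 → ∃ x : ℝ, z = w * x) :
    z - Complex.I * w ≠ 0 := by
  rw [← norm_pos_iff]; linarith [one_le_norm_sub hw hz]

theorem lineCayley_mul (hw : ‖w‖ = 1) (u : ℂ) :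
    lineCayley w (w * u) = (u - Complex.I) / (u + Complex.I) := by
  have hw0 : w ≠ 0 := by rw [← norm_pos_iff, hw]; norm_num
  rw [lineCayley, show w * u - Complex.I * w = w * (u - Complex.I) by ring,
    show w * u + Complex.I * w = w * (u + Complex.I) by ring, mul_div_mul_left _ _ hw0]

theorem norm_lineCayley_ofReal (hw : ‖w‖ = 1) (x : ℝ) : ‖lineCayley w (w * x)‖ = 1 := by
  rw [lineCayley_mul hw, norm_div, norm_ofReal_sub_I, div_self]
  have := norm_ofReal_add_I_sq x
  intro h
  rw [h] at this
  nlinarith [sq_nonneg x]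

/-- On the line the modulus is `1`; for `|z| ≥ 3` it lies between `(|z| - 1)/(|z| + 1)` and the
reciprocal, hence between `2/4` and `4/2`. -/
theorem norm_lineCayley_mem (hw : ‖w‖ = 1) (hz : ‖z‖ < 3 → ∃ x : ℝ, z = w * x) :
    1 / 2 ≤ ‖lineCayley w z‖ ∧ ‖lineCayley w z‖ ≤ 2 := by
  rcases lt_or_ge ‖z‖ 3 with h | h
  · obtain ⟨x, rfl⟩ := hz h
    rw [norm_lineCayley_ofReal hw]; norm_num
  · have h0 : ‖Complex.I * w‖ = 1 := by rw [norm_mul, hw, Complex.norm_I, one_mul]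
    have h1 := norm_sub_norm_le z (-(Complex.I * w))
    have h2 := norm_sub_norm_le z (Complex.I * w)
    have h3 := norm_sub_le z (Complex.I * w)
    have h4 := norm_add_le z (Complex.I * w)
    rw [sub_neg_eq_add, norm_neg] at h1
    have h5 : 0 < ‖z + Complex.I * w‖ := by linarith
    rw [lineCayley, norm_div, le_div_iff₀ h5, div_le_iff₀ h5]
    constructor <;> linarith

theorem norm_linePhase (hw : ‖w‖ = 1) (hz : ‖z‖ < 3 → ∃ x : ℝ, z = w * x) :
    ‖linePhase w z‖ = 1 := by
  have := (norm_lineCayley_mem hw hz).1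
  rw [linePhase, norm_div, Complex.norm_real, norm_norm, div_self (by linarith)]

theorem linePhase_ofReal (hw : ‖w‖ = 1) (x : ℝ) :
    linePhase w (w * x) = ((x ^ 2 - 1) / (x ^ 2 + 1) : ℝ) + ((-2 * x) / (x ^ 2 + 1) : ℝ) * Complex.I := by
  have h1 : (x : ℂ) ^ 2 + 1 ≠ 0 := by
    have : (x ^ 2 + 1 : ℝ) ≠ 0 := by positivity
    exact_mod_cast this
  have h2 : (x : ℂ) + Complex.I ≠ 0 := by
    intro h
    have := congrArg Complex.im h
    simp at this
  rw [linePhase, norm_lineCayley_ofReal hw, lineCayley_mul hw, Complex.ofReal_one, div_one]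
  push_cast
  field_simp
  ring_nf
  rw [Complex.I_sq]
  ring

/-- With `z = wu` the real part is `(|u|² - 1)/(|u - i| |u + i|)`. The denominator is at most `|u|²
+ 1`, and at `|u| = 3` this gives `8/10`. -/
theorem linePhase_re_of_ge (hw : ‖w‖ = 1) (hz : 3 ≤ ‖z‖) : 0.8 ≤ (linePhase w z).re := by
  have hw0 : w ≠ 0 := by rw [← norm_pos_iff, hw]; norm_num
  obtain ⟨u, rfl⟩ : ∃ u, z = w * u := ⟨w⁻¹ * z, by field_simp⟩
  have hq := (norm_lineCayley_mem hw fun h => absurd hz (not_le.2 h)).1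
  rw [norm_mul, hw, one_mul] at hz
  rw [linePhase, Complex.div_ofReal_re, le_div_iff₀ (by linarith), lineCayley_mul hw, norm_div,
    Complex.div_re, ← add_div, Complex.normSq_eq_norm_sq]
  have h1 : ‖u + Complex.I‖ ^ 2 = ‖u‖ ^ 2 + 1 + 2 * u.im := by
    rw [← Complex.normSq_eq_norm_sq, ← Complex.normSq_eq_norm_sq, Complex.normSq_apply,
      Complex.normSq_apply]; simp; ring
  have h2 : ‖u - Complex.I‖ ^ 2 = ‖u‖ ^ 2 + 1 - 2 * u.im := by
    rw [← Complex.normSq_eq_norm_sq, ← Complex.normSq_eq_norm_sq, Complex.normSq_apply,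
      Complex.normSq_apply]; simp; ring
  have h3 : (u - Complex.I).re * (u + Complex.I).re + (u - Complex.I).im * (u + Complex.I).im =
      ‖u‖ ^ 2 - 1 := by
    rw [← Complex.normSq_eq_norm_sq, Complex.normSq_apply]; simp; ring
  have h4 : 0 < ‖u + Complex.I‖ := by
    have := norm_sub_norm_le u (-Complex.I)
    rw [sub_neg_eq_add, norm_neg, Complex.norm_I] at this
    linarith
  rw [h3, ← mul_div_assoc, div_le_div_iff₀ h4 (by positivity)]
  have h5 : 0.8 * (‖u - Complex.I‖ * ‖u + Complex.I‖) ≤ ‖u‖ ^ 2 - 1 := by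
    nlinarith [sq_nonneg (‖u + Complex.I‖ - ‖u - Complex.I‖)]
  nlinarith [mul_le_mul_of_nonneg_right h5 h4.le]

theorem continuousOn_lineCayley (hw : ‖w‖ = 1) {s : Set ℂ}
    (hs : ∀ z ∈ s, ‖z‖ < 3 → ∃ x : ℝ, z = w * x) : ContinuousOn (lineCayley w) s :=
  ContinuousOn.div (by fun_prop) (by fun_prop) fun z hz => add_ne_zero_of_line hw (hs z hz)

theorem continuousOn_linePhase (hw : ‖w‖ = 1) {s : Set ℂ}
    (hs : ∀ z ∈ s, ‖z‖ < 3 → ∃ x : ℝ, z = w * x) : ContinuousOn (linePhase w) s :=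
  (continuousOn_lineCayley hw hs).div
    (Complex.continuous_ofReal.comp_continuousOn (continuousOn_lineCayley hw hs).norm) fun z hz => by
      have := (norm_lineCayley_mem hw (hs z hz)).1
      exact_mod_cast (by linarith : ‖lineCayley w z‖ ≠ 0)

/-- On the line the real part is `(x² - 1)/(x² + 1)`, which is `-0.6` at `|x| = 1/2` and `0.6` at
`|x| = 2`. These values match the thresholds of `lowCut` and `arcSin`. -/
theorem linePhase_re_of_half_le (hw : ‖w‖ = 1) (hz : ‖z‖ < 3 → ∃ x : ℝ, z = w * x)
    (h : 1 / 2 ≤ ‖z‖) : -0.6 ≤ (linePhase w z).re := by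
  rcases lt_or_ge ‖z‖ 3 with h1 | h1
  · obtain ⟨x, rfl⟩ := hz h1
    rw [norm_mul, hw, one_mul, Complex.norm_real, Real.norm_eq_abs] at h
    have h2 : 1 / 4 ≤ x ^ 2 := by rw [← sq_abs]; nlinarith
    rw [linePhase_ofReal hw]
    simp only [Complex.add_re, Complex.ofReal_re, Complex.re_ofReal_mul, Complex.I_re, mul_zero,
      add_zero]
    rw [le_div_iff₀ (by positivity)]
    linarith
  · linarith [linePhase_re_of_ge hw h1]

theorem linePhase_re_of_lt_two (hw : ‖w‖ = 1) (hz : ‖z‖ < 3 → ∃ x : ℝ, z = w * x)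
    (h : ‖z‖ < 2) : (linePhase w z).re ≤ 0.6 := by
  obtain ⟨x, rfl⟩ := hz (by linarith)
  rw [norm_mul, hw, one_mul, Complex.norm_real, Real.norm_eq_abs] at h
  have h2 : x ^ 2 ≤ 4 := by rw [← sq_abs]; nlinarith [abs_nonneg x]
  rw [linePhase_ofReal hw]
  simp only [Complex.add_re, Complex.ofReal_re, Complex.re_ofReal_mul, Complex.I_re, mul_zero,
    add_zero]
  rw [div_le_iff₀ (by positivity)]
  linarith

theorem mul_arcFun_linePhase (hw : ‖w‖ = 1) (hz : ‖z‖ < 3 → ∃ x : ℝ, z = w * x)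
    (h : 1 / 2 ≤ ‖z‖) (h' : ‖z‖ < 2) : w * arcFun (linePhase w z) = z / ‖z‖ := by
  obtain ⟨x, rfl⟩ := hz (by linarith)
  have hp := linePhase_ofReal hw x
  rw [norm_mul, hw, one_mul, Complex.norm_real, Real.norm_eq_abs] at *
  have him : (linePhase w (w * x)).im = (-2 * x) / (x ^ 2 + 1) := by
    rw [hp]
    simp only [Complex.add_im, Complex.ofReal_im, Complex.im_ofReal_mul, Complex.I_im, mul_one,
      zero_add]
  -- This places the phase at `|Im| ≥ 1/2`, where `arcFun` is exactly `±1`; positive `x` goes to the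
  -- lower arc, where the value is `1`.
  have key : |x| ^ 2 + 1 ≤ 4 * |x| := by nlinarith
  rw [sq_abs] at key
  rcases le_total 0 x with h0 | h0
  · rw [abs_of_nonneg h0] at *
    have h1 : (linePhase w (w * x)).im ≤ -1 / 2 := by
      rw [him, div_le_div_iff₀ (by positivity) (by norm_num)]; linarith
    rw [arcFun, arcSin_of_le_abs_im (le_abs.2 (Or.inr (by linarith))), arcCos_of_im_le h1]
    have : (x : ℂ) ≠ 0 := by exact_mod_cast (by linarith : x ≠ 0)
    field_simp
    ring
  · rw [abs_of_nonpos h0] at *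
    have h1 : 1 / 2 ≤ (linePhase w (w * x)).im := by
      rw [him, div_le_div_iff₀ (by norm_num) (by positivity)]; linarith
    rw [arcFun, arcSin_of_le_abs_im (le_abs.2 (Or.inl h1)), arcCos_of_le_im h1]
    have : (x : ℂ) ≠ 0 := by exact_mod_cast (by linarith : x ≠ 0)
    push_cast
    field_simp
    ring

end Phase

/-! ### The unitary `Z` and its commutator with `P` -/

section PhaseElement
variable {E : Type*} [CStarAlgebra E]

theorem polar_cfc {T : E} [IsStarNormal T] {g : ℂ → ℂ} (hg : ContinuousOn g (spectrum ℂ T))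
    (h0 : ∀ z ∈ spectrum ℂ T, g z ≠ 0) :
    polar (cfc g T) = cfc (fun z => g z / ‖g z‖) T := by
  have h1 : star (cfc g T) * cfc g T = cfc (fun z => ((‖g z‖ ^ 2 : ℝ) : ℂ)) T := by
    rw [← cfc_star]
    refine cfc_mul_of_eqOn (by fun_prop) hg fun z _ => ?_
    rw [← starRingEnd_apply, ← Complex.normSq_eq_conj_mul_self, Complex.normSq_eq_norm_sq]
  have hn : ContinuousOn (fun z => ((‖g z‖ ^ 2 : ℝ) : ℂ)) (spectrum ℂ T) :=
    Complex.continuous_ofReal.comp_continuousOn (hg.norm.pow 2)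
  have h2 : absInv (cfc g T) = cfc (fun z => (((‖g z‖)⁻¹ : ℝ) : ℂ)) T := by
    rw [absInv, cfc_real_eq_complex _ (IsSelfAdjoint.star_mul_self _), h1,
      ← cfc_comp' (fun x : ℂ => (((√x.re)⁻¹ : ℝ) : ℂ)) _ T ?_ hn]
    · refine cfc_congr fun z _ => ?_
      simp only [Complex.ofReal_re]
      rw [Real.sqrt_sq (norm_nonneg _)]
    · refine Complex.continuous_ofReal.comp_continuousOn (ContinuousOn.inv₀ (by fun_prop) ?_)
      rintro _ ⟨z, hz, rfl⟩
      have := norm_pos_iff.2 (h0 z hz)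
      simp only [Complex.ofReal_re]
      positivity
  rw [polar, h2]
  refine cfc_mul_of_eqOn hg ?_ fun z hz => ?_
  · exact Complex.continuous_ofReal.comp_continuousOn
      (hg.norm.inv₀ fun z hz => norm_ne_zero_iff.2 (h0 z hz))
  · push_cast; rw [div_eq_mul_inv]

theorem cfc_add_smul_one (T : E) [IsStarNormal T] (c : ℂ) :
    cfc (fun z => z + c) T = T + c • 1 := by
  rw [cfc_add_const c (fun z => z) T, cfc_id' ℂ T, Algebra.algebraMap_eq_smul_one]

theorem norm_commutator_inv_le {P X R : E} (h1 : X * R = 1) (h2 : R * X = 1) (hR : ‖R‖ ≤ 1) :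
    ‖P * R - R * P‖ ≤ ‖P * X - X * P‖ := by
  have h : P * R - R * P = -(R * (P * X - X * P) * R) := by
    calc _ = (R * X) * P * R - R * P * (X * R) := by rw [h1, h2]; noncomm_ring
      _ = _ := by noncomm_ring
  rw [h, norm_neg]
  calc _ ≤ 1 * ‖P * X - X * P‖ * 1 :=
        (norm_mul_le _ _).trans (by gcongr; exact (norm_mul_le _ _).trans (by gcongr))
    _ = _ := by ring

variable {P T : E} {w : ℂ} [IsStarNormal T]

/-- The Cayley transform is `1 - 2iw (T + iw)⁻¹`, and the resolvent has norm at most `1`. -/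
theorem norm_commutator_lineCayley_le (hw : ‖w‖ = 1)
    (hT : ∀ z ∈ spectrum ℂ T, ‖z‖ < 3 → ∃ x : ℝ, z = w * x) :
    ‖P * cfc (lineCayley w) T - cfc (lineCayley w) T * P‖ ≤ 2 * ‖P * T - T * P‖ := by
  have hc : ContinuousOn (fun z => (z + Complex.I * w)⁻¹) (spectrum ℂ T) :=
    ContinuousOn.inv₀ (by fun_prop) fun z hz => add_ne_zero_of_line hw (hT z hz)
  obtain ⟨R, hR⟩ : ∃ R, R = cfc (fun z => (z + Complex.I * w)⁻¹) T := ⟨_, rfl⟩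
  have h1 : (T + (Complex.I * w) • 1) * R = 1 := by
    rw [hR, ← cfc_add_smul_one, ← cfc_const_one ℂ T]
    exact cfc_mul_of_eqOn (by fun_prop) hc fun z hz => mul_inv_cancel₀ (add_ne_zero_of_line hw (hT z hz))
  have h2 : R * (T + (Complex.I * w) • 1) = 1 := by
    rw [hR, ← cfc_add_smul_one, ← cfc_const_one ℂ T]
    exact cfc_mul_of_eqOn hc (by fun_prop) fun z hz => inv_mul_cancel₀ (add_ne_zero_of_line hw (hT z hz))
  have hRn : ‖R‖ ≤ 1 := by
    rw [hR]
    refine norm_cfc_le zero_le_one fun z hz => ?_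
    rw [norm_inv]
    exact inv_le_one_of_one_le₀ (one_le_norm_add hw (hT z hz))
  have h3 : cfc (lineCayley w) T = 1 - (2 * Complex.I * w) • R := by
    rw [hR, ← cfc_const_mul _ _ T hc, ← cfc_const_one ℂ T,
      ← cfc_sub (fun _ => 1) (fun z => 2 * Complex.I * w * (z + Complex.I * w)⁻¹) T
        continuousOn_const (continuousOn_const.mul hc)]
    refine cfc_congr fun z hz => ?_
    have := add_ne_zero_of_line hw (hT z hz)
    simp only [lineCayley]
    field_simp
    ring
  have h4 := norm_commutator_inv_le (P := P) h1 h2 hRn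
  have h5 : P * (T + (Complex.I * w) • 1) - (T + (Complex.I * w) • 1) * P = P * T - T * P := by
    simp [mul_add, add_mul]
  have h6 : P * cfc (lineCayley w) T - cfc (lineCayley w) T * P =
      -((2 * Complex.I * w) • (P * R - R * P)) := by
    rw [h3]; simp [mul_sub, sub_mul, smul_sub]
  rw [h5] at h4
  rw [h6, norm_neg, norm_smul]
  simp only [norm_mul, hw, Complex.norm_I, Complex.norm_ofNat, mul_one]
  gcongr

theorem polar_lineCayley (hw : ‖w‖ = 1)
    (hT : ∀ z ∈ spectrum ℂ T, ‖z‖ < 3 → ∃ x : ℝ, z = w * x) :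
    polar (cfc (lineCayley w) T) = cfc (linePhase w) T :=
  polar_cfc (continuousOn_lineCayley hw hT) fun z hz => by
    have := (norm_lineCayley_mem hw (hT z hz)).1
    rw [← norm_pos_iff]; linarith

/-- The constant is the product of `2` for the Cayley transform and `130` for its polar part. -/
theorem norm_commutator_linePhase_le (hP : IsSelfAdjoint P) (hw : ‖w‖ = 1)
    (hT : ∀ z ∈ spectrum ℂ T, ‖z‖ < 3 → ∃ x : ℝ, z = w * x) :
    ‖P * cfc (linePhase w) T - cfc (linePhase w) T * P‖ ≤ 260 * ‖P * T - T * P‖ := by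
  have hc := continuousOn_lineCayley hw hT
  rw [← polar_lineCayley hw hT]
  have hs : ∀ t ∈ spectrum ℝ (star (cfc (lineCayley w) T) * cfc (lineCayley w) T),
      (1 / 2) ^ 2 ≤ t ∧ t ≤ 2 ^ 2 := by
    intro t ht
    have h1 : star (cfc (lineCayley w) T) * cfc (lineCayley w) T =
        cfc (fun z => ((‖lineCayley w z‖ ^ 2 : ℝ) : ℂ)) T := by
      rw [← cfc_star]
      refine cfc_mul_of_eqOn (by fun_prop) hc fun z _ => ?_
      rw [← starRingEnd_apply, ← Complex.normSq_eq_conj_mul_self, Complex.normSq_eq_norm_sq]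
    have h2 : (t : ℂ) ∈ spectrum ℂ (star (cfc (lineCayley w) T) * cfc (lineCayley w) T) := by
      rw [← Complex.coe_algebraMap]
      exact spectrum.algebraMap_mem ℂ ht
    have hc' : ContinuousOn (fun z => ((‖lineCayley w z‖ ^ 2 : ℝ) : ℂ)) (spectrum ℂ T) :=
      Complex.continuous_ofReal.comp_continuousOn (hc.norm.pow 2)
    rw [h1, cfc_map_spectrum _ T (hf := hc')] at h2
    obtain ⟨z, hz, h3⟩ := h2
    have h4 : ‖lineCayley w z‖ ^ 2 = t := Complex.ofReal_injective h3
    obtain ⟨h5, h6⟩ := norm_lineCayley_mem hw (hT z hz)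
    rw [← h4]
    constructor <;> gcongr
  refine (norm_commutator_polar_le (by norm_num) (by norm_num) hs hP).trans ?_
  have := norm_commutator_lineCayley_le (P := P) hw hT
  norm_num
  linarith

theorem linePhase_mem_unitary (hw : ‖w‖ = 1)
    (hT : ∀ z ∈ spectrum ℂ T, ‖z‖ < 3 → ∃ x : ℝ, z = w * x) :
    cfc (linePhase w) T ∈ unitary E := by
  rw [cfc_unitary_iff _ _ (hf := continuousOn_linePhase hw hT)]
  intro z hz
  rw [← starRingEnd_apply, ← Complex.normSq_eq_conj_mul_self, Complex.normSq_eq_norm_sq,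
    norm_linePhase hw (hT z hz)]
  simp

end PhaseElement
end NormalDist

namespace NormalDist
open Set Filter Topology

/-! ### The block diagonal part of `Z` is connected to the identity -/

section BlockPhase
variable {E : Type*} [CStarAlgebra E] {D : Type*} [CStarAlgebra D] {ι : D →⋆ₐ[ℂ] E}
  {P T : E} {w : ℂ} [IsStarNormal T]

/-- The block diagonal part of the Cayley transform of `T` is connected to `1` if those of
`T ± i w` are. -/
theorem lineCayley_mem_idComponent (hι : IsBlockHom ι P) (hw : ‖w‖ = 1)
    (hT : ∀ z ∈ spectrum ℂ T, ‖z‖ < 3 → ∃ x : ℝ, z = w * x)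
    (hd : ‖P * T - T * P‖ < 1 / 4) {n m y : D} (hn : n ∈ idComponent D) (hm : m ∈ idComponent D)
    (en : ι n = blockDiag P (T + (Complex.I * w) • 1))
    (em : ι m = blockDiag P (T - (Complex.I * w) • 1))
    (ey : ι y = blockDiag P (cfc (lineCayley w) T)) : y ∈ idComponent D := by
  have hcC := continuousOn_lineCayley hw hT
  refine mem_idComponent_of_mul_left hn ?_
  obtain ⟨g, hg, rfl⟩ := hm
  have hc : ContinuousOn (fun z => (z - Complex.I * w)⁻¹) (spectrum ℂ T) :=
    ContinuousOn.inv₀ (by fun_prop) fun z hz => sub_ne_zero_of_line hw (hT z hz)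
  have hX : T - (Complex.I * w) • 1 = cfc (fun z => z - Complex.I * w) T := by
    have := cfc_add_smul_one T (-(Complex.I * w))
    rw [neg_smul, ← sub_eq_add_neg] at this
    rw [← this]; rfl
  have h2 : cfc (fun z => (z - Complex.I * w)⁻¹) T * (T - (Complex.I * w) • 1) = 1 := by
    rw [hX, ← cfc_const_one ℂ T]
    exact cfc_mul_of_eqOn hc (by fun_prop) fun z hz => inv_mul_cancel₀ (sub_ne_zero_of_line hw (hT z hz))
  have hR : ‖cfc (fun z => (z - Complex.I * w)⁻¹) T‖ ≤ 1 := by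
    refine norm_cfc_le zero_le_one fun z hz => ?_
    rw [norm_inv]
    exact inv_le_one_of_one_le₀ (one_le_norm_sub hw (hT z hz))
  have e1 : P * (T - (Complex.I * w) • 1) - (T - (Complex.I * w) • 1) * P = P * T - T * P := by
    simp [mul_sub, sub_mul]
  have e2 : P * (T + (Complex.I * w) • 1) - (T + (Complex.I * w) • 1) * P = P * T - T * P := by
    simp [mul_add, add_mul]
  have h3 := hι.norm_inv_le_of_map_eq h2 hR (by rw [e1]; linarith) em
  refine mem_idComponent_of_norm_lt (g := g) ⟨g, hg, rfl⟩ ?_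
  have h4 : cfc (lineCayley w) T * (T + (Complex.I * w) • 1) = T - (Complex.I * w) • 1 := by
    rw [hX, ← cfc_add_smul_one]
    exact cfc_mul_of_eqOn hcC (by fun_prop) fun z hz =>
      div_mul_cancel₀ _ (add_ne_zero_of_line hw (hT z hz))
  -- The relation `C (T + iw) = T - iw` survives on block diagonal parts up to a quadratic error,
  -- which is small against the inverse of `g`, of norm at most `2`.
  have h5 : ‖(g : D) - y * n‖ ≤ 2 * ‖P * T - T * P‖ * ‖P * T - T * P‖ := by
    rw [norm_sub_rev, ← hι.norm_map, map_sub, map_mul, ey, en, em, ← h4]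
    refine (norm_blockDiag_mul_sub_le hι.idem hι.isSelfAdjoint _ _).trans ?_
    rw [e2]
    gcongr
    exact norm_commutator_lineCayley_le hw hT
  have h6 : 2 * ‖P * T - T * P‖ * ‖P * T - T * P‖ < 1 / 4 := by
    nlinarith [norm_nonneg (P * T - T * P)]
  nlinarith [norm_nonneg ((g : D) - y * n)]

/-- Points on the segment from the Cayley transform to its phase are positive multiples of the
phase, pointwise of modulus at least `1/2`. They almost commute with `P`, so their block diagonal
parts stay invertible. -/
theorem linePhase_mem_idComponent (hι : IsBlockHom ι P) (hw : ‖w‖ = 1)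
    (hT : ∀ z ∈ spectrum ℂ T, ‖z‖ < 3 → ∃ x : ℝ, z = w * x)
    (hd : 260 * ‖P * T - T * P‖ ≤ 1 / 4) {c y : D} (hc : c ∈ idComponent D)
    (ec : ι c = blockDiag P (cfc (lineCayley w) T))
    (ey : ι y = blockDiag P (cfc (linePhase w) T)) : y ∈ idComponent D := by
  have hcC := continuousOn_lineCayley hw hT
  have hcZ := continuousOn_linePhase hw hT
  refine mem_idComponent_of_segment hc fun x hx => ?_
  obtain ⟨a, b, ha, hb, hab, rfl⟩ := hx
  set F : ℂ → ℂ := fun z => (a : ℂ) * lineCayley w z + (b : ℂ) * linePhase w z with hF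
  have hcF : ContinuousOn F (spectrum ℂ T) :=
    (continuousOn_const.mul hcC).add (continuousOn_const.mul hcZ)
  have hFT : cfc F T = (a : ℂ) • cfc (lineCayley w) T + (b : ℂ) • cfc (linePhase w) T := by
    rw [← cfc_const_mul _ _ T hcC, ← cfc_const_mul _ _ T hcZ, ← cfc_add (a := T)
      (fun z => (a : ℂ) * lineCayley w z) (fun z => (b : ℂ) * linePhase w z)
      (continuousOn_const.mul hcC) (continuousOn_const.mul hcZ)]
  have hFn : ∀ z ∈ spectrum ℂ T, 1 / 2 ≤ ‖F z‖ := by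
    intro z hz
    have h1 := (norm_lineCayley_mem hw (hT z hz)).1
    have h0 : (‖lineCayley w z‖ : ℂ) ≠ 0 := by
      exact_mod_cast (by linarith : ‖lineCayley w z‖ ≠ 0)
    have h2 : F z = ((a * ‖lineCayley w z‖ + b : ℝ) : ℂ) * linePhase w z := by
      simp only [hF, linePhase]
      push_cast
      field_simp
    rw [h2, norm_mul, norm_linePhase hw (hT z hz), mul_one, Complex.norm_real,
      Real.norm_of_nonneg (by positivity)]
    nlinarith
  have hF0 : ∀ z ∈ spectrum ℂ T, F z ≠ 0 := fun z hz => by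
    rw [← norm_pos_iff]; linarith [hFn z hz]
  have hcI : ContinuousOn (fun z => (F z)⁻¹) (spectrum ℂ T) := hcF.inv₀ hF0
  refine hι.isUnit_of_map_eq (X := cfc F T) (R := cfc (fun z => (F z)⁻¹) T) (k := 2) ?_ ?_ ?_ ?_ ?_
  · rw [← cfc_const_one ℂ T]
    exact cfc_mul_of_eqOn hcF hcI fun z hz => mul_inv_cancel₀ (hF0 z hz)
  · rw [← cfc_const_one ℂ T]
    exact cfc_mul_of_eqOn hcI hcF fun z hz => inv_mul_cancel₀ (hF0 z hz)
  · refine norm_cfc_le zero_le_two fun z hz => ?_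
    rw [norm_inv, inv_le_comm₀ (by linarith [hFn z hz]) two_pos]
    linarith [hFn z hz]
  · have h1 := norm_commutator_lineCayley_le (P := P) hw hT
    have h2 := norm_commutator_linePhase_le hι.isSelfAdjoint hw hT
    have h3 : P * cfc F T - cfc F T * P =
        (a : ℂ) • (P * cfc (lineCayley w) T - cfc (lineCayley w) T * P) +
        (b : ℂ) • (P * cfc (linePhase w) T - cfc (linePhase w) T * P) := by
      rw [hFT]
      simp only [mul_add, add_mul, mul_smul_comm, smul_mul_assoc, smul_sub]
      abel
    rw [h3]
    have h4 := norm_add_le ((a : ℂ) • (P * cfc (lineCayley w) T - cfc (lineCayley w) T * P))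
      ((b : ℂ) • (P * cfc (linePhase w) T - cfc (linePhase w) T * P))
    rw [norm_smul, norm_smul, Complex.norm_real, Complex.norm_real, Real.norm_of_nonneg ha,
      Real.norm_of_nonneg hb] at h4
    nlinarith [norm_nonneg (P * T - T * P)]
  · rw [hFT, blockDiag_add, blockDiag_smul, blockDiag_smul, ← ec, ← ey, map_add]
    rw [← Complex.coe_smul, ← Complex.coe_smul, map_smul, map_smul]

end BlockPhase

/-! ### The modified unitary part in an abstract algebra -/

section Main

theorem map_mem_unitary {D E : Type*} [CStarAlgebra D] [CStarAlgebra E] (ι : D →⋆ₐ[ℂ] E) {v : D}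
    (hv : v ∈ unitary D) : ι v ∈ unitary E := by
  rw [Unitary.mem_iff] at *
  rw [← map_star, ← map_mul, ← map_mul, hv.1, hv.2, map_one]
  exact ⟨rfl, rfl⟩

/-- A normal element `T` which almost commutes with `P`, and whose spectrum near `0` lies on the
line `w ℝ`, has a modified unitary part `U` which almost commutes with `P`, commutes with
functions of `T` away from `0`, coincides with the phase of `T` on an annulus, and
satisfies `U ^ 2 = w ^ 2` near `0`. -/
theorem exists_modified_unitary_part : ∃ δ K : ℝ, 0 < δ ∧ 0 < K ∧
    ∀ {E D : Type u} [CStarAlgebra E] [CStarAlgebra D] {ι : D →⋆ₐ[ℂ] E} {P T : E} {w : ℂ}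
      [IsStarNormal T], IsBlockHom ι P → HasRealRankZero D → ‖w‖ = 1 → w ∈ Complex.slitPlane →
      (∀ z ∈ spectrum ℂ T, ‖z‖ < 3 → ∃ x : ℝ, z = w * x) → ‖P * T - T * P‖ < δ →
      (∃ n ∈ idComponent D, ι n = blockDiag P (T + (Complex.I * w) • 1)) →
      (∃ n ∈ idComponent D, ι n = blockDiag P (T - (Complex.I * w) • 1)) →
      ∃ U ∈ unitary E, (∃ y ∈ idComponent D, ι y = blockDiag P U) ∧
        ‖P * U - U * P‖ ≤ K * ‖P * T - T * P‖ ∧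
        (∀ f : ℂ → ℂ, Continuous f → (∀ z, ‖z‖ < 1 / 2 → f z = 0) → Commute U (cfc f T)) ∧
        (∀ f : ℂ → ℂ, Continuous f → (∀ z, 2 ≤ ‖z‖ → f z = 0) →
          U * (U * cfc f T) = w ^ 2 • cfc f T) ∧
        ∀ f : ℂ → ℂ, Continuous f → (∀ z, ‖z‖ < 1 / 2 → f z = 0) → (∀ z, 2 ≤ ‖z‖ → f z = 0) →
          U * cfc f T = cfc (fun z => z / ‖z‖ * f z) T := by
  obtain ⟨ε₀, K, hε₀, hK, H⟩ := exists_unitary_of_close.{u}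
  -- The bound `1/4` serves the invertibility of block diagonal parts, `ε₀/4` the closeness of `Z`
  -- to `v`; the summand `+ 1` only makes the constant positive.
  refine ⟨min (1 / 4) (ε₀ / 4) / 260, K * 260 + 1, by positivity, by positivity, ?_⟩
  intro E D _ _ ι P T w _ hι hD hw hws hT hd ⟨n, hn, en⟩ ⟨m, hm, em⟩
  rw [lt_div_iff₀' (by norm_num)] at hd
  have hd1 := hd.le.trans (min_le_left _ _)
  have hd2 := hd.le.trans (min_le_right _ _)
  have hcZ := continuousOn_linePhase hw hT
  obtain ⟨Z, hZ⟩ : ∃ Z, Z = cfc (linePhase w) T := ⟨_, rfl⟩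
  have hZu : Z ∈ unitary E := hZ ▸ linePhase_mem_unitary hw hT
  have hPZ : ‖P * Z - Z * P‖ ≤ 260 * ‖P * T - T * P‖ :=
    hZ ▸ norm_commutator_linePhase_le hι.isSelfAdjoint hw hT
  obtain ⟨c, hc⟩ := hι.exists_map_eq (cfc (lineCayley w) T)
  obtain ⟨y, hy⟩ := hι.exists_map_eq Z
  have hcI := lineCayley_mem_idComponent hι hw hT (by linarith [norm_nonneg (P * T - T * P)]) hn hm
    en em hc
  obtain ⟨g, hg, hgy⟩ := linePhase_mem_idComponent hι hw hT hd1 hcI hc (hZ ▸ hy)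
  obtain ⟨v, hvu, hvf, hyv⟩ := isLimitFiniteSpectrum_polar hD hg (ε₀ / 2) (half_pos hε₀)
  rw [hgy] at hyv
  have hZn := norm_le_one_of_mem_unitary hZu
  have hyn : ‖y‖ ≤ 1 := by
    rw [← hι.norm_map, hy]
    exact (norm_blockDiag_le hι.idem hι.isSelfAdjoint Z).trans hZn
  have hyy : ‖star y * y - 1‖ ≤ (260 * ‖P * T - T * P‖) * (260 * ‖P * T - T * P‖) := by
    rw [← hι.norm_map, map_sub, map_mul, map_star, hy, map_one, ← blockDiag_star hι.isSelfAdjoint]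
    have h1 := norm_blockDiag_mul_sub_le hι.idem hι.isSelfAdjoint (star Z) Z
    rw [Unitary.star_mul_self_of_mem hZu, blockDiag_of_commute hι.idem (Commute.one_right P),
      norm_commutator_star hι.isSelfAdjoint] at h1
    refine h1.trans ?_
    gcongr
  have hyy' : ‖star y * y - 1‖ ≤ 1 / 4 * (260 * ‖P * T - T * P‖) :=
    hyy.trans (by gcongr)
  have hpy : ‖polar y - y‖ ≤ 1 / 4 * (260 * ‖P * T - T * P‖) := by
    refine (norm_polar_sub_le (by linarith)).trans ?_
    calc _ ≤ 1 * (1 / 4 * (260 * ‖P * T - T * P‖)) := by gcongr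
      _ = _ := one_mul _
  have hZv : ‖Z - ι v‖ ≤ ε₀ := by
    have h1 : ‖Z - ι y‖ ≤ 260 * ‖P * T - T * P‖ := by
      rw [hy]
      exact (norm_sub_blockDiag_le hι.idem hι.isSelfAdjoint Z).trans hPZ
    have h2 : ‖ι y - ι v‖ ≤ 1 / 4 * (260 * ‖P * T - T * P‖) + ε₀ / 2 := by
      rw [← map_sub, hι.norm_map]
      have := norm_add_le (y - polar y) (polar y - v)
      rw [sub_add_sub_cancel, norm_sub_rev y (polar y)] at this
      linarith
    have := norm_add_le (Z - ι y) (ι y - ι v)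
    rw [sub_add_sub_cancel] at this
    linarith
  have hιf : (spectrum ℂ (ι v)).Finite := hvf.subset (AlgHom.spectrum_apply_subset ι v)
  obtain ⟨U, hU, hPU, hUW, hA, hA', hB⟩ := H hι.isSelfAdjoint hZu (map_mem_unitary ι hvu) hιf
    (hι.commute v) hZv
  have comp : ∀ F : ℂ → ℂ, Continuous F → ∀ f : ℂ → ℂ, ContinuousOn f (spectrum ℂ T) →
      cfc F Z * cfc f T = cfc (fun z => F (linePhase w z) * f z) T := by
    intro F hF f hf
    rw [hZ, ← cfc_comp' F (linePhase w) T (hF.continuousOn) hcZ]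
    exact cfc_mul_of_eqOn (hF.comp_continuousOn hcZ) hf fun z _ => rfl
  have hsp : ∀ z ∈ spectrum ℂ T, linePhase w z ∈ Metric.sphere (0 : ℂ) 1 := fun z hz =>
    mem_sphere_zero_iff_norm.2 (norm_linePhase hw (hT z hz))
  -- Functions of `T` that vanish for `|z| < 1/2` live where the cut-off near `-1` is zero and
  -- `arcFun` is unimodular, so there `U` is just a function of `Z`.
  have cut : ∀ f : ℂ → ℂ, Continuous f → (∀ z, ‖z‖ < 1 / 2 → f z = 0) →
      cfc lowCut Z * cfc f T = 0 ∧
        cfc (fun z => star (arcFun z) * arcFun z) Z * cfc f T = cfc f T := by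
    intro f hf h0
    constructor
    · rw [comp _ continuous_lowCut f hf.continuousOn, ← cfc_const_zero ℂ T]
      refine cfc_congr fun z hz => ?_
      rcases lt_or_ge ‖z‖ (1 / 2) with h | h
      · simp [h0 z h]
      · simp [lowCut_of_le (linePhase_re_of_half_le hw (hT z hz) h)]
    · rw [comp _ (by fun_prop) f hf.continuousOn]
      refine cfc_congr fun z hz => ?_
      rcases lt_or_ge ‖z‖ (1 / 2) with h | h
      · simp [h0 z h]
      · have h1 := norm_arcFun (hsp z hz) (linePhase_re_of_half_le hw (hT z hz) h)
        rw [← starRingEnd_apply, ← Complex.normSq_eq_conj_mul_self, Complex.normSq_eq_norm_sq, h1]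
        simp
  have hU1 : ∀ f : ℂ → ℂ, Continuous f → (∀ z, ‖z‖ < 1 / 2 → f z = 0) →
      Commute U (cfc f T) := by
    intro f hf h0
    have h1 := cut f hf h0
    -- Commutation needs both `U f(T)` and `f(T) U`; the latter is the adjoint of the statement
    -- about `U⋆` and the conjugate of `f`.
    have h2 := cut (fun z => star (f z)) (by fun_prop) fun z hz => by simp [h0 z hz]
    have h3 := hA' _ h2.1 h2.2
    rw [cfc_star] at h3
    have h4 := congrArg star h3
    simp only [star_mul, star_star] at h4
    rw [Commute, SemiconjBy, h4, hA _ h1.1 h1.2]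
    have : cfc arcFun Z = cfc (fun z => arcFun (linePhase w z)) T := by
      rw [hZ, cfc_comp' arcFun (linePhase w) T continuous_arcFun.continuousOn hcZ]
    rw [this]
    exact (cfc_commute_cfc _ _ T).eq
  refine ⟨w • U, smul_mem_unitary hw hU, ?_, ?_, fun f hf h0 => (hU1 f hf h0).smul_left w,
    fun f hf h0 => ?_, fun f hf h0 h0' => ?_⟩
  · obtain ⟨x, hx⟩ := hι.exists_map_eq U
    refine ⟨(w • 1) * x, mul_mem_idComponent (smul_one_mem_idComponent hws) ?_, ?_⟩
    · have hWu := cfc_arc_mem_unitary hvu hvf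
      refine mem_idComponent_of_norm_lt (g := Unitary.toUnits ⟨_, hWu⟩)
        (cfc_arc_mem_idComponent hvu hvf) ?_
      have h1 : ‖(((Unitary.toUnits ⟨_, hWu⟩)⁻¹ : Dˣ) : D)‖ ≤ 1 :=
        norm_le_one_of_mem_unitary (Unitary.star_mem hWu)
      have nv := isStarNormal_of_mem_unitary hvu
      have nv' := isStarNormal_of_mem_unitary (map_mem_unitary ι hvu)
      have h2 : ι (cfc (fun z => arcFun z + arcJump z) v) =
          cfc (fun z => arcFun z + arcJump z) (ι v) :=
        StarAlgHomClass.map_cfc (S := ℂ) ι _ v (continuousOn_spectrum_of_finite hvf _)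
          (NonUnitalStarAlgHom.isometry ι hι.injective).continuous nv nv'
      have h3 : ‖cfc (fun z => arcFun z + arcJump z) v - x‖ ≤ 1 / 2 := by
        rw [norm_sub_rev, ← hι.norm_map, map_sub, h2, hx,
          ← blockDiag_of_commute hι.idem (h2 ▸ hι.commute _ :
            Commute P (cfc (fun z => arcFun z + arcJump z) (ι v))), ← blockDiag_sub]
        exact (norm_blockDiag_le hι.idem hι.isSelfAdjoint _).trans hUW
      calc _ ≤ 1 * (1 / 2 : ℝ) := by gcongr; exact h3
        _ < 1 := by norm_num
    · rw [smul_mul_assoc, one_mul, map_smul, hx, blockDiag_smul]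
  · rw [mul_smul_comm, smul_mul_assoc, ← smul_sub, norm_smul, hw, one_mul]
    refine hPU.trans ?_
    calc _ ≤ K * (260 * ‖P * T - T * P‖) := by gcongr
      _ ≤ _ := by nlinarith [norm_nonneg (P * T - T * P)]
  · have h1 : cfc arcSin Z * cfc f T = 0 := by
      rw [comp _ continuous_arcSin f hf.continuousOn, ← cfc_const_zero ℂ T]
      refine cfc_congr fun z hz => ?_
      rcases lt_or_ge ‖z‖ 2 with h | h
      · simp [arcSin_of_re_le (hsp z hz) (linePhase_re_of_lt_two hw (hT z hz) h)]
      · simp [h0 z h]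
    simp only [smul_mul_assoc, mul_smul_comm, smul_smul]
    -- On this range `U` acts as its adjoint, so its square acts as `U U⋆ = 1`, and only the scalar
    -- `w²` remains.
    rw [hB _ h1, ← mul_assoc, Unitary.mul_star_self_of_mem hU,
      one_mul, sq]
  · have h1 := cut f hf h0
    have h2 : ContinuousOn (fun z => arcFun (linePhase w z) * f z) (spectrum ℂ T) :=
      (continuous_arcFun.comp_continuousOn hcZ).mul hf.continuousOn
    rw [smul_mul_assoc, hA _ h1.1 h1.2, comp _ continuous_arcFun f hf.continuousOn,
      ← cfc_const_mul _ _ T h2]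
    refine cfc_congr fun z hz => ?_
    rcases lt_or_ge ‖z‖ (1 / 2) with h | h
    · simp [h0 z h]
    rcases lt_or_ge ‖z‖ 2 with h' | h'
    · rw [← mul_assoc, mul_arcFun_linePhase hw (hT z hz) h h']
    · simp [h0' z h']

end Main
end NormalDist

namespace NormalDist
open Set Filter Topology

/-! ### Operator matrices and the algebra `M₂(A)` -/

section OpMatrix
variable {H : Type u} [NormedAddCommGroup H] [InnerProductSpace ℂ H]

theorem opMatrix_add (M N : Matrix (Fin 2) (Fin 2) (H →L[ℂ] H)) :
    opMatrix (M + N) = opMatrix M + opMatrix N := by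
  ext x i
  simp [opMatrix_apply, Fin.sum_univ_two]
  abel

theorem opMatrix_smul (c : ℂ) (M : Matrix (Fin 2) (Fin 2) (H →L[ℂ] H)) :
    opMatrix (c • M) = c • opMatrix M := by
  ext x i
  simp [opMatrix_apply, Fin.sum_univ_two]

theorem opMatrix_mul (M N : Matrix (Fin 2) (Fin 2) (H →L[ℂ] H)) :
    opMatrix (M * N) = opMatrix M * opMatrix N := by
  ext x i
  simp [opMatrix_apply, Fin.sum_univ_two, Matrix.mul_apply]
  abel

theorem opMatrix_one : opMatrix (1 : Matrix (Fin 2) (Fin 2) (H →L[ℂ] H)) = 1 := by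
  ext x i
  fin_cases i <;> simp [opMatrix_apply, Fin.sum_univ_two]

/-- The inclusion of a summand of `H ⊕ H`. -/
noncomputable def summandIncl (j : Fin 2) : H →L[ℂ] Dbl H :=
  ((PiLp.continuousLinearEquiv 2 ℂ (fun _ : Fin 2 => H)).symm : (Fin 2 → H) →L[ℂ] Dbl H) ∘L
    ContinuousLinearMap.single ℂ (fun _ : Fin 2 => H) j

theorem summandIncl_apply (i j : Fin 2) (x : H) :
    summandIncl j x i = if i = j then x else 0 := by
  simp [summandIncl]

/-- The entries of an operator on `H ⊕ H`. -/
noncomputable def opEntry (i j : Fin 2) (X : Dbl H →L[ℂ] Dbl H) : H →L[ℂ] H :=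
  PiLp.proj 2 (fun _ : Fin 2 => H) i ∘L X ∘L summandIncl j

theorem continuous_opEntry (i j : Fin 2) : Continuous (opEntry (H := H) i j) := by
  unfold opEntry
  fun_prop

theorem opEntry_opMatrix (M : Matrix (Fin 2) (Fin 2) (H →L[ℂ] H)) (i j : Fin 2) :
    opEntry i j (opMatrix M) = M i j := by
  ext x
  fin_cases j <;> simp [opEntry, opMatrix_apply, Fin.sum_univ_two, summandIncl_apply]

theorem opMatrix_opEntry (X : Dbl H →L[ℂ] Dbl H) :
    opMatrix (Matrix.of fun i j => opEntry i j X) = X := by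
  ext x i
  have hx : x = summandIncl 0 (x 0) + summandIncl 1 (x 1) := by
    ext k
    fin_cases k <;> simp [summandIncl_apply]
  conv_rhs => rw [hx, map_add]
  simp [opMatrix_apply, Fin.sum_univ_two, opEntry]

theorem opMatrix_injective : Function.Injective (opMatrix (H := H)) := by
  intro M N h
  ext1 i j
  rw [← opEntry_opMatrix M, h, opEntry_opMatrix]

theorem projFst_mul_self : projFst H * projFst H = projFst H := by
  rw [projFst, ← opMatrix_mul]
  congr 1
  ext1 i j
  fin_cases i <;> fin_cases j <;> simp [Matrix.mul_apply, Fin.sum_univ_two]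

theorem eq_zero_of_commute_projFst {M : Matrix (Fin 2) (Fin 2) (H →L[ℂ] H)}
    (h : Commute (projFst H) (opMatrix M)) : M 0 1 = 0 ∧ M 1 0 = 0 := by
  rw [Commute, SemiconjBy, projFst, ← opMatrix_mul, ← opMatrix_mul] at h
  have h1 := opMatrix_injective h
  have h2 := congrFun (congrFun h1 0) 1
  have h3 := congrFun (congrFun h1 1) 0
  simp [Matrix.mul_apply, Fin.sum_univ_two] at h2 h3
  exact ⟨h2, h3.symm⟩

variable [CompleteSpace H]

theorem opMatrix_star (M : Matrix (Fin 2) (Fin 2) (H →L[ℂ] H)) :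
    opMatrix (star M) = star (opMatrix M) := by
  rw [ContinuousLinearMap.star_eq_adjoint, ContinuousLinearMap.eq_adjoint_iff]
  intro x y
  simp only [PiLp.inner_apply, Fin.sum_univ_two, opMatrix_apply, inner_add_left, inner_add_right,
    Matrix.star_apply, ContinuousLinearMap.star_eq_adjoint, ContinuousLinearMap.adjoint_inner_left]
  ring

theorem mem_M2_iff {A : StarSubalgebra ℂ (H →L[ℂ] H)} {X : Dbl H →L[ℂ] Dbl H} :
    X ∈ M2 A ↔ ∀ i j, opEntry i j X ∈ A := by
  constructor
  · rintro ⟨M, hM, rfl⟩ i j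
    rw [opEntry_opMatrix]
    exact hM i j
  · exact fun h => ⟨_, h, (opMatrix_opEntry X).symm⟩

/-- `M₂(A)` as a star subalgebra. -/
def matSubalgebra (A : StarSubalgebra ℂ (H →L[ℂ] H)) : StarSubalgebra ℂ (Dbl H →L[ℂ] Dbl H) where
  carrier := M2 A
  mul_mem' := by
    rintro _ _ ⟨M, hM, rfl⟩ ⟨N, hN, rfl⟩
    refine ⟨M * N, fun i j => ?_, (opMatrix_mul M N).symm⟩
    rw [Matrix.mul_apply]
    exact sum_mem fun k _ => mul_mem (hM i k) (hN k j)
  add_mem' := by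
    rintro _ _ ⟨M, hM, rfl⟩ ⟨N, hN, rfl⟩
    exact ⟨M + N, fun i j => add_mem (hM i j) (hN i j), (opMatrix_add M N).symm⟩
  algebraMap_mem' c := by
    refine ⟨c • 1, fun i j => ?_, ?_⟩
    · rw [Matrix.smul_apply, Matrix.one_apply]
      split_ifs
      · exact A.smul_mem (one_mem A) c
      · exact A.smul_mem (zero_mem A) c
    · rw [opMatrix_smul, opMatrix_one, Algebra.algebraMap_eq_smul_one]
  star_mem' := by
    rintro _ ⟨M, hM, rfl⟩
    exact ⟨star M, fun i j => star_mem (hM j i), (opMatrix_star M).symm⟩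

instance isClosed_matSubalgebra (A : StarSubalgebra ℂ (H →L[ℂ] H))
    [hA : IsClosed (A : Set (H →L[ℂ] H))] :
    IsClosed (matSubalgebra A : Set (Dbl H →L[ℂ] Dbl H)) := by
  have : (matSubalgebra A : Set (Dbl H →L[ℂ] Dbl H)) =
      ⋂ i, ⋂ j, opEntry i j ⁻¹' (A : Set (H →L[ℂ] H)) := by
    ext X
    simp only [mem_iInter, mem_preimage, SetLike.mem_coe]
    exact mem_M2_iff
  rw [this]
  exact isClosed_iInter fun i => isClosed_iInter fun j => hA.preimage (continuous_opEntry i j)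

theorem projFst_mem_M2 (A : StarSubalgebra ℂ (H →L[ℂ] H)) : projFst H ∈ M2 A := by
  refine ⟨_, fun i j => ?_, rfl⟩
  fin_cases i <;> fin_cases j <;> simp [one_mem, zero_mem]

theorem isSelfAdjoint_projFst : IsSelfAdjoint (projFst H) := by
  rw [IsSelfAdjoint, projFst, ← opMatrix_star]
  congr 1
  ext1 i j
  fin_cases i <;> fin_cases j <;> simp [Matrix.star_apply]

/-- The inclusion of `A ⊕ A` into `M₂(A)` as block diagonal operators. -/
noncomputable def diagHom (A : StarSubalgebra ℂ (H →L[ℂ] H)) : A × A →⋆ₐ[ℂ] matSubalgebra A where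
  toFun y := ⟨opMatrix !![(y.1 : H →L[ℂ] H), 0; 0, (y.2 : H →L[ℂ] H)], _, fun i j => by
    fin_cases i <;> fin_cases j <;> simp [zero_mem], rfl⟩
  map_one' := Subtype.ext <| by
    change opMatrix _ = 1
    rw [← opMatrix_one]
    congr 1
    ext1 i j
    fin_cases i <;> fin_cases j <;> simp
  map_zero' := Subtype.ext <| by
    change opMatrix _ = 0
    ext x i
    fin_cases i <;> simp [opMatrix_apply, Fin.sum_univ_two]
  map_mul' x y := Subtype.ext <| by
    change opMatrix _ = opMatrix _ * opMatrix _
    rw [← opMatrix_mul]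
    congr 1
    ext1 i j
    fin_cases i <;> fin_cases j <;> simp [Matrix.mul_apply, Fin.sum_univ_two]
  map_add' x y := Subtype.ext <| by
    change opMatrix _ = opMatrix _ + opMatrix _
    rw [← opMatrix_add]
    congr 1
    ext1 i j
    fin_cases i <;> fin_cases j <;> simp
  commutes' c := Subtype.ext <| by
    change opMatrix _ = algebraMap ℂ (Dbl H →L[ℂ] Dbl H) c
    have : algebraMap ℂ (Dbl H →L[ℂ] Dbl H) c = c • opMatrix 1 := by
      rw [opMatrix_one, Algebra.algebraMap_eq_smul_one]
    rw [this, ← opMatrix_smul]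
    congr 1
    ext1 i j
    fin_cases i <;> fin_cases j <;> simp [Algebra.algebraMap_eq_smul_one]
  map_star' y := Subtype.ext <| by
    change opMatrix _ = star (opMatrix _)
    rw [← opMatrix_star]
    congr 1
    ext1 i j
    fin_cases i <;> fin_cases j <;> simp [Matrix.star_apply]

theorem coe_diagHom (A : StarSubalgebra ℂ (H →L[ℂ] H)) (y : A × A) :
    (diagHom A y : Dbl H →L[ℂ] Dbl H) = opMatrix !![(y.1 : H →L[ℂ] H), 0; 0, (y.2 : H →L[ℂ] H)] :=
  rfl

theorem isBlockHom_diagHom (A : StarSubalgebra ℂ (H →L[ℂ] H))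
    [hA : IsClosed (A : Set (H →L[ℂ] H))] :
    IsBlockHom (diagHom A) (⟨projFst H, projFst_mem_M2 A⟩ : matSubalgebra A) where
  injective x y h := by
    have h1 := opMatrix_injective (congrArg Subtype.val h)
    have h2 := congrFun (congrFun h1 0) 0
    have h3 := congrFun (congrFun h1 1) 1
    simp at h2 h3
    exact Prod.ext h2 h3
  commute y := by
    refine Subtype.ext ?_
    change projFst H * opMatrix _ = opMatrix _ * projFst H
    rw [projFst, ← opMatrix_mul, ← opMatrix_mul]
    congr 1
    ext1 i j
    fin_cases i <;> fin_cases j <;> simp [Matrix.mul_apply, Fin.sum_univ_two]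
  surjective := by
    rintro ⟨_, M, hM, rfl⟩ h
    obtain ⟨h1, h2⟩ := eq_zero_of_commute_projFst (congrArg Subtype.val h)
    refine ⟨(⟨M 0 0, hM 0 0⟩, ⟨M 1 1, hM 1 1⟩), Subtype.ext ?_⟩
    rw [coe_diagHom]
    congr 1
    ext1 i j
    fin_cases i <;> fin_cases j <;> simp [h1, h2]
  idem := Subtype.ext projFst_mul_self
  isSelfAdjoint := Subtype.ext (isSelfAdjoint_projFst (H := H))

end OpMatrix

/-! ### Real rank zero and identity components of direct sums -/

section Products

theorem HasRealRankZero.prod {B C : Type*} [CStarAlgebra B] [CStarAlgebra C]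
    (hB : HasRealRankZero B) (hC : HasRealRankZero C) : HasRealRankZero (B × C) := by
  intro a ha ε hε
  obtain ⟨b, hb, hbf, hab⟩ := hB a.1 (congrArg Prod.fst ha) ε hε
  obtain ⟨c, hc, hcf, hac⟩ := hC a.2 (congrArg Prod.snd ha) ε hε
  refine ⟨(b, c), Prod.ext hb hc, ?_, ?_⟩
  · rw [Prod.spectrum_eq]
    exact hbf.union hcf
  · rw [Prod.norm_def]
    exact max_lt hab hac

variable {B C : Type*} [CStarAlgebra B] [CStarAlgebra C]

theorem prod_mem_idComponent {b : B} {c : C} (hb : b ∈ idComponent B) (hc : c ∈ idComponent C) :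
    (b, c) ∈ idComponent (B × C) := by
  obtain ⟨g, hg, rfl⟩ := hb
  obtain ⟨k, hk, rfl⟩ := hc
  refine ⟨Homeomorph.prodUnits.symm (g, k), ?_, rfl⟩
  have h := (isPreconnected_connectedComponent (x := (1 : Bˣ))).prod
    (isPreconnected_connectedComponent (x := (1 : Cˣ)))
  have h' := h.image Homeomorph.prodUnits.symm Homeomorph.prodUnits.symm.continuous.continuousOn
  exact h'.subset_connectedComponent
    ⟨(1, 1), ⟨mem_connectedComponent, mem_connectedComponent⟩, rfl⟩ ⟨(g, k), ⟨hg, hk⟩, rfl⟩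

theorem fst_mem_idComponent {y : B × C} (hy : y ∈ idComponent (B × C)) : y.1 ∈ idComponent B := by
  obtain ⟨g, hg, rfl⟩ := hy
  refine ⟨(Homeomorph.prodUnits g).1, ?_, rfl⟩
  exact (continuous_fst.comp Homeomorph.prodUnits.continuous).image_connectedComponent_subset
    (1 : (B × C)ˣ) ⟨g, hg, rfl⟩

theorem snd_mem_idComponent {y : B × C} (hy : y ∈ idComponent (B × C)) : y.2 ∈ idComponent C := by
  obtain ⟨g, hg, rfl⟩ := hy
  refine ⟨(Homeomorph.prodUnits g).2, ?_, rfl⟩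
  exact (continuous_snd.comp Homeomorph.prodUnits.continuous).image_connectedComponent_subset
    (1 : (B × C)ˣ) ⟨g, hg, rfl⟩

end Products

/-! ### Transfer from `M₂(A)` to operators -/

section Concrete
variable {H : Type u} [NormedAddCommGroup H] [InnerProductSpace ℂ H] [CompleteSpace H]
  {A : StarSubalgebra ℂ (H →L[ℂ] H)}

theorem RealRankZero.hasRealRankZero [hA : IsClosed (A : Set (H →L[ℂ] H))] (h : RealRankZero A) :
    HasRealRankZero A := fun a ha ε hε => h a ha ε hε

theorem mem_GL0_iff [hA : IsClosed (A : Set (H →L[ℂ] H))] {a : H →L[ℂ] H} :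
    a ∈ GL0 A ↔ ∃ x ∈ idComponent A, (x : H →L[ℂ] H) = a := by
  constructor
  · rintro ⟨g, hg, rfl⟩
    exact ⟨g, ⟨g, hg, rfl⟩, rfl⟩
  · rintro ⟨_, ⟨g, hg, rfl⟩, rfl⟩
    exact ⟨g, hg, rfl⟩

theorem mem_GL0Sum_iff [hA : IsClosed (A : Set (H →L[ℂ] H))] {X : Dbl H →L[ℂ] Dbl H} :
    X ∈ GL0Sum A ↔ ∃ y ∈ idComponent (A × A), (diagHom A y : Dbl H →L[ℂ] Dbl H) = X := by
  constructor
  · rintro ⟨a, ha, b, hb, rfl⟩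
    obtain ⟨x, hx, rfl⟩ := mem_GL0_iff.1 ha
    obtain ⟨y, hy, rfl⟩ := mem_GL0_iff.1 hb
    exact ⟨(x, y), prod_mem_idComponent hx hy, rfl⟩
  · rintro ⟨y, hy, rfl⟩
    exact ⟨_, mem_GL0_iff.2 ⟨y.1, fst_mem_idComponent hy, rfl⟩, _,
      mem_GL0_iff.2 ⟨y.2, snd_mem_idComponent hy, rfl⟩, rfl⟩

theorem cfc_matSubalgebra [hA : IsClosed (A : Set (H →L[ℂ] H))] {T : matSubalgebra A}
    [IsStarNormal T] {f : ℂ → ℂ} (hf : ContinuousOn f (spectrum ℂ T)) :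
    ((cfc f T : matSubalgebra A) : Dbl H →L[ℂ] Dbl H) = cfc f (T : Dbl H →L[ℂ] Dbl H) :=
  StarAlgHomClass.map_cfc (S := ℂ) (matSubalgebra A).subtype f T hf continuous_subtype_val
    inferInstance ⟨congrArg Subtype.val (star_comm_self' T)⟩

/-- `exists_modified_unitary_part` for operators. -/
theorem exists_modified_unitary_part_of_mem_M2 : ∃ δ K : ℝ, 0 < δ ∧ 0 < K ∧
    ∀ {H : Type u} [NormedAddCommGroup H] [InnerProductSpace ℂ H] [CompleteSpace H]
      {A : StarSubalgebra ℂ (H →L[ℂ] H)} {T : Dbl H →L[ℂ] Dbl H} {w : ℂ},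
      IsClosed (A : Set (H →L[ℂ] H)) → RealRankZero A → T ∈ M2 A → IsStarNormal T →
      ‖w‖ = 1 → w ∈ Complex.slitPlane →
      (∀ z ∈ spectrum ℂ T, ‖z‖ < 3 → ∃ x : ℝ, z = w * x) →
      ‖projFst H * T - T * projFst H‖ < δ →
      diagP (T + (Complex.I * w) • 1) ∈ GL0Sum A → diagP (T - (Complex.I * w) • 1) ∈ GL0Sum A →
      ∃ U ∈ unitary (Dbl H →L[ℂ] Dbl H), U ∈ M2 A ∧ diagP U ∈ GL0Sum A ∧
        ‖projFst H * U - U * projFst H‖ ≤ K * ‖projFst H * T - T * projFst H‖ ∧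
        (∀ f : ℂ → ℂ, Continuous f → (∀ z, ‖z‖ < 1 / 2 → f z = 0) → Commute U (cfc f T)) ∧
        (∀ f : ℂ → ℂ, Continuous f → (∀ z, 2 ≤ ‖z‖ → f z = 0) →
          U * (U * cfc f T) = w ^ 2 • cfc f T) ∧
        ∀ f : ℂ → ℂ, Continuous f → (∀ z, ‖z‖ < 1 / 2 → f z = 0) → (∀ z, 2 ≤ ‖z‖ → f z = 0) →
          U * cfc (fun z => ‖z‖ * f z) T = cfc (fun z => z * f z) T := by
  obtain ⟨δ, K, hδ, hK, key⟩ := exists_modified_unitary_part.{u}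
  refine ⟨δ, K, hδ, hK, ?_⟩
  intro H _ _ _ A T w hA hr hT hn hw hws hs hd h1 h2
  let T' : matSubalgebra A := ⟨T, hT⟩
  have hn' : IsStarNormal T' := ⟨Subtype.ext hn.star_comm_self⟩
  have hs' : spectrum ℂ T' = spectrum ℂ T := StarSubalgebra.spectrum_eq (matSubalgebra A)
  obtain ⟨y, hy, hy'⟩ := mem_GL0Sum_iff.1 h1
  obtain ⟨x, hx, hx'⟩ := mem_GL0Sum_iff.1 h2
  obtain ⟨U, hU, ⟨u, hu, hu'⟩, hPU, ha, hb, hc⟩ := key (T := T') (isBlockHom_diagHom A)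
    (hr.hasRealRankZero.prod hr.hasRealRankZero) hw hws (fun z hz => hs z (hs' ▸ hz)) hd
    ⟨y, hy, Subtype.ext hy'⟩ ⟨x, hx, Subtype.ext hx'⟩
  have hcoe : ∀ f : ℂ → ℂ, Continuous f →
      ((cfc f T' : matSubalgebra A) : Dbl H →L[ℂ] Dbl H) = cfc f T := fun f hf =>
    cfc_matSubalgebra hf.continuousOn
  refine ⟨U, map_mem_unitary (matSubalgebra A).subtype hU, U.2,
    mem_GL0Sum_iff.2 ⟨u, hu, congrArg Subtype.val hu'⟩, hPU, fun f hf h0 => ?_, fun f hf h0 => ?_,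
    fun f hf h0 h0' => ?_⟩
  · have := congrArg Subtype.val (ha f hf h0)
    rw [← hcoe f hf]
    exact this
  · have := congrArg Subtype.val (hb f hf h0)
    rw [← hcoe f hf]
    exact this
  · have := congrArg Subtype.val (hc (fun z => ‖z‖ * f z) (by fun_prop)
      (fun z hz => by simp [h0 z hz]) (fun z hz => by simp [h0' z hz]))
    rw [← hcoe _ (by fun_prop), ← hcoe _ (by fun_prop)]
    refine Eq.trans this ?_
    congr 2
    ext z
    rcases eq_or_ne z 0 with rfl | hz
    · simp
    · have : (‖z‖ : ℂ) ≠ 0 := by exact_mod_cast norm_ne_zero_iff.2 hz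
      field_simp

end Concrete
end NormalDist

namespace NormalDist
open Set Filter Topology

/-! ### Spectral subspaces of discs -/

section SpectralSubspace
variable {K : Type u} [NormedAddCommGroup K] [InnerProductSpace ℂ K] [CompleteSpace K]
  {T : K →L[ℂ] K} {Ω : Set ℂ}

/-- A continuous function on `ℂ` which is `1` for `|z| ≤ a` and `0` for `|z| ≥ b`. -/
noncomputable def discBump (a b : ℝ) (z : ℂ) : ℂ := ((max 0 (min 1 ((b - ‖z‖) / (b - a))) : ℝ) : ℂ)

@[fun_prop]
theorem continuous_discBump (a b : ℝ) : Continuous (discBump a b) := by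
  unfold discBump
  fun_prop

theorem discBump_of_le {a b : ℝ} (hab : a < b) {z : ℂ} (hz : ‖z‖ ≤ a) : discBump a b z = 1 := by
  have : 1 ≤ (b - ‖z‖) / (b - a) := by rw [le_div_iff₀ (by linarith)]; linarith
  rw [discBump, min_eq_left this, max_eq_right zero_le_one, Complex.ofReal_one]

theorem discBump_of_ge {a b : ℝ} (hab : a < b) {z : ℂ} (hz : b ≤ ‖z‖) : discBump a b z = 0 := by
  have : (b - ‖z‖) / (b - a) ≤ 0 := div_nonpos_of_nonpos_of_nonneg (by linarith) (by linarith)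
  rw [discBump, max_eq_left ((min_le_right _ _).trans this), Complex.ofReal_zero]

theorem cfc_apply_mem_spectralSubspace {f : ℂ → ℂ} (hf : Continuous f) (h0 : ∀ z, z ∉ Ω → f z = 0)
    (x : K) : cfc f T x ∈ spectralSubspace T Ω :=
  Submodule.le_topologicalClosure _ (Submodule.subset_span ⟨f, hf, h0, x, rfl⟩)

theorem mem_of_mem_spectralSubspace {M : Submodule ℂ K} (hM : IsClosed (M : Set K))
    (h : ∀ f : ℂ → ℂ, Continuous f → (∀ z, z ∉ Ω → f z = 0) → ∀ x, cfc f T x ∈ M) {y : K}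
    (hy : y ∈ spectralSubspace T Ω) : y ∈ M := by
  refine Submodule.topologicalClosure_minimal _ (Submodule.span_le.2 ?_) hM hy
  rintro _ ⟨f, hf, h0, x, rfl⟩
  exact h f hf h0 x

theorem spectralSubspace_mono {Ω' : Set ℂ} (h : Ω ⊆ Ω') :
    spectralSubspace T Ω ≤ spectralSubspace T Ω' := fun _ hy =>
  mem_of_mem_spectralSubspace (Submodule.isClosed_topologicalClosure _)
    (fun _ hf h0 x => cfc_apply_mem_spectralSubspace hf (fun z hz => h0 z fun hz' => hz (h hz')) x) hy

theorem eq_on_spectralSubspace {X Y : K →L[ℂ] K}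
    (h : ∀ f : ℂ → ℂ, Continuous f → (∀ z, z ∉ Ω → f z = 0) → X * cfc f T = Y * cfc f T) {y : K}
    (hy : y ∈ spectralSubspace T Ω) : X y = Y y := by
  have h1 : y ∈ (X - Y).ker := by
    refine mem_of_mem_spectralSubspace (X - Y).isClosed_ker (fun f hf h0 x => ?_) hy
    have := congrArg (fun A : K →L[ℂ] K => A x) (h f hf h0)
    simpa [sub_eq_zero] using this
  simpa [sub_eq_zero] using h1

theorem range_discProj (r : ℝ) : (discProj T r).range = spectralSubspace T (Metric.ball 0 r) :=
  Submodule.range_starProjection _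

variable [IsStarNormal T]

/-- An operator which commutes with the functions of `T` that vanish near `0` preserves the
spectral subspaces of larger discs. -/
theorem apply_mem_spectralSubspace_of_commute {X : K →L[ℂ] K}
    (hX : ∀ f : ℂ → ℂ, Continuous f → (∀ z, ‖z‖ < 1 / 2 → f z = 0) → Commute X (cfc f T))
    {r : ℝ} (hr : 1 ≤ r) {y : K} (hy : y ∈ spectralSubspace T (Metric.ball 0 r)) :
    X y ∈ spectralSubspace T (Metric.ball 0 r) := by
  refine mem_of_mem_spectralSubspace (M := (spectralSubspace T (Metric.ball 0 r)).comap
    (X : K →ₗ[ℂ] K)) ?_ (fun f hf h0 x => ?_) hy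
  · exact (Submodule.isClosed_topologicalClosure _).preimage X.continuous
  change X (cfc f T x) ∈ spectralSubspace T _
  obtain ⟨k, hk⟩ : ∃ k, k = discBump (1 / 2) (3 / 4) := ⟨_, rfl⟩
  obtain ⟨l, hl⟩ : ∃ l, l = discBump (3 / 4) 1 := ⟨_, rfl⟩
  have ck : Continuous k := hk ▸ continuous_discBump _ _
  have cl : Continuous l := hl ▸ continuous_discBump _ _
  -- The part of `f` near `0` is guarded by `l(T)`, which commutes with `X` because `1 - l` vanishes
  -- near `0` and whose support lies in the unit disc, hence in the disc of radius `r`. The rest of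
  -- `f` commutes with `X` by hypothesis.
  have e1 : cfc f T = cfc l T * cfc (fun z => k z * f z) T + cfc (fun z => (1 - k z) * f z) T := by
    rw [cfc_mul_of_eqOn (h := fun z => k z * f z) cl.continuousOn (by fun_prop) fun z _ => ?_,
      ← cfc_add (a := T) (fun z => k z * f z) (fun z => (1 - k z) * f z)]
    · congr 1
      ext z
      ring
    · rcases le_total ‖z‖ (3 / 4) with h | h
      · rw [hl, discBump_of_le (by norm_num) h, one_mul]
      · rw [hk, discBump_of_ge (by norm_num) h, zero_mul, mul_zero]
  have hlX : Commute X (cfc l T) := by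
    have h1 := hX (fun z => 1 - l z) (by fun_prop) fun z hz => by
      rw [hl, discBump_of_le (by norm_num) (by linarith), sub_self]
    rw [cfc_sub (fun _ => 1) l T, cfc_const_one ℂ T] at h1
    have := (Commute.one_right X).sub_right h1
    rwa [sub_sub_cancel] at this
  have hkX := hX (fun z => (1 - k z) * f z) (by fun_prop) fun z hz => by
    rw [hk, discBump_of_le (by norm_num) hz.le, sub_self, zero_mul]
  have e2 : X (cfc f T x) = cfc l T (X (cfc (fun z => k z * f z) T x)) +
      cfc (fun z => (1 - k z) * f z) T (X x) := by
    have h1 : X * cfc f T = cfc l T * (X * cfc (fun z => k z * f z) T) +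
        cfc (fun z => (1 - k z) * f z) T * X := by
      rw [e1, mul_add, ← mul_assoc, hlX.eq, hkX.eq, mul_assoc]
    exact congrArg (fun A : K →L[ℂ] K => A x) h1
  rw [e2]
  refine add_mem (cfc_apply_mem_spectralSubspace cl (fun z hz => ?_) _)
    (cfc_apply_mem_spectralSubspace (by fun_prop) (fun z hz => ?_) _)
  · rw [mem_ball_zero_iff, not_lt] at hz
    rw [hl, discBump_of_ge (by norm_num) (by linarith)]
  · rw [h0 z hz, mul_zero]

theorem discProj_mul_mul_discProj {X : K →L[ℂ] K}
    (hX : ∀ f : ℂ → ℂ, Continuous f → (∀ z, ‖z‖ < 1 / 2 → f z = 0) → Commute X (cfc f T))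
    {r : ℝ} (hr : 1 ≤ r) : discProj T r * (X * discProj T r) = X * discProj T r := by
  ext x
  exact Submodule.starProjection_eq_self_iff.2
    (apply_mem_spectralSubspace_of_commute hX hr (Submodule.starProjection_apply_mem _ x))

/-- The hypothesis passes to the adjoint, so the spectral subspace is invariant under both `X` and
`X⋆`, hence reducing. -/
theorem mul_discProj_eq_discProj_mul {X : K →L[ℂ] K}
    (hX : ∀ f : ℂ → ℂ, Continuous f → (∀ z, ‖z‖ < 1 / 2 → f z = 0) → Commute X (cfc f T))
    {r : ℝ} (hr : 1 ≤ r) : X * discProj T r = discProj T r * X := by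
  have hp : star (discProj T r) = discProj T r :=
    (isSelfAdjoint_starProjection (spectralSubspace T (Metric.ball 0 r))).star_eq
  have hX' : ∀ f : ℂ → ℂ, Continuous f → (∀ z, ‖z‖ < 1 / 2 → f z = 0) →
      Commute (star X) (cfc f T) := by
    intro f hf h0
    have h1 := (hX (fun z => star (f z)) (by fun_prop) fun z hz => by simp [h0 z hz]).star_star
    rwa [← cfc_star, ← cfc_congr fun z _ => (star_star (f z)).symm] at h1
  have h1 := discProj_mul_mul_discProj hX hr
  have h2 := congrArg star (discProj_mul_mul_discProj hX' hr)
  simp only [star_mul, star_star, hp] at h2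
  rw [← h1, ← h2, mul_assoc]

/-- As `f` vanishes near `0`, it is `|z|` times a continuous `q`. Then both sides equal `T q(T)`,
whichever unitary polar part is chosen. -/
theorem polarPart_mul_cfc {U V : K →L[ℂ] K}
    (hU : ∀ f : ℂ → ℂ, Continuous f → (∀ z, ‖z‖ < 1 / 2 → f z = 0) → (∀ z, 2 ≤ ‖z‖ → f z = 0) →
      U * cfc (fun z => ‖z‖ * f z) T = cfc (fun z => z * f z) T)
    (hV : IsUnitaryPolarPart T V) {f : ℂ → ℂ} (hf : Continuous f)
    (h0 : ∀ z, ‖z‖ < 1 / 2 → f z = 0) (h0' : ∀ z, 2 ≤ ‖z‖ → f z = 0) :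
    U * cfc f T = V * cfc f T := by
  obtain ⟨q, hq⟩ : ∃ q : ℂ → ℂ, q = fun z => ((max ‖z‖ (1 / 2))⁻¹ : ℝ) * f z := ⟨_, rfl⟩
  have hqc : Continuous q := by
    rw [hq]
    refine (Complex.continuous_ofReal.comp (Continuous.inv₀ (by fun_prop) fun z => ?_)).mul hf
    have : (1 / 2 : ℝ) ≤ max ‖z‖ (1 / 2) := le_max_right _ _
    linarith
  have hfq : f = fun z => ‖z‖ * q z := by
    ext z
    rw [hq]
    rcases lt_or_ge ‖z‖ (1 / 2) with h | h
    · simp [h0 z h]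
    · have : (‖z‖ : ℂ) ≠ 0 := by exact_mod_cast (by linarith : ‖z‖ ≠ 0)
      simp only [max_eq_left h]
      push_cast
      field_simp
  have h1 := hU q hqc (fun z hz => by simp [hq, h0 z hz]) (fun z hz => by simp [hq, h0' z hz])
  have h2 : CFC.abs T = cfc (fun z : ℂ => (‖z‖ : ℂ)) T := by
    rw [CFC.abs_eq_cfcₙ_coe_norm ℂ T, cfcₙ_eq_cfc (hf0 := by rw [norm_zero]; exact RCLike.ofReal_zero)]
    rfl
  have h3 : cfc (fun z : ℂ => ‖z‖ * q z) T = CFC.abs T * cfc q T := by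
    rw [h2]
    exact (cfc_mul_of_eqOn (by fun_prop) (by fun_prop) fun z _ => rfl).symm
  have h4 : cfc (fun z => z * q z) T = T * cfc q T := by
    conv_rhs => enter [1]; rw [← cfc_id' ℂ T]
    exact (cfc_mul_of_eqOn (by fun_prop) (by fun_prop) fun z _ => rfl).symm
  rw [hfq, h1, h3, h4, ← mul_assoc, ← hV.2]

theorem mul_discProj_sub_eq {U V : K →L[ℂ] K}
    (h : ∀ f : ℂ → ℂ, Continuous f → (∀ z, ‖z‖ < 1 / 2 → f z = 0) → (∀ z, 2 ≤ ‖z‖ → f z = 0) →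
      U * cfc f T = V * cfc f T) :
    U * (discProj T 2 - discProj T 1) = V * (discProj T 2 - discProj T 1) := by
  ext x
  obtain ⟨n, hn⟩ : ∃ n, n = discProj T 2 x - discProj T 1 x := ⟨_, rfl⟩
  change U (discProj T 2 x - discProj T 1 x) = V (discProj T 2 x - discProj T 1 x)
  rw [← hn]
  have hle : spectralSubspace T (Metric.ball 0 1) ≤ spectralSubspace T (Metric.ball 0 2) :=
    spectralSubspace_mono (Metric.ball_subset_ball (by norm_num))
  have hn2 : n ∈ spectralSubspace T (Metric.ball 0 2) := by
    rw [hn]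
    exact sub_mem (Submodule.starProjection_apply_mem _ x) (hle (Submodule.starProjection_apply_mem _ x))
  have hn1 : ∀ s ∈ spectralSubspace T (Metric.ball 0 1), inner ℂ s n = 0 := by
    intro s hs
    have e : n = (x - discProj T 1 x) - (x - discProj T 2 x) := by rw [hn]; abel
    rw [e, inner_sub_right]
    have h1 : inner ℂ s (x - discProj T 1 x) = 0 :=
      (Submodule.mem_orthogonal _ _).1 (Submodule.sub_starProjection_mem_orthogonal x) s hs
    have h2 : inner ℂ s (x - discProj T 2 x) = 0 :=
      (Submodule.mem_orthogonal _ _).1 (Submodule.sub_starProjection_mem_orthogonal x) s (hle hs)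
    rw [h1, h2, sub_zero]
  obtain ⟨l, hl⟩ : ∃ l, l = discBump (1 / 2) 1 := ⟨_, rfl⟩
  have cl : Continuous l := hl ▸ continuous_discBump _ _
  -- The vector `n` is orthogonal to the subspace of the unit disc, which contains the range of the
  -- adjoint of `l(T)`. Therefore `1 - l`, which vanishes for `|z| ≤ 1/2`, can be inserted in front
  -- of `n`.
  have hln : cfc l T n = 0 := by
    refine ext_inner_left ℂ fun y => ?_
    rw [inner_zero_right, ← ContinuousLinearMap.adjoint_inner_left,
      ← ContinuousLinearMap.star_eq_adjoint, ← cfc_star]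
    refine hn1 _ (cfc_apply_mem_spectralSubspace (by fun_prop) (fun z hz => ?_) y)
    rw [mem_ball_zero_iff, not_lt] at hz
    rw [hl, discBump_of_ge (by norm_num) hz, star_zero]
  have hn' : n = cfc (fun z => 1 - l z) T n := by
    rw [cfc_sub (fun _ => 1) l T, cfc_const_one ℂ T]
    simp [hln]
  have key : (U * cfc (fun z => 1 - l z) T) n = (V * cfc (fun z => 1 - l z) T) n := by
    refine eq_on_spectralSubspace (fun f hf h0 => ?_) hn2
    have h1 : cfc (fun z => 1 - l z) T * cfc f T = cfc (fun z => (1 - l z) * f z) T :=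
      cfc_mul_of_eqOn (by fun_prop) (by fun_prop) fun z _ => rfl
    rw [mul_assoc, mul_assoc, h1]
    refine h _ (by fun_prop) (fun z hz => ?_) fun z hz => ?_
    · rw [hl, discBump_of_le (by norm_num) hz.le, sub_self, zero_mul]
    · rw [h0 z (by rw [mem_ball_zero_iff, not_lt]; exact hz), mul_zero]
  rw [hn']
  exact key

end SpectralSubspace

/-- The inverse of `z - u` is `(z + u)/(z² - w²)`. -/
theorem spectrum_subset_of_sq_eq {B : Type*} [Ring B] [Algebra ℂ B] {u : B} {w : ℂ}
    (hu : u * u = w ^ 2 • 1) : spectrum ℂ u ⊆ {w, -w} := by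
  intro z hz
  by_contra hne
  have h0 : z ^ 2 - w ^ 2 ≠ 0 := by
    intro h
    rcases sq_eq_sq_iff_eq_or_eq_neg.1 (sub_eq_zero.1 h) with h | h <;> simp [h] at hne
  refine hz (isUnit_iff_exists.2 ⟨(z ^ 2 - w ^ 2)⁻¹ • (z • 1 + u), ?_, ?_⟩)
  · rw [Algebra.algebraMap_eq_smul_one, mul_smul_comm, sub_mul, mul_add, mul_add, hu]
    simp only [smul_mul_assoc, one_mul, mul_smul_comm, mul_one]
    rw [smul_smul, show (z * z) • (1 : B) + z • u - (z • u + w ^ 2 • 1) = (z ^ 2 - w ^ 2) • 1 by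
      rw [sub_smul, sq z]; abel, smul_smul, inv_mul_cancel₀ h0, one_smul]
  · rw [Algebra.algebraMap_eq_smul_one, smul_mul_assoc, add_mul, mul_sub, mul_sub, hu]
    simp only [smul_mul_assoc, one_mul, mul_smul_comm, mul_one]
    rw [smul_smul, show (z * z) • (1 : B) - z • u + (z • u - w ^ 2 • 1) = (z ^ 2 - w ^ 2) • 1 by
      rw [sub_smul, sq z]; abel, smul_smul, inv_mul_cancel₀ h0, one_smul]

/-- The range `[0, π)` keeps `w` off the negative real axis, so a segment of nonzero scalars joins
`1` to `w`. -/
theorem exp_mem_slitPlane {θ : ℝ} (hθ : θ ∈ Ico 0 Real.pi) :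
    Complex.exp (θ * Complex.I) ∈ Complex.slitPlane := by
  rw [Complex.mem_slitPlane_iff]
  rcases hθ.1.eq_or_lt with h | h
  · left; simp [← h]
  · right
    rw [Complex.exp_ofReal_mul_I_im]
    exact (Real.sin_pos_of_pos_of_lt_pi h hθ.2).ne'

end NormalDist

theorem theorem3p2 :
    ∃ δ C : ℝ, 0 < δ ∧ 0 < C ∧
      ∀ (H : Type*) [NormedAddCommGroup H] [InnerProductSpace ℂ H] [CompleteSpace H]
        (A : StarSubalgebra ℂ (H →L[ℂ] H)),
        IsClosed (A : Set (H →L[ℂ] H)) → NormalDist.RealRankZero A →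
      ∀ (T : NormalDist.Dbl H →L[ℂ] NormalDist.Dbl H),
        T ∈ NormalDist.M2 A → IsStarNormal T →
      ∀ θ : ℝ, θ ∈ Set.Ico 0 Real.pi →
        spectrum ℂ T ∩ Metric.ball 0 3 ⊆ NormalDist.line θ →
        ‖NormalDist.projFst H * T - T * NormalDist.projFst H‖ < δ →
        NormalDist.diagP (T + (Complex.I * Complex.exp (θ * Complex.I)) • 1)
          ∈ NormalDist.GL0Sum A →
        NormalDist.diagP (T - (Complex.I * Complex.exp (θ * Complex.I)) • 1)
          ∈ NormalDist.GL0Sum A →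
      ∃ U : NormalDist.Dbl H →L[ℂ] NormalDist.Dbl H,
        U ∈ NormalDist.M2 A ∧
        U ∈ unitary (NormalDist.Dbl H →L[ℂ] NormalDist.Dbl H) ∧
        NormalDist.diagP U ∈ NormalDist.GL0Sum A ∧
        (∀ r : ℝ, 1 ≤ r → r ≤ 2 →
          U * NormalDist.discProj T r = NormalDist.discProj T r * U) ∧
        (∀ V : NormalDist.Dbl H →L[ℂ] NormalDist.Dbl H,
          NormalDist.IsUnitaryPolarPart T V →
          U * (NormalDist.discProj T 2 - NormalDist.discProj T 1) =
            V * (NormalDist.discProj T 2 - NormalDist.discProj T 1)) ∧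
        ‖NormalDist.projFst H * U - U * NormalDist.projFst H‖ ≤
          C * ‖NormalDist.projFst H * T - T * NormalDist.projFst H‖ ∧
        ∃ hU : Set.MapsTo U (NormalDist.discProj T 2).range (NormalDist.discProj T 2).range,
          spectrum ℂ (U.restrict hU) ⊆ NormalDist.line θ ∩ Metric.sphere 0 1 := by
  obtain ⟨δ, C, hδ, hC, key⟩ := NormalDist.exists_modified_unitary_part_of_mem_M2
  refine ⟨δ, C, hδ, hC, ?_⟩
  intro H _ _ _ A hA hr T hT hn θ hθ hs hd h1 h2
  obtain ⟨U, hU, hUA, hUd, hPU, ha, hb, hc⟩ := key hA hr hT hn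
    (Complex.norm_exp_ofReal_mul_I θ) (NormalDist.exp_mem_slitPlane hθ)
    (fun z hz h => hs ⟨hz, mem_ball_zero_iff.2 h⟩) hd h1 h2
  have hinv : Set.MapsTo U (NormalDist.discProj T 2).range (NormalDist.discProj T 2).range := by
    intro y hy
    rw [SetLike.mem_coe, NormalDist.range_discProj] at hy ⊢
    exact NormalDist.apply_mem_spectralSubspace_of_commute ha one_le_two hy
  refine ⟨U, hUA, hU, hUd, fun r hr1 _ => NormalDist.mul_discProj_eq_discProj_mul ha hr1,
    fun V hV => NormalDist.mul_discProj_sub_eq fun f hf h0 h0' =>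
      NormalDist.polarPart_mul_cfc hc hV hf h0 h0', hPU, hinv, ?_⟩
  have hsq : U.restrict hinv * U.restrict hinv =
      Complex.exp (θ * Complex.I) ^ 2 • (1 : _ →L[ℂ] (NormalDist.discProj T 2).range) := by
    refine ContinuousLinearMap.ext fun ⟨y, hy⟩ => Subtype.ext ?_
    rw [NormalDist.range_discProj] at hy
    refine NormalDist.eq_on_spectralSubspace (X := U * U)
      (Y := Complex.exp (θ * Complex.I) ^ 2 • 1) (fun f hf h0 => ?_) hy
    rw [mul_assoc, hb f hf fun z hz => h0 z (by rw [mem_ball_zero_iff, not_lt]; exact hz),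
      smul_mul_assoc, one_mul]
  refine (NormalDist.spectrum_subset_of_sq_eq hsq).trans ?_
  rintro z (rfl | rfl)
  · exact ⟨⟨1, by simp⟩, mem_sphere_zero_iff_norm.2 (Complex.norm_exp_ofReal_mul_I θ)⟩
  · exact ⟨⟨-1, by simp⟩, mem_sphere_zero_iff_norm.2 (by
      rw [norm_neg, Complex.norm_exp_ofReal_mul_I])⟩
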